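/- Let $d\in\mathbb N$ and consider functions and tempered distributions (real or complex valued) on $\mathbb R\times\mathbb R^d$, with variables $(t,x)$; $D_x$ and $\Delta$ denote the gradient and the Laplacian in the space variable $x$, and all derivatives are taken in the sense of distributions. For $1<p,q<\infty$ and $0<\beta<\frac2p+\frac dq$, let $E_{p,q,\beta}$ and $F_{p,q,\beta}$ be the spaces of locally integrable (scalar or vector valued) functions $f$ on $\mathbb R\times\mathbb R^d$ for which, respectively, $$\|f\|_{E_{p,q,\beta}}=\sup_{\rho>0,\,t\in\mathbb R,\,x\in\mathbb R^d}\rho^{\beta-\frac2p-\frac dq}\Big(\int_{|t-s|<\rho^2}\Big(\int_{|x-y|<\rho}|f(s,y)|^q\,dy\Big)^{\frac pq}ds\Big)^{\frac1p}<\infty,$$ $$\|f\|_{F_{p,q,\beta}}=\sup_{\rho>0,\,t\in\mathbb R,\,x\in\mathbb R^d}\rho^{\beta-\frac2p-\frac dq}\Big(\int_{|x-y|<\rho}\Big(\int_{|t-s|<\rho^2}|f(s,y)|^p\,ds\Big)^{\frac qp}dy\Big)^{\frac1q}<\infty.$$ For $\delta>0$, let $\mathcal B^{-\delta}_{[2],\infty,\infty}$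 be the space of tempered distributions $u$ on $\mathbb R\times\mathbb R^d$ such that $$\|u\|_{\mathcal B^{-\delta}_{[2],\infty,\infty}}=\sup_{\theta>0}\theta^{\delta/2}\big\|e^{\theta^2(\partial_t^2-\Delta^2)}u\big\|_{L^\infty(\mathbb R\times\mathbb R^d)}<\infty,$$ where $e^{\theta^2(\partial_t^2-\Delta^2)}$ is the Fourier multiplier with symbol $e^{-\theta^2(\tau^2+|\xi|^4)}$ ($\tau$ and $\xi$ being the frequencies dual to $t$ and $x$, normalized so that $\partial_t$ and $\partial_{x_j}$ have symbols $i\tau$ and $i\xi_j$). **Proposition (Gagliardo--Nirenberg inequality).** Let $\delta>0$, $1<p,q<\infty$ and $0<\beta<\frac2p+\frac dq$. There is a constant $C$, depending only on $d,\delta,p,q,\beta$, such that: a) if $u\in\mathcal B^{-\delta}_{[2],\infty,\infty}$ and $\partial_tu,\Delta u\in E_{p,q,\beta}$, then $D_xu$ is a locally integrable function and $$\|D_xu\|_{E_{\frac{2+\delta}{1+\delta}p,\frac{2+\delta}{1+\delta}q,\frac{1+\delta}{2+\delta}\beta}}\le C\,\|u\|_{\mathcal B^{-\delta}_{[2],\infty,\infty}}^{\frac1{2+\delta}}\big(\|\partial_tu\|_{E_{p,q,\beta}}+\|\Delta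 u\|_{E_{p,q,\beta}}\big)^{\frac{1+\delta}{2+\delta}};$$ b) if $u\in\mathcal B^{-\delta}_{[2],\infty,\infty}$ and $\partial_tu,\Delta u\in F_{p,q,\beta}$, then $D_xu$ is a locally integrable function and $$\|D_xu\|_{F_{\frac{2+\delta}{1+\delta}p,\frac{2+\delta}{1+\delta}q,\frac{1+\delta}{2+\delta}\beta}}\le C\,\|u\|_{\mathcal B^{-\delta}_{[2],\infty,\infty}}^{\frac1{2+\delta}}\big(\|\partial_tu\|_{F_{p,q,\beta}}+\|\Delta u\|_{F_{p,q,\beta}}\big)^{\frac{1+\delta}{2+\delta}}.$$ -/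

import Mathlib

open MeasureTheory SchwartzMap LineDeriv
open scoped ENNReal NNReal

noncomputable section

namespace ParabolicGN

/-- Space-time `ℝ × ℝ^d`, with Lebesgue measure. The `ℓ²` product structure only serves to make it
a Euclidean space, so that Mathlib's Fourier transform applies. -/
abbrev SpaceTime (d : ℕ) : Type := WithLp 2 (ℝ × EuclideanSpace ℝ (Fin d))

/-- The point `(t, x)`. -/
abbrev pt {d : ℕ} (t : ℝ) (x : EuclideanSpace ℝ (Fin d)) : SpaceTime d := WithLp.toLp 2 (t, x)

/-- `∂_t u`, in the sense of distributions. -/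
def timeDeriv {d : ℕ} (u : 𝓢'(SpaceTime d, ℂ)) : 𝓢'(SpaceTime d, ℂ) :=
  ∂_{pt (d := d) 1 0} u

/-- `∂_{x_i} u`, in the sense of distributions. -/
def spaceDeriv {d : ℕ} (i : Fin d) (u : 𝓢'(SpaceTime d, ℂ)) : 𝓢'(SpaceTime d, ℂ) :=
  ∂_{pt 0 (EuclideanSpace.single i (1 : ℝ))} u

/-- The Laplacian in the space variables, `Δ u = ∑ i, ∂_{x_i}² u`. -/
def spaceLaplacian {d : ℕ} (u : 𝓢'(SpaceTime d, ℂ)) : 𝓢'(SpaceTime d, ℂ) :=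
  ∑ i, spaceDeriv i (spaceDeriv i u)

/-- The distribution `v` is (given by integration against) the locally integrable function `f`.
Schwartz functions with compact support are exactly the smooth compactly supported functions. -/
def IsRepresentedBy {d : ℕ} (v : 𝓢'(SpaceTime d, ℂ)) (f : SpaceTime d → ℂ) : Prop :=
  LocallyIntegrable f ∧
    ∀ φ : 𝓢(SpaceTime d, ℂ), HasCompactSupport (φ : SpaceTime d → ℂ) → v φ = ∫ z, φ z * f z

/-- The norm of `f` in the mixed-norm parabolic Morrey space `E_{p,q,β}` (inner integral in `x`). -/
def normE {d : ℕ} {V : Type*} [NormedAddCommGroup V] (p q β : ℝ) (f : SpaceTime d → V) : ℝ≥0∞ :=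
  ⨆ (ρ : ℝ) (_ : 0 < ρ) (t : ℝ) (x : EuclideanSpace ℝ (Fin d)),
    ENNReal.ofReal (ρ ^ (β - 2 / p - d / q)) *
      (∫⁻ s in {s : ℝ | |t - s| < ρ ^ 2},
        (∫⁻ y in {y : EuclideanSpace ℝ (Fin d) | ‖x - y‖ < ρ}, ‖f (pt s y)‖ₑ ^ q) ^ (p / q))
          ^ (1 / p)

/-- The norm of `f` in the mixed-norm parabolic Morrey space `F_{p,q,β}` (inner integral in `t`). -/
def normF {d : ℕ} {V : Type*} [NormedAddCommGroup V] (p q β : ℝ) (f : SpaceTime d → V) : ℝ≥0∞ :=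
  ⨆ (ρ : ℝ) (_ : 0 < ρ) (t : ℝ) (x : EuclideanSpace ℝ (Fin d)),
    ENNReal.ofReal (ρ ^ (β - 2 / p - d / q)) *
      (∫⁻ y in {y : EuclideanSpace ℝ (Fin d) | ‖x - y‖ < ρ},
        (∫⁻ s in {s : ℝ | |t - s| < ρ ^ 2}, ‖f (pt s y)‖ₑ ^ p) ^ (q / p))
          ^ (1 / q)

/-- The symbol of `exp(θ² (∂_t² - Δ²))`. Mathlib's Fourier transform has the kernel
`exp(-2πi ⟨z, ζ⟩)`, so `∂_t²` has symbol `-(2πτ)²` and `Δ²` has symbol `(2π|ξ|)⁴`. -/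
def biheatSymbol {d : ℕ} (θ : ℝ) (ζ : SpaceTime d) : ℂ :=
  ((Real.exp (-(θ ^ 2 * ((2 * Real.pi * ζ.fst) ^ 2 + (2 * Real.pi * ‖ζ.snd‖) ^ 4))) : ℝ) : ℂ)

theorem gaussian_hasTemperateGrowth :
    Function.HasTemperateGrowth (fun x : ℝ => Real.exp (-(x ^ 2 / 2))) := by
  refine ⟨by fun_prop, fun n => ?_⟩
  have hP : Function.HasTemperateGrowth
      (fun x : ℝ => Polynomial.aeval x (Polynomial.hermite n)) := by
    simp only [Polynomial.aeval_eq_sum_range, zsmul_eq_mul]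
    refine Function.HasTemperateGrowth.sum fun i _ => ?_
    exact (Function.HasTemperateGrowth.const _).mul (Function.HasTemperateGrowth.id'.pow i)
  obtain ⟨k, C, hC⟩ := hP.2 0
  refine ⟨k, C, fun x => ?_⟩
  rw [norm_iteratedFDeriv_eq_norm_iteratedDeriv, iteratedDeriv_eq_iterate,
    Polynomial.deriv_gaussian_eq_hermite_mul_gaussian]
  have h := hC x
  rw [norm_iteratedFDeriv_zero] at h
  have he : ‖Real.exp (-(x ^ 2 / 2))‖ ≤ 1 := by
    rw [Real.norm_eq_abs, Real.abs_exp, Real.exp_le_one_iff]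
    have := sq_nonneg x
    linarith
  rw [norm_mul, norm_mul, norm_pow, norm_neg, norm_one, one_pow, one_mul]
  calc _ ≤ ‖Polynomial.aeval x (Polynomial.hermite n)‖ * 1 := by gcongr
    _ ≤ _ := by rw [mul_one]; exact h

/-- The symbol is an admissible Fourier multiplier on tempered distributions. -/
theorem biheatSymbol_hasTemperateGrowth {d : ℕ} (θ : ℝ) :
    Function.HasTemperateGrowth (biheatSymbol (d := d) θ) := by
  have h1 : Function.HasTemperateGrowth (fun ζ : SpaceTime d => ζ.fst) :=
    (WithLp.fstL 2 ℝ ℝ (EuclideanSpace ℝ (Fin d))).hasTemperateGrowth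
  have h2 : Function.HasTemperateGrowth (fun ζ : SpaceTime d => ζ.snd) :=
    (WithLp.sndL 2 ℝ ℝ (EuclideanSpace ℝ (Fin d))).hasTemperateGrowth
  have h3 : Function.HasTemperateGrowth (fun ζ : SpaceTime d => ‖ζ.snd‖ ^ 2) :=
    (Function.hasTemperateGrowth_norm_sq (EuclideanSpace ℝ (Fin d))).comp h2
  have e : biheatSymbol (d := d) θ = fun ζ =>
      (((fun x : ℝ => Real.exp (-(x ^ 2 / 2))) (Real.sqrt 2 * θ * (2 * Real.pi) * ζ.fst) *
       (fun x : ℝ => Real.exp (-(x ^ 2 / 2)))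
        (Real.sqrt 2 * θ * (2 * Real.pi) ^ 2 * ‖ζ.snd‖ ^ 2) : ℝ) : ℂ) := by
    funext ζ
    unfold biheatSymbol
    simp only
    rw [← Real.exp_add]
    congr 2
    simp only [mul_pow, Real.sq_sqrt (show (0 : ℝ) ≤ 2 by norm_num)]
    ring
  rw [e]
  have h4 := gaussian_hasTemperateGrowth.comp
    ((Function.HasTemperateGrowth.const (Real.sqrt 2 * θ * (2 * Real.pi))).mul h1)
  have h5 := gaussian_hasTemperateGrowth.comp
    ((Function.HasTemperateGrowth.const (Real.sqrt 2 * θ * (2 * Real.pi) ^ 2)).mul h3)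
  exact Complex.ofRealCLM.hasTemperateGrowth.comp (h4.mul h5)

/-- The operator `exp(θ² (∂_t² - Δ²))` on tempered distributions. -/
def biheat {d : ℕ} (θ : ℝ) (u : 𝓢'(SpaceTime d, ℂ)) : 𝓢'(SpaceTime d, ℂ) :=
  TemperedDistribution.fourierMultiplierCLM ℂ (biheatSymbol θ) u

/-- The `L^∞` norm of a tempered distribution, equal to `∞` if it is not a bounded function. -/
def normLinfty {d : ℕ} (v : 𝓢'(SpaceTime d, ℂ)) : ℝ≥0∞ :=
  ⨅ (f : Lp ℂ ∞ (volume : Measure (SpaceTime d))) (_ : Lp.toTemperedDistribution f = v), ‖f‖ₑ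

/-- The norm in the parabolic Besov space `B^{-δ}_{[2],∞,∞}`; a tempered distribution belongs to
this space when the norm is finite. -/
def normBesov {d : ℕ} (δ : ℝ) (u : 𝓢'(SpaceTime d, ℂ)) : ℝ≥0∞ :=
  ⨆ (θ : ℝ) (_ : 0 < θ), ENNReal.ofReal (θ ^ (δ / 2)) * normLinfty (biheat θ u)

/-- The function `G` is the distributional space gradient `D_x u`. -/
def IsSpaceGradient {d : ℕ} (u : 𝓢'(SpaceTime d, ℂ))
    (G : SpaceTime d → EuclideanSpace ℂ (Fin d)) : Prop :=
  ∀ i, IsRepresentedBy (spaceDeriv i u) (fun z => G z i)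

end ParabolicGN

end

open ParabolicGN

/-! The heart of the matter is a pointwise bound, valid almost everywhere: |D_x u| ≤ C ‖u‖^{1/(2+δ)}
(M(∂_t u) + M(Δu))^{(1+δ)/(2+δ)}, where ‖u‖ is the Besov norm and M the maximal function over
parabolic cylinders of dyadic radii (`exists_spaceGradient_bound`).

Put Q = (2πτ)² + (2π|ξ|)⁴ and regularise ∂_i u at scale 2^k by the multiplier exp(-Q) composed with
the parabolic dilation of ratio 2^k. Half of the exponent is a biheat operator acting on u, the
other half absorbs the derivative, so the regularisation is O(2^{-k(1+δ)} ‖u‖). Going from scale 2^k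
to 2^{k-1} changes the symbol by ξ_i (exp(-Q/16) - exp(-Q)), dilated. This vanishes at the origin in
such a way that it equals τ α + |ξ|² β up to constants, with α and β Schwartz
(`exists_symbol_decomposition`). Hence the change is O(2^k (M(∂_t u) + M(Δu))), because a dilated
Schwartz kernel is controlled by M (`exists_lintegral_kernel_le_parMax`). Summing over all finer
scales gives |∂_i u| ≤ C (2^{-k(1+δ)} ‖u‖ + 2^k (M(∂_t u) + M(Δu))) for every integer k, and the
best k gives the pointwise bound.

Taking the power (1+δ)/(2+δ) turns the norm with exponents (p, q, β) into the one in the conclusion,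
so it remains to bound M on mixed-norm Morrey spaces (`exists_morrey_cylMax_le`). Averages over
cylinders larger than the one under consideration are bounded by the Morrey norm, as β > 0. Smaller
cylinders see only a doubled cylinder, and there M is dominated by two one-variable maximal
operators applied in turn. The outer one acts on functions with values in L^Q
(`exists_lintegral_hlMax_mixed_le`): for P ≤ Q a factorisation and Hölder's inequality reduce it to
the scalar case, and for Q < P one dualises against the weighted Fefferman–Stein inequality
(`exists_lintegral_hlMax_rpow_le`).

The families E and F differ only in the order of integration, so `exists_gagliardoNirenberg` is
stated for any pair of norms having the few properties that are used. -/

set_option linter.unusedSectionVars false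

noncomputable section

namespace ParabolicGN

/-! ### Weighted Hardy–Littlewood maximal inequalities. -/

section HardyLittlewood

open Metric Set

variable {E : Type*} [NormedAddCommGroup E] [MeasurableSpace E]

/-- The average of `g` over the closed ball of radius `2 ^ k` around `x`. -/
def ballAvg (μ : Measure E) (k : ℤ) (g : E → ℝ≥0∞) (x : E) : ℝ≥0∞ :=
  (μ (closedBall 0 (2 ^ k : ℝ)))⁻¹ * ∫⁻ y in closedBall x (2 ^ k : ℝ), g y ∂μ

/-- The centred Hardy–Littlewood maximal function over balls of dyadic radii. -/
def hlMax (μ : Measure E) (g : E → ℝ≥0∞) (x : E) : ℝ≥0∞ := ⨆ k : ℤ, ballAvg μ k g x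

theorem ballAvg_le_hlMax (μ : Measure E) (k : ℤ) (g : E → ℝ≥0∞) (x : E) :
    ballAvg μ k g x ≤ hlMax μ g x :=
  le_iSup (fun k => ballAvg μ k g x) k

theorem hlMax_le {μ : Measure E} {g : E → ℝ≥0∞} {x : E} {c : ℝ≥0∞}
    (h : ∀ k, ballAvg μ k g x ≤ c) : hlMax μ g x ≤ c :=
  iSup_le h

theorem ballAvg_mono {μ : Measure E} {k : ℤ} {g h : E → ℝ≥0∞} (hgh : g ≤ᵐ[μ] h) (x : E) :
    ballAvg μ k g x ≤ ballAvg μ k h x := by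
  unfold ballAvg
  gcongr 1
  exact lintegral_mono_ae (ae_restrict_of_ae hgh)

theorem hlMax_mono {μ : Measure E} {g h : E → ℝ≥0∞} (hgh : g ≤ᵐ[μ] h) (x : E) :
    hlMax μ g x ≤ hlMax μ h x :=
  iSup_mono fun _ => ballAvg_mono hgh x

theorem hlMax_add_le {μ : Measure E} {g h : E → ℝ≥0∞} (hg : Measurable g) (x : E) :
    hlMax μ (fun y => g y + h y) x ≤ hlMax μ g x + hlMax μ h x := by
  refine iSup_le fun k => ?_
  unfold ballAvg
  rw [lintegral_add_left hg, mul_add]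
  exact add_le_add (ballAvg_le_hlMax μ k g x) (ballAvg_le_hlMax μ k h x)

variable [NormedSpace ℝ E] [FiniteDimensional ℝ E] [BorelSpace E]

theorem closedBall_measure_eq (μ : Measure E) [μ.IsAddHaarMeasure] (k : ℤ) (x : E) :
    μ (closedBall x (2 ^ k : ℝ)) = μ (closedBall 0 (2 ^ k : ℝ)) := by
  rw [Measure.addHaar_closedBall_center]

theorem closedBall_measure_ne_zero (μ : Measure E) [μ.IsAddHaarMeasure] (k : ℤ) :
    μ (closedBall (0 : E) (2 ^ k : ℝ)) ≠ 0 :=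
  (measure_closedBall_pos μ 0 (by positivity)).ne'

theorem closedBall_measure_ne_top (μ : Measure E) [μ.IsAddHaarMeasure] (k : ℤ) :
    μ (closedBall (0 : E) (2 ^ k : ℝ)) ≠ ∞ :=
  measure_closedBall_lt_top.ne

theorem closedBall_measure_add (μ : Measure E) [μ.IsAddHaarMeasure] (k : ℤ) (j : ℕ) :
    μ (closedBall (0 : E) (2 ^ (k + j) : ℝ)) =
      2 ^ (j * Module.finrank ℝ E) * μ (closedBall (0 : E) (2 ^ k : ℝ)) := by
  rw [Measure.addHaar_closedBall _ _ (by positivity), Measure.addHaar_closedBall _ _ (by positivity),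
    zpow_add₀ two_ne_zero, mul_pow, ENNReal.ofReal_mul (by positivity), ← mul_assoc,
    mul_comm (ENNReal.ofReal _) (ENNReal.ofReal _)]
  congr 2
  rw [zpow_natCast, ← pow_mul, ENNReal.ofReal_pow (by norm_num)]
  simp

theorem hlMax_const_le (μ : Measure E) [μ.IsAddHaarMeasure] (c : ℝ≥0∞) (x : E) :
    hlMax μ (fun _ => c) x ≤ c := by
  refine iSup_le fun k => ?_
  unfold ballAvg
  rw [setLIntegral_const, closedBall_measure_eq μ k x, mul_left_comm,
    ENNReal.inv_mul_cancel (closedBall_measure_ne_zero μ k) (closedBall_measure_ne_top μ k), mul_one]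

theorem measurable_ballAvg {α : Type*} [MeasurableSpace α] {μ : Measure E} [SFinite μ] (k : ℤ)
    {g : α × E → ℝ≥0∞} (hg : Measurable g) :
    Measurable fun z : α × E => ballAvg μ k (fun y => g (z.1, y)) z.2 := by
  unfold ballAvg
  refine Measurable.const_mul ?_ _
  have : ∀ z : α × E, ∫⁻ y in closedBall z.2 (2 ^ k : ℝ), g (z.1, y) ∂μ =
      ∫⁻ y, {w : (α × E) × E | dist w.2 w.1.2 ≤ 2 ^ k}.indicator (fun w => g (w.1.1, w.2)) (z, y) ∂μ := by
    intro z
    rw [← lintegral_indicator measurableSet_closedBall]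
    rfl
  simp only [this]
  refine Measurable.lintegral_prod_right' (Measurable.indicator ?_ ?_)
  · exact hg.comp (by fun_prop)
  · exact measurableSet_le (by fun_prop) measurable_const

theorem measurable_hlMax_prod {α : Type*} [MeasurableSpace α] {μ : Measure E} [SFinite μ]
    {g : α × E → ℝ≥0∞} (hg : Measurable g) :
    Measurable fun z : α × E => hlMax μ (fun y => g (z.1, y)) z.2 :=
  Measurable.iSup fun k => measurable_ballAvg k hg

theorem measurable_hlMax {μ : Measure E} [SFinite μ] {g : E → ℝ≥0∞} (hg : Measurable g) :
    Measurable (hlMax μ g) :=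
  (measurable_hlMax_prod (α := Unit) (hg.comp measurable_snd)).comp
    (f := fun x => ((), x)) (by fun_prop)

/-- The enlarged ball lies in the ball of radius 5 · 2 ^ k around `y`; rounding 5 up to 8 makes the
radius dyadic. This is how the weight is replaced by its maximal function on a Vitali ball. -/
theorem lintegral_closedBall_le_hlMax (μ : Measure E) [μ.IsAddHaarMeasure] (k : ℤ) (w : E → ℝ≥0∞)
    {x y : E} (hy : y ∈ closedBall x (2 ^ k : ℝ)) :
    ∫⁻ z in closedBall x (4 * 2 ^ k : ℝ), w z ∂μ ≤
      8 ^ Module.finrank ℝ E * μ (closedBall (0 : E) (2 ^ k : ℝ)) * hlMax μ w y := by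
  have h1 : closedBall x (4 * 2 ^ k : ℝ) ⊆ closedBall y (2 ^ (k + (3 : ℕ)) : ℝ) := by
    refine closedBall_subset_closedBall' ?_
    rw [mem_closedBall, dist_comm] at hy
    rw [zpow_add₀ two_ne_zero]
    have : (0 : ℝ) < 2 ^ k := by positivity
    norm_num
    linarith
  have h2 := ballAvg_le_hlMax μ (k + (3 : ℕ)) w y
  unfold ballAvg at h2
  rw [ENNReal.inv_mul_le_iff (closedBall_measure_ne_zero μ _) (closedBall_measure_ne_top μ _),
    closedBall_measure_add, pow_mul] at h2
  norm_num at h2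
  exact (lintegral_mono_set h1).trans (by simpa using h2)

/-- Weak-type inequality for the maximal function, with a weight. -/
theorem lintegral_hlMax_gt_le (μ : Measure E) [μ.IsAddHaarMeasure] {g w : E → ℝ≥0∞}
    (hg : Measurable g) (hw : Measurable w) {l : ℝ≥0∞} (hl : l ≠ 0) (hl' : l ≠ ∞) :
    ∫⁻ x in {x | l < hlMax μ g x}, w x ∂μ ≤
      8 ^ Module.finrank ℝ E * l⁻¹ * ∫⁻ x, g x * hlMax μ w x ∂μ := by
  -- The Vitali covering lemma needs bounded radii, so the scales are capped at `K`; the sets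
  -- increase to the full level set.
  set S : ℕ → Set E := fun K => {x | ∃ k : ℤ, k ≤ K ∧ l < ballAvg μ k g x} with hS
  have hSm : Monotone S := by
    intro K L hKL x ⟨k, hk, h⟩
    exact ⟨k, hk.trans (by exact_mod_cast hKL), h⟩
  have hSu : {x | l < hlMax μ g x} = ⋃ K, S K := by
    ext x
    simp only [mem_ofPred_eq, hlMax, lt_iSup_iff, mem_iUnion, hS]
    constructor
    · rintro ⟨k, hk⟩
      exact ⟨k.toNat, k, Int.self_le_toNat k, hk⟩
    · rintro ⟨K, k, -, hk⟩
      exact ⟨k, hk⟩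
  rw [hSu, setLIntegral_iUnion_of_directed _ (directed_of_isDirected_le hSm)]
  refine iSup_le fun K => ?_
  choose! k hkK hk using fun x (hx : x ∈ S K) => hx
  obtain ⟨u, huS, hud, hu⟩ := Vitali.exists_disjoint_subfamily_covering_enlargement_closedBall
    (S K) (fun x : E => x) (fun x => (2 : ℝ) ^ k x) (2 ^ (K : ℤ))
    (fun x hx => zpow_le_zpow_right₀ (by norm_num) (hkK x hx)) 4 (by norm_num)
  have huc : u.Countable := hud.countable_of_nonempty_interior fun x _ =>
    ⟨x, ball_subset_interior_closedBall (mem_ball_self (by positivity))⟩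
  have hcov : S K ⊆ ⋃ b ∈ u, closedBall b (4 * 2 ^ k b) := by
    intro x hx
    obtain ⟨b, hb, hxb⟩ := hu x hx
    exact mem_biUnion hb (hxb (mem_closedBall_self (by positivity)))
  have hone : ∀ b ∈ u, ∫⁻ x in closedBall b (4 * 2 ^ k b), w x ∂μ ≤
      8 ^ Module.finrank ℝ E * l⁻¹ * ∫⁻ x in closedBall b (2 ^ k b), g x * hlMax μ w x ∂μ := by
    intro b hb
    set I := ∫⁻ x in closedBall b (4 * 2 ^ k b), w x ∂μ
    set V := μ (closedBall (0 : E) (2 ^ k b : ℝ))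
    have hV0 : V ≠ 0 := closedBall_measure_ne_zero μ _
    have hVt : V ≠ ∞ := closedBall_measure_ne_top μ _
    have h1 : l * V ≤ ∫⁻ x in closedBall b (2 ^ k b : ℝ), g x ∂μ := by
      have := (hk b (huS hb)).le
      unfold ballAvg at this
      rwa [mul_comm, ← ENNReal.le_div_iff_mul_le (Or.inl hl) (Or.inl hl'),
        ENNReal.le_div_iff_mul_le (Or.inl hl) (Or.inl hl'), mul_comm,
        ← ENNReal.le_div_iff_mul_le (Or.inl hV0) (Or.inl hVt), div_eq_mul_inv, mul_comm]
    -- `I` is at most `8 ^ n * V` times the maximal function of `w` at every point of the small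
    -- ball, `n` being the dimension; integrate this against `g`.
    have h2 : I * ∫⁻ x in closedBall b (2 ^ k b : ℝ), g x ∂μ ≤
        8 ^ Module.finrank ℝ E * V * ∫⁻ x in closedBall b (2 ^ k b), g x * hlMax μ w x ∂μ := by
      rw [← lintegral_const_mul _ hg,
        ← lintegral_const_mul (f := fun x => g x * hlMax μ w x) _ (hg.mul (measurable_hlMax hw))]
      refine setLIntegral_mono
        ((hg.mul (measurable_hlMax hw)).const_mul _) fun x hx => ?_
      have := lintegral_closedBall_le_hlMax μ (k b) w hx
      calc I * g x ≤ (8 ^ Module.finrank ℝ E * V * hlMax μ w x) * g x := by gcongr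
        _ = _ := by ring
    have h3 : (l * V) * I ≤ (l * V) *
        (8 ^ Module.finrank ℝ E * l⁻¹ * ∫⁻ x in closedBall b (2 ^ k b), g x * hlMax μ w x ∂μ) := by
      calc (l * V) * I ≤ I * ∫⁻ x in closedBall b (2 ^ k b : ℝ), g x ∂μ := by
            rw [mul_comm]; gcongr
        _ ≤ _ := h2
        _ = (l * l⁻¹) * (8 ^ Module.finrank ℝ E * V *
              ∫⁻ x in closedBall b (2 ^ k b), g x * hlMax μ w x ∂μ) := by
            rw [ENNReal.mul_inv_cancel hl hl', one_mul]
        _ = _ := by ring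
    exact (ENNReal.mul_le_mul_iff_right (mul_ne_zero hl hV0) (ENNReal.mul_ne_top hl' hVt)).1 h3
  have := huc.to_subtype
  calc ∫⁻ x in S K, w x ∂μ ≤ ∫⁻ x in ⋃ b ∈ u, closedBall b (4 * 2 ^ k b), w x ∂μ :=
        lintegral_mono_set hcov
    _ ≤ ∑' b : u, ∫⁻ x in closedBall (b : E) (4 * 2 ^ k b), w x ∂μ := by
        rw [biUnion_eq_iUnion]
        exact lintegral_iUnion_le _ _
    _ ≤ ∑' b : u, 8 ^ Module.finrank ℝ E * l⁻¹ *
          ∫⁻ x in closedBall (b : E) (2 ^ k b), g x * hlMax μ w x ∂μ :=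
        ENNReal.tsum_le_tsum fun b => hone b b.2
    _ = 8 ^ Module.finrank ℝ E * l⁻¹ *
          ∫⁻ x in ⋃ b ∈ u, closedBall b (2 ^ k b), g x * hlMax μ w x ∂μ := by
        rw [ENNReal.tsum_mul_left, lintegral_biUnion huc (fun _ _ => measurableSet_closedBall) hud]
    _ ≤ _ := by
        gcongr
        exact Measure.restrict_le_self

/-- The layer-cake formula for a constant function on a one-point space. The value `∞` is reached
through all finite values below it. -/
theorem ENNReal_rpow_eq_lintegral {q : ℝ} (hq : 0 < q) (X : ℝ≥0∞) :
    X ^ q = ENNReal.ofReal q * ∫⁻ t in Ioi (0 : ℝ),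
      (if ENNReal.ofReal t < X then 1 else 0) * ENNReal.ofReal (t ^ (q - 1)) := by
  have key : ∀ x : ℝ, 0 ≤ x → ENNReal.ofReal x ^ q = ENNReal.ofReal q * ∫⁻ t in Ioi (0 : ℝ),
      (if ENNReal.ofReal t < ENNReal.ofReal x then 1 else 0) * ENNReal.ofReal (t ^ (q - 1)) := by
    intro x hx
    have := lintegral_rpow_eq_lintegral_meas_lt_mul (Measure.dirac ()) (f := fun _ => x)
      (Filter.Eventually.of_forall fun _ => hx) (by fun_prop) hq
    simp only [lintegral_dirac] at this
    rw [ENNReal.ofReal_rpow_of_nonneg hx hq.le, this]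
    congr 1
    refine setLIntegral_congr_fun measurableSet_Ioi fun t ht => ?_
    have : (ENNReal.ofReal t < ENNReal.ofReal x) ↔ t < x :=
      ENNReal.ofReal_lt_ofReal_iff_of_nonneg (le_of_lt ht)
    by_cases h : t < x <;> simp [this, h]
  by_cases hX : X = ∞
  · subst hX
    rw [ENNReal.top_rpow_of_pos hq]
    refine (eq_top_iff.2 ?_).symm
    refine ENNReal.le_of_forall_nnreal_lt fun r _ => ?_
    have h1 := key ((r : ℝ) ^ q⁻¹) (by positivity)
    rw [ENNReal.ofReal_rpow_of_nonneg (by positivity) hq.le, ← Real.rpow_mul r.coe_nonneg,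
      inv_mul_cancel₀ hq.ne', Real.rpow_one, ENNReal.ofReal_coe_nnreal] at h1
    rw [h1]
    gcongr 1
    refine lintegral_mono fun t => ?_
    gcongr 1
    split_ifs <;> simp_all
  · rw [← ENNReal.ofReal_toReal hX]
    exact key _ ENNReal.toReal_nonneg

/-- The part of `g` not exceeding `l / 2` contributes at most `l / 2` to the maximal function, so
the part above `l / 2` must exceed the other half. This is the form of the weak bound that can be
integrated in `l`. -/
theorem setLIntegral_hlMax_gt_le_truncated (μ : Measure E) [μ.IsAddHaarMeasure] {g w : E → ℝ≥0∞}
    (hg : Measurable g) (hw : Measurable w) {l : ℝ≥0∞} (hl : l ≠ 0) (hl' : l ≠ ∞) :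
    ∫⁻ x in {x | l < hlMax μ g x}, w x ∂μ ≤ 8 ^ Module.finrank ℝ E * (l / 2)⁻¹ *
      ∫⁻ x, {x | l < 2 * g x}.indicator (fun x => g x * hlMax μ w x) x ∂μ := by
  set A := {x | l < 2 * g x}
  have hA : MeasurableSet A := measurableSet_lt measurable_const (hg.const_mul 2)
  have h1 : {x | l < hlMax μ g x} ⊆ {x | l / 2 < hlMax μ (A.indicator g) x} := by
    intro x hx
    have h2 : hlMax μ g x ≤ hlMax μ (A.indicator g) x + l / 2 := by
      calc hlMax μ g x ≤ hlMax μ (fun y => A.indicator g y + l / 2) x := by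
            refine hlMax_mono (Filter.Eventually.of_forall fun y => ?_) x
            by_cases hy : y ∈ A
            · simp [hy]
            · simp only [hy, not_false_eq_true, indicator_of_notMem, zero_add]
              rw [ENNReal.le_div_iff_mul_le (by simp) (by simp), mul_comm]
              exact not_lt.1 hy
        _ ≤ _ := (hlMax_add_le (hg.indicator hA) x).trans
              (add_le_add_right (hlMax_const_le μ _ x) _)
    by_contra h3
    have h4 : hlMax μ (A.indicator g) x ≤ l / 2 := not_lt.1 h3
    have := h2.trans (add_le_add_left h4 _)
    rw [ENNReal.add_halves] at this
    exact absurd hx (not_lt.2 this)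
  refine (lintegral_mono_set h1).trans ((lintegral_hlMax_gt_le μ (hg.indicator hA) hw
    (by simp [hl]) (ENNReal.div_ne_top hl' (by simp))).trans (le_of_eq ?_))
  congr 2
  ext x
  by_cases hx : x ∈ A <;> simp [hx]

/-- Strong-type inequality for the maximal function, with a weight. -/
theorem exists_lintegral_hlMax_rpow_le (μ : Measure E) [μ.IsAddHaarMeasure] {q : ℝ} (hq : 1 < q) :
    ∃ C : ℝ≥0, ∀ g w : E → ℝ≥0∞, Measurable g → Measurable w →
      ∫⁻ x, hlMax μ g x ^ q * w x ∂μ ≤ C * ∫⁻ x, g x ^ q * hlMax μ w x ∂μ := by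
  have hq1 : 0 < q - 1 := by linarith
  have h2 : (ENNReal.ofReal (q - 1))⁻¹ * (2 : ℝ≥0∞) ^ (q - 1) ≠ ∞ := by
    refine ENNReal.mul_ne_top ?_ (ENNReal.rpow_ne_top_of_nonneg hq1.le (by simp))
    simpa using hq
  set c : ℝ≥0∞ := ENNReal.ofReal q * (8 ^ Module.finrank ℝ E * 2)
  have hc : c ≠ ∞ := ENNReal.mul_ne_top ENNReal.ofReal_ne_top (ENNReal.mul_ne_top (by simp) (by simp))
  refine ⟨(c * ((ENNReal.ofReal (q - 1))⁻¹ * (2 : ℝ≥0∞) ^ (q - 1))).toNNReal, fun g w hg hw => ?_⟩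
  rw [ENNReal.coe_toNNReal (ENNReal.mul_ne_top hc h2)]
  have hM := measurable_hlMax (μ := μ) hg
  have hMw := measurable_hlMax (μ := μ) hw
  calc ∫⁻ x, hlMax μ g x ^ q * w x ∂μ
      = ENNReal.ofReal q * ∫⁻ t in Ioi (0 : ℝ), ∫⁻ x, (if ENNReal.ofReal t < hlMax μ g x then 1 else 0) *
          ENNReal.ofReal (t ^ (q - 1)) * w x ∂μ := by
        rw [lintegral_lintegral_swap, ← lintegral_const_mul']
        · refine lintegral_congr fun x => ?_
          rw [ENNReal_rpow_eq_lintegral (by linarith) (hlMax μ g x), mul_assoc, lintegral_mul_const]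
          refine Measurable.mul (Measurable.ite ?_ measurable_const measurable_const) (by fun_prop)
          exact measurableSet_lt (by fun_prop) measurable_const
        · exact ENNReal.ofReal_ne_top
        · refine Measurable.aemeasurable (Measurable.mul (Measurable.mul
            (Measurable.ite ?_ measurable_const measurable_const) (by fun_prop)) (by fun_prop))
          exact measurableSet_lt (by fun_prop) (hM.comp measurable_snd)
    -- The factor 1/t of the weak bound lowers the weight from t^(q-1) to t^(q-2). For q > 1 the
    -- layer-cake formula of order q - 1 then integrates it back to a power of `2 * g`.
    _ ≤ ENNReal.ofReal q * ∫⁻ t in Ioi (0 : ℝ), (8 ^ Module.finrank ℝ E * 2) *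
          ∫⁻ x, (if ENNReal.ofReal t < 2 * g x then 1 else 0) * ENNReal.ofReal (t ^ (q - 1 - 1)) *
            (g x * hlMax μ w x) ∂μ := by
        gcongr 1
        refine setLIntegral_mono' measurableSet_Ioi fun t ht => ?_
        have ht : 0 < t := ht
        have h1 := setLIntegral_hlMax_gt_le_truncated μ hg hw
          (l := ENNReal.ofReal t) (by simpa using ht) ENNReal.ofReal_ne_top
        have hmeas : MeasurableSet {x | ENNReal.ofReal t < hlMax μ g x} :=
          measurableSet_lt measurable_const hM
        calc ∫⁻ x, (if ENNReal.ofReal t < hlMax μ g x then 1 else 0) *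
              ENNReal.ofReal (t ^ (q - 1)) * w x ∂μ
            = ENNReal.ofReal (t ^ (q - 1)) *
                ∫⁻ x in {x | ENNReal.ofReal t < hlMax μ g x}, w x ∂μ := by
              rw [← lintegral_indicator hmeas, ← lintegral_const_mul' _ _ ENNReal.ofReal_ne_top]
              refine lintegral_congr fun x => ?_
              by_cases hx : ENNReal.ofReal t < hlMax μ g x <;> simp [hx]
          _ ≤ _ := mul_le_mul_right h1 _
          _ = (8 ^ Module.finrank ℝ E * 2) * (ENNReal.ofReal (t ^ (q - 1 - 1)) *
              ∫⁻ x, {x | ENNReal.ofReal t < 2 * g x}.indicator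
                (fun x => g x * hlMax μ w x) x ∂μ) := by
              have : ENNReal.ofReal (t ^ (q - 1)) * (ENNReal.ofReal t / 2)⁻¹ =
                  2 * ENNReal.ofReal (t ^ (q - 1 - 1)) := by
                rw [Real.rpow_sub_one ht.ne' (q - 1), ENNReal.ofReal_div_of_pos ht,
                  ENNReal.inv_div (by simp) (by simp), div_eq_mul_inv, div_eq_mul_inv]
                ring
              rw [← mul_assoc, mul_left_comm, this]
              ring
          _ = _ := by
              rw [← lintegral_const_mul' _ _ ENNReal.ofReal_ne_top]
              congr 1
              refine lintegral_congr fun x => ?_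
              by_cases hx : ENNReal.ofReal t < 2 * g x <;> simp [hx]
    _ = c * ∫⁻ x, (∫⁻ t in Ioi (0 : ℝ), (if ENNReal.ofReal t < 2 * g x then 1 else 0) *
          ENNReal.ofReal (t ^ (q - 1 - 1))) * (g x * hlMax μ w x) ∂μ := by
        rw [lintegral_const_mul' _ _ (ENNReal.mul_ne_top (by finiteness) (by simp)),
          lintegral_lintegral_swap, ← mul_assoc]
        · congr 1
          refine lintegral_congr fun x => ?_
          rw [lintegral_mul_const]
          refine Measurable.mul (Measurable.ite ?_ measurable_const measurable_const) (by fun_prop)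
          exact measurableSet_lt (by fun_prop) measurable_const
        · refine Measurable.aemeasurable (Measurable.mul (Measurable.mul
            (Measurable.ite ?_ measurable_const measurable_const) (by fun_prop)) (by fun_prop))
          exact measurableSet_lt (by fun_prop) (by fun_prop)
    _ = c * ((ENNReal.ofReal (q - 1))⁻¹ * 2 ^ (q - 1)) * ∫⁻ x, g x ^ q * hlMax μ w x ∂μ := by
        rw [mul_assoc c, ← lintegral_const_mul' _ _ h2]
        congr 1
        refine lintegral_congr fun x => ?_
        have h3 := ENNReal_rpow_eq_lintegral hq1 (2 * g x)
        have h4 : (∫⁻ t in Ioi (0 : ℝ), (if ENNReal.ofReal t < 2 * g x then 1 else 0) *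
          ENNReal.ofReal (t ^ (q - 1 - 1))) = (ENNReal.ofReal (q - 1))⁻¹ * (2 * g x) ^ (q - 1) := by
          rw [h3, ← mul_assoc, ENNReal.inv_mul_cancel (by simpa using hq) ENNReal.ofReal_ne_top,
            one_mul]
        have h5 : g x ^ q = g x ^ (q - 1) * g x := by
          conv_rhs => rw [← ENNReal.rpow_one (g x), ← ENNReal.rpow_mul, one_mul]
          rw [← ENNReal.rpow_add_of_nonneg _ _ hq1.le zero_le_one]
          simp
        rw [h4, ENNReal.mul_rpow_of_nonneg _ _ hq1.le, h5]
        ring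

theorem exists_lintegral_hlMax_rpow_le' (μ : Measure E) [μ.IsAddHaarMeasure] {q : ℝ} (hq : 1 < q) :
    ∃ C : ℝ≥0, ∀ g : E → ℝ≥0∞, Measurable g →
      ∫⁻ x, hlMax μ g x ^ q ∂μ ≤ C * ∫⁻ x, g x ^ q ∂μ := by
  obtain ⟨C, hC⟩ := exists_lintegral_hlMax_rpow_le μ hq
  refine ⟨C, fun g hg => ?_⟩
  have := hC g (fun _ => 1) hg measurable_const
  simp only [mul_one] at this
  refine this.trans ?_
  gcongr with x
  calc g x ^ q * hlMax μ (fun _ => 1) x ≤ g x ^ q * 1 := by gcongr; exact hlMax_const_le μ 1 x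
    _ = _ := mul_one _

attribute [irreducible] hlMax

end HardyLittlewood

/-! ### The maximal operator in one variable on L^P(L^Q). -/

section FeffermanStein

open Metric Set

variable {X : Type*} [NormedAddCommGroup X] [MeasurableSpace X]

/-- The converse of Hölder's inequality for nonnegative functions. -/
theorem lintegral_rpow_le_of_forall_lintegral_mul_le {α : Type*} [MeasurableSpace α] {μ : Measure α}
    [SigmaFinite μ] {s s' : ℝ} (hs : s.HolderConjugate s') {h : α → ℝ≥0∞} (hh : Measurable h)
    {K : ℝ≥0∞}
    (H : ∀ w : α → ℝ≥0∞, Measurable w → ∫⁻ x, h x * w x ∂μ ≤ K * (∫⁻ x, w x ^ s' ∂μ) ^ (1 / s')) :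
    ∫⁻ x, h x ^ s ∂μ ≤ K ^ s := by
  have hs0 : 0 < s := hs.pos
  set hN : ℕ → α → ℝ≥0∞ := fun N => (spanningSets μ N).indicator (fun x => min (h x) N) with hhN
  have hNm : ∀ N, Measurable (hN N) := fun N =>
    (hh.min measurable_const).indicator (measurableSet_spanningSets μ N)
  have hNle : ∀ N x, hN N x ≤ h x := fun N x => by
    refine indicator_apply_le' (fun _ => min_le_left _ _) fun _ => zero_le
  have hmono : Monotone hN := by
    intro N M hNM x
    simp only [hhN, indicator]
    split_ifs with h1 h2
    · exact min_le_min_left _ (by exact_mod_cast hNM)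
    · exact absurd (monotone_spanningSets μ hNM h1) h2
    · exact zero_le
    · exact le_rfl
  have hsup : ∀ x, ⨆ N, hN N x = h x := by
    intro x
    refine le_antisymm (iSup_le fun N => hNle N x) ?_
    refine le_of_forall_lt fun c hc => ?_
    obtain ⟨n, hn⟩ := ENNReal.exists_nat_gt (hc.ne_top)
    have hx : x ∈ spanningSets μ (max n (spanningSetsIndex μ x)) :=
      monotone_spanningSets μ (le_max_right _ _) (mem_spanningSetsIndex μ x)
    refine lt_iSup_iff.2 ⟨max n (spanningSetsIndex μ x), ?_⟩
    simp only [hhN, hx, indicator_of_mem, lt_min_iff]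
    exact ⟨hc, hn.trans_le (by exact_mod_cast le_max_left _ _)⟩
  have hbound : ∀ N, ∫⁻ x, hN N x ^ s ∂μ ≤ K ^ s := by
    intro N
    set I := ∫⁻ x, hN N x ^ s ∂μ with hI
    have hIfin : I ≠ ∞ := by
      refine ((lintegral_mono (g := (spanningSets μ N).indicator (fun _ => (N : ℝ≥0∞) ^ s))
        fun x => ?_).trans_lt ?_).ne
      · by_cases hx : x ∈ spanningSets μ N
        · simp only [hhN, hx, indicator_of_mem]
          exact ENNReal.rpow_le_rpow (min_le_right _ _) hs0.le
        · simp [hhN, hx, hs0]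
      · rw [lintegral_indicator_const (measurableSet_spanningSets μ N)]
        exact ENNReal.mul_lt_top (ENNReal.rpow_lt_top_of_nonneg hs0.le (by simp))
          (measure_spanningSets_lt_top μ N)
    by_cases hI0 : I = 0
    · rw [hI0]; exact zero_le
    -- The test function `hN ^ (s - 1)` is the extremal one in Hölder's inequality.
    have h1 : I ≤ K * I ^ (1 / s') := by
      have h2 := H (fun x => hN N x ^ (s - 1)) ((hNm N).pow_const _)
      have e1 : ∀ x, (hN N x ^ (s - 1)) ^ s' = hN N x ^ s := fun x => by
        rw [← ENNReal.rpow_mul, hs.sub_one_mul_conj]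
      simp only [e1] at h2
      refine le_trans (lintegral_mono fun x => ?_) h2
      calc hN N x ^ s = hN N x * hN N x ^ (s - 1) := by
            nth_rw 2 [← ENNReal.rpow_one (hN N x)]
            rw [← ENNReal.rpow_add_of_nonneg _ _ zero_le_one hs.sub_one_pos.le]
            simp
        _ ≤ _ := by gcongr; exact hNle N x
    have h3 : I ^ (1 / s) * I ^ (1 / s') ≤ K * I ^ (1 / s') := by
      rw [← ENNReal.rpow_add _ _ hI0 hIfin, one_div, one_div, hs.inv_add_inv_eq_one,
        ENNReal.rpow_one, ← one_div]
      exact h1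
    have h4 : I ^ (1 / s) ≤ K :=
      (ENNReal.mul_le_mul_iff_left (by simp [hI0, hIfin])
        (ENNReal.rpow_ne_top_of_nonneg (by have := hs.symm.pos; positivity) hIfin)).1 h3
    rwa [one_div, ENNReal.rpow_inv_le_iff hs0] at h4
  have : ∫⁻ x, h x ^ s ∂μ = ⨆ N, ∫⁻ x, hN N x ^ s ∂μ := by
    rw [← lintegral_iSup (fun N => (hNm N).pow_const _)
      (fun N M hNM x => ENNReal.rpow_le_rpow (hmono hNM x) hs0.le)]
    refine lintegral_congr fun x => ?_
    rw [← hsup x]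
    exact (ENNReal.orderIsoRpow s hs0).map_iSup _
  rw [this]
  exact iSup_le hbound

variable [NormedSpace ℝ X] [FiniteDimensional ℝ X] [BorelSpace X]

theorem ballAvg_rpow_mul_rpow_le (μ : Measure X) [μ.IsAddHaarMeasure] (k : ℤ) {f h : X → ℝ≥0∞}
    (hf : Measurable f) (hh : Measurable h) {a b : ℝ} (ha : 0 ≤ a) (hb : 0 ≤ b) (hab : a + b = 1)
    (x : X) :
    ballAvg μ k (fun y => f y ^ a * h y ^ b) x ≤ ballAvg μ k f x ^ a * ballAvg μ k h x ^ b := by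
  unfold ballAvg
  rw [ENNReal.mul_rpow_of_nonneg _ _ ha, ENNReal.mul_rpow_of_nonneg _ _ hb, mul_mul_mul_comm,
    ← ENNReal.rpow_add_of_nonneg _ _ ha hb, hab, ENNReal.rpow_one]
  gcongr
  exact ENNReal.lintegral_mul_norm_pow_le hf.aemeasurable hh.aemeasurable ha hb hab

/-- Hölder's inequality on each ball; the two normalising factors recombine because the exponents
sum to one. -/
theorem hlMax_rpow_mul_rpow_le (μ : Measure X) [μ.IsAddHaarMeasure] {f h : X → ℝ≥0∞}
    (hf : Measurable f) (hh : Measurable h) {a b : ℝ} (ha : 0 ≤ a) (hb : 0 ≤ b) (hab : a + b = 1)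
    (x : X) :
    hlMax μ (fun y => f y ^ a * h y ^ b) x ≤ hlMax μ f x ^ a * hlMax μ h x ^ b := by
  refine hlMax_le fun k => (ballAvg_rpow_mul_rpow_le μ k hf hh ha hb hab x).trans ?_
  gcongr <;> exact ballAvg_le_hlMax μ k _ x

variable {Y : Type*} [MeasurableSpace Y]

theorem measurable_hlMax_fst {μ : Measure X} [SFinite μ] {g : X × Y → ℝ≥0∞} (hg : Measurable g) :
    Measurable fun z : X × Y => hlMax μ (fun x => g (x, z.2)) z.1 :=
  (measurable_hlMax_prod (α := Y) (hg.comp measurable_swap)).comp measurable_swap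

/-- The maximal function in the outer variable is bounded on `L^P(L^Q)`, `P ≤ Q`. -/
theorem exists_lintegral_hlMax_mixed_le_of_le (μ : Measure X) [μ.IsAddHaarMeasure] (ν : Measure Y)
    [SigmaFinite ν] {P Q : ℝ} (hP : 1 < P) (hPQ : P ≤ Q) :
    ∃ C : ℝ≥0, ∀ g : X × Y → ℝ≥0∞, Measurable g →
      ∫⁻ x, (∫⁻ y, hlMax μ (fun x' => g (x', y)) x ^ Q ∂ν) ^ (P / Q) ∂μ ≤
        C * ∫⁻ x, (∫⁻ y, g (x, y) ^ Q ∂ν) ^ (P / Q) ∂μ := by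
  obtain ⟨C, hC⟩ := exists_lintegral_hlMax_rpow_le' μ hP
  refine ⟨C + 1, fun g hg => ?_⟩
  have hgx : ∀ x, Measurable fun y => g (x, y) := fun x => hg.comp measurable_prodMk_left
  have hP0 : 0 < P := by linarith
  have hQ0 : 0 < Q := by linarith
  set H : X → ℝ≥0∞ := fun x => (∫⁻ y, g (x, y) ^ Q ∂ν) ^ (1 / Q) with hH
  have hHQ : ∀ x, H x ^ Q = ∫⁻ y, g (x, y) ^ Q ∂ν := fun x => by
    rw [hH, ← ENNReal.rpow_mul, one_div, inv_mul_cancel₀ hQ0.ne', ENNReal.rpow_one]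
  have hHP : ∀ x, (∫⁻ y, g (x, y) ^ Q ∂ν) ^ (P / Q) = H x ^ P := fun x => by
    rw [hH, ← ENNReal.rpow_mul, one_div, div_eq_inv_mul]
  have hHm : Measurable H := ((hg.pow_const Q).lintegral_prod_right').pow_const _
  simp only [hHP]
  set A := ∫⁻ x, H x ^ P ∂μ with hA
  by_cases hAtop : A = ∞
  · rw [hAtop, ENNReal.mul_top (by positivity)]; exact le_top
  have hHfin : ∀ᵐ x ∂μ, H x ≠ ∞ := by
    filter_upwards [ae_lt_top (hHm.pow_const P) hAtop] with x hx h
    simp [h, hP0] at hx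
  set a : ℝ := P / Q with ha
  have ha0 : 0 < a := by positivity
  have ha1 : a ≤ 1 := (div_le_one hQ0).2 hPQ
  -- Chosen so that g = φ^a H^(1-a), while the integral of φ^P over the product equals that of H^P.
  -- Thus the L^P(L^Q) bound for `g` reduces to plain L^P bounds for `φ` and `H`.
  set φ : X × Y → ℝ≥0∞ := fun z => g z ^ (1 / a) * H z.1 ^ (1 - 1 / a) with hφ
  have hφm : Measurable φ := (hg.pow_const _).mul ((hHm.comp measurable_fst).pow_const _)
  have hle : ∀ᵐ x ∂μ, ∀ᵐ y ∂ν, g (x, y) ≤ φ (x, y) ^ a * H x ^ (1 - a) := by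
    filter_upwards [hHfin] with x hx
    by_cases hx0 : H x = 0
    · have h0 : ∫⁻ y, g (x, y) ^ Q ∂ν = 0 := by rw [← hHQ, hx0, ENNReal.zero_rpow_of_pos hQ0]
      rw [lintegral_eq_zero_iff ((hgx x).pow_const Q)] at h0
      filter_upwards [h0] with y hy
      simp only [Pi.zero_apply, ENNReal.rpow_eq_zero_iff] at hy
      rcases hy with ⟨h, -⟩ | ⟨-, h⟩
      · rw [h]; exact zero_le
      · linarith
    · refine Filter.Eventually.of_forall fun y => le_of_eq ?_
      rw [hφ]
      simp only
      rw [ENNReal.mul_rpow_of_nonneg _ _ ha0.le, ← ENNReal.rpow_mul, ← ENNReal.rpow_mul, mul_assoc,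
        ← ENNReal.rpow_add _ _ hx0 hx]
      have e1 : 1 / a * a = 1 := by field_simp
      have e2 : (1 - 1 / a) * a + (1 - a) = 0 := by field_simp; ring
      rw [e1, e2, ENNReal.rpow_one, ENNReal.rpow_zero, mul_one]
  -- The maximal function acts in `x` for fixed `y`, so the null sets must be regrouped by `y`.
  have hle' : ∀ᵐ y ∂ν, ∀ᵐ x ∂μ, g (x, y) ≤ φ (x, y) ^ a * H x ^ (1 - a) := by
    refine (Measure.ae_ae_comm (p := fun x y => g (x, y) ≤ φ (x, y) ^ a * H x ^ (1 - a)) ?_).1 hle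
    exact measurableSet_le hg ((hφm.pow_const _).mul ((hHm.comp measurable_fst).pow_const _))
  have hM : ∀ᵐ y ∂ν, ∀ x, hlMax μ (fun x' => g (x', y)) x ^ Q ≤
      hlMax μ (fun x' => φ (x', y)) x ^ P * hlMax μ H x ^ (Q - P) := by
    filter_upwards [hle'] with y hy x
    have h1 := (hlMax_mono hy x).trans (hlMax_rpow_mul_rpow_le μ
      (f := fun x' => φ (x', y)) (h := H) (hφm.comp measurable_prodMk_right) hHm ha0.le
      (by linarith) (by ring) x)
    refine (ENNReal.rpow_le_rpow h1 hQ0.le).trans (le_of_eq ?_)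
    rw [ENNReal.mul_rpow_of_nonneg _ _ hQ0.le, ← ENNReal.rpow_mul, ← ENNReal.rpow_mul]
    congr 2
    · rw [ha]; field_simp
    · rw [ha]; field_simp
  have hMφ := measurable_hlMax_fst (μ := μ) hφm
  have hMφx : ∀ x, Measurable fun y => hlMax μ (fun x' => φ (x', y)) x :=
    fun x => hMφ.comp measurable_prodMk_left
  -- Since φ^P = g^Q H^(P-Q), the inner integral is H^Q H^(P-Q) = H^P wherever `H` is nonzero.
  have hφint : ∫⁻ x, ∫⁻ y, φ (x, y) ^ P ∂ν ∂μ ≤ A := by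
    refine lintegral_mono_ae ?_
    filter_upwards [hHfin] with x hx
    have e : ∀ y, φ (x, y) ^ P = g (x, y) ^ Q * H x ^ (P - Q) := fun y => by
      rw [hφ]
      simp only
      rw [ENNReal.mul_rpow_of_nonneg _ _ hP0.le, ← ENNReal.rpow_mul, ← ENNReal.rpow_mul]
      congr 2
      · rw [ha]; field_simp
      · rw [ha]; field_simp
    simp only [e]
    rw [lintegral_mul_const _ ((hgx x).pow_const Q), ← hHQ]
    by_cases hx0 : H x = 0
    · simp [hx0, hQ0]
    · rw [← ENNReal.rpow_add _ _ hx0 hx]; simp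
  calc ∫⁻ x, (∫⁻ y, hlMax μ (fun x' => g (x', y)) x ^ Q ∂ν) ^ a ∂μ
      ≤ ∫⁻ x, (∫⁻ y, hlMax μ (fun x' => φ (x', y)) x ^ P ∂ν) ^ a * (hlMax μ H x ^ P) ^ (1 - a) ∂μ := by
        refine lintegral_mono fun x => ?_
        have : ∫⁻ y, hlMax μ (fun x' => g (x', y)) x ^ Q ∂ν ≤
            (∫⁻ y, hlMax μ (fun x' => φ (x', y)) x ^ P ∂ν) * hlMax μ H x ^ (Q - P) := by
          rw [← lintegral_mul_const _ ((hMφx x).pow_const P)]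
          exact lintegral_mono_ae (hM.mono fun y hy => hy x)
        refine (ENNReal.rpow_le_rpow this ha0.le).trans (le_of_eq ?_)
        rw [ENNReal.mul_rpow_of_nonneg _ _ ha0.le, ← ENNReal.rpow_mul, ← ENNReal.rpow_mul]
        congr 2
        rw [ha]; field_simp
    _ ≤ (∫⁻ x, ∫⁻ y, hlMax μ (fun x' => φ (x', y)) x ^ P ∂ν ∂μ) ^ a *
          (∫⁻ x, hlMax μ H x ^ P ∂μ) ^ (1 - a) :=
        ENNReal.lintegral_mul_norm_pow_le
          ((hMφ.pow_const P).lintegral_prod_right').aemeasurable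
          ((measurable_hlMax hHm).pow_const P).aemeasurable ha0.le (by linarith) (by ring)
    _ ≤ (C * A) ^ a * (C * A) ^ (1 - a) := by
        gcongr
        · rw [lintegral_lintegral_swap (hMφ.pow_const P).aemeasurable]
          refine le_trans ?_ (mul_le_mul_right hφint _)
          rw [lintegral_lintegral_swap (f := fun x y => φ (x, y) ^ P) (hφm.pow_const P).aemeasurable,
            ← lintegral_const_mul' _ _ (by simp)]
          exact lintegral_mono fun y => hC _ (hφm.comp measurable_prodMk_right)
        · exact hC H hHm
    _ = C * A := by
        rw [← ENNReal.rpow_add_of_nonneg _ _ ha0.le (by linarith)]; simp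
    _ ≤ _ := by gcongr; exact le_self_add

/-- The maximal function in the outer variable is bounded on `L^P(L^Q)`, `Q < P`. -/
theorem exists_lintegral_hlMax_mixed_le_of_lt (μ : Measure X) [μ.IsAddHaarMeasure] (ν : Measure Y)
    [SigmaFinite ν] {P Q : ℝ} (hQ : 1 < Q) (hPQ : Q < P) :
    ∃ C : ℝ≥0, ∀ g : X × Y → ℝ≥0∞, Measurable g →
      ∫⁻ x, (∫⁻ y, hlMax μ (fun x' => g (x', y)) x ^ Q ∂ν) ^ (P / Q) ∂μ ≤
        C * ∫⁻ x, (∫⁻ y, g (x, y) ^ Q ∂ν) ^ (P / Q) ∂μ := by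
  have hQ0 : 0 < Q := by linarith
  set s : ℝ := P / Q with hs
  have hs1 : 1 < s := (one_lt_div hQ0).2 hPQ
  have hs0 : 0 < s := by linarith
  have hconj := Real.HolderConjugate.conjExponent hs1
  set s' := s.conjExponent
  obtain ⟨C, hC⟩ := exists_lintegral_hlMax_rpow_le μ hQ
  obtain ⟨D, hD⟩ := exists_lintegral_hlMax_rpow_le' μ hconj.symm.lt
  refine ⟨(C * D ^ (1 / s')) ^ s, fun g hg => ?_⟩
  have hgx : ∀ x, Measurable fun y => g (x, y) := fun x => hg.comp measurable_prodMk_left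
  have hMg := measurable_hlMax_fst (μ := μ) hg
  have hMgx : ∀ x, Measurable fun y => hlMax μ (fun x' => g (x', y)) x :=
    fun x => hMg.comp measurable_prodMk_left
  have hG : Measurable fun x => ∫⁻ y, g (x, y) ^ Q ∂ν := (hg.pow_const Q).lintegral_prod_right'
  set A := ∫⁻ x, (∫⁻ y, g (x, y) ^ Q ∂ν) ^ s ∂μ with hA
  have hs'0 : 0 < s' := hconj.symm.pos
  -- The inner integral is estimated in L^s by duality. The weighted inequality shifts the maximal
  -- operator from `g` to the test function `w`, where it is bounded on L^{s'} with `s'` the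
  -- conjugate exponent.
  refine (lintegral_rpow_le_of_forall_lintegral_mul_le hconj
    ((hMg.pow_const Q).lintegral_prod_right') (K := C * D ^ (1 / s') * A ^ (1 / s)) ?_).trans
    (le_of_eq ?_)
  · intro w hw
    calc ∫⁻ x, (∫⁻ y, hlMax μ (fun x' => g (x', y)) x ^ Q ∂ν) * w x ∂μ
        = ∫⁻ y, ∫⁻ x, hlMax μ (fun x' => g (x', y)) x ^ Q * w x ∂μ ∂ν := by
          rw [← lintegral_lintegral_swap
            (((hMg.pow_const Q).mul (hw.comp measurable_fst)).aemeasurable)]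
          refine lintegral_congr fun x => ?_
          rw [lintegral_mul_const _ ((hMgx x).pow_const Q)]
      _ ≤ ∫⁻ y, C * ∫⁻ x, g (x, y) ^ Q * hlMax μ w x ∂μ ∂ν :=
          lintegral_mono fun y => hC _ w (hg.comp measurable_prodMk_right) hw
      _ = C * ∫⁻ x, (∫⁻ y, g (x, y) ^ Q ∂ν) * hlMax μ w x ∂μ := by
          rw [lintegral_const_mul' _ _ (by simp), ← lintegral_lintegral_swap
            (((hg.pow_const Q).mul ((measurable_hlMax hw).comp measurable_fst)).aemeasurable)]
          congr 1
          refine lintegral_congr fun x => ?_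
          rw [lintegral_mul_const _ ((hgx x).pow_const Q)]
      _ ≤ C * (A ^ (1 / s) * (∫⁻ x, hlMax μ w x ^ s' ∂μ) ^ (1 / s')) := by
          gcongr
          exact ENNReal.lintegral_mul_le_Lp_mul_Lq μ hconj hG.aemeasurable
            (measurable_hlMax hw).aemeasurable
      _ ≤ C * (A ^ (1 / s) * (D * ∫⁻ x, w x ^ s' ∂μ) ^ (1 / s')) := by
          gcongr
          exact hD w hw
      _ = _ := by
          rw [ENNReal.mul_rpow_of_nonneg _ _ (by positivity)]
          ring
  · rw [ENNReal.mul_rpow_of_nonneg _ _ hs0.le, ← ENNReal.rpow_mul, one_div_mul_cancel hs0.ne',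
      ENNReal.rpow_one, ENNReal.coe_rpow_of_nonneg _ hs0.le, ENNReal.coe_mul,
      ENNReal.coe_rpow_of_nonneg _ (by positivity)]

/-- The maximal function in the outer variable is bounded on `L^P(L^Q)`. -/
theorem exists_lintegral_hlMax_mixed_le (μ : Measure X) [μ.IsAddHaarMeasure] (ν : Measure Y)
    [SigmaFinite ν] {P Q : ℝ} (hP : 1 < P) (hQ : 1 < Q) :
    ∃ C : ℝ≥0, ∀ g : X × Y → ℝ≥0∞, Measurable g →
      ∫⁻ x, (∫⁻ y, hlMax μ (fun x' => g (x', y)) x ^ Q ∂ν) ^ (P / Q) ∂μ ≤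
        C * ∫⁻ x, (∫⁻ y, g (x, y) ^ Q ∂ν) ^ (P / Q) ∂μ := by
  rcases le_or_gt P Q with h | h
  · exact exists_lintegral_hlMax_mixed_le_of_le μ ν hP h
  · exact exists_lintegral_hlMax_mixed_le_of_lt μ ν hQ h

end FeffermanStein

/-! ### Elementary properties of mixed Lebesgue norms. -/

section MixedNorm

open Metric Set

variable {X Y : Type*} [MeasurableSpace X] [MeasurableSpace Y]

/-- The mixed norm of `F` in `L^P(μ; L^Q(ν))`. -/
def mixedNorm (P Q : ℝ) (μ : Measure X) (ν : Measure Y) (F : X × Y → ℝ≥0∞) : ℝ≥0∞ :=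
  (∫⁻ x, (∫⁻ y, F (x, y) ^ Q ∂ν) ^ (P / Q) ∂μ) ^ (1 / P)

theorem mixedNorm_mono {P Q : ℝ} (hP : 0 < P) (hQ : 0 < Q) {μ : Measure X} {ν : Measure Y}
    {F G : X × Y → ℝ≥0∞} (h : ∀ᵐ x ∂μ, ∀ᵐ y ∂ν, F (x, y) ≤ G (x, y)) :
    mixedNorm P Q μ ν F ≤ mixedNorm P Q μ ν G := by
  unfold mixedNorm
  refine ENNReal.rpow_le_rpow (lintegral_mono_ae (h.mono fun x hx => ?_)) (by positivity)
  exact ENNReal.rpow_le_rpow (lintegral_mono_ae (hx.mono fun y hy =>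
    ENNReal.rpow_le_rpow hy hQ.le)) (by positivity)

theorem mixedNorm_measure_mono {P Q : ℝ} (hP : 0 < P) (hQ : 0 < Q) {μ μ' : Measure X}
    {ν ν' : Measure Y} (hμ : μ ≤ μ') (hν : ν ≤ ν') (F : X × Y → ℝ≥0∞) :
    mixedNorm P Q μ ν F ≤ mixedNorm P Q μ' ν' F := by
  unfold mixedNorm
  refine ENNReal.rpow_le_rpow (lintegral_mono' hμ fun x => ?_) (by positivity)
  exact ENNReal.rpow_le_rpow (lintegral_mono' hν fun y => le_rfl) (by positivity)

theorem mixedNorm_add_le {P Q : ℝ} (hP : 1 ≤ P) (hQ : 1 ≤ Q) {μ : Measure X} {ν : Measure Y}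
    [SFinite ν] {F G : X × Y → ℝ≥0∞} (hF : Measurable F) (hG : Measurable G) :
    mixedNorm P Q μ ν (fun z => F z + G z) ≤ mixedNorm P Q μ ν F + mixedNorm P Q μ ν G := by
  have hP0 : 0 < P := by linarith
  have hQ0 : 0 < Q := by linarith
  have key : ∀ F : X × Y → ℝ≥0∞, mixedNorm P Q μ ν F =
      (∫⁻ x, ((∫⁻ y, F (x, y) ^ Q ∂ν) ^ (1 / Q)) ^ P ∂μ) ^ (1 / P) := by
    intro F
    unfold mixedNorm
    simp only [← ENNReal.rpow_mul]
    rw [one_div_mul_eq_div]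
  rw [key, key, key]
  refine le_trans ?_ (ENNReal.lintegral_Lp_add_le
    ((hF.pow_const Q).lintegral_prod_right'.pow_const _).aemeasurable
    ((hG.pow_const Q).lintegral_prod_right'.pow_const _).aemeasurable hP)
  refine ENNReal.rpow_le_rpow (lintegral_mono fun x => ENNReal.rpow_le_rpow ?_ hP0.le) (by positivity)
  exact ENNReal.lintegral_Lp_add_le (hF.comp measurable_prodMk_left).aemeasurable
    (hG.comp measurable_prodMk_left).aemeasurable hQ

theorem mixedNorm_const {P Q : ℝ} (hP : 0 < P) (hQ : 0 < Q) (μ : Measure X) (ν : Measure Y)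
    (c : ℝ≥0∞) :
    mixedNorm P Q μ ν (fun _ => c) = c * ν univ ^ (1 / Q) * μ univ ^ (1 / P) := by
  unfold mixedNorm
  simp only [lintegral_const]
  rw [ENNReal.mul_rpow_of_nonneg _ _ (by positivity), ENNReal.mul_rpow_of_nonneg _ _ (by positivity),
    ENNReal.mul_rpow_of_nonneg _ _ (by positivity), ← ENNReal.rpow_mul, ← ENNReal.rpow_mul,
    ← ENNReal.rpow_mul]
  have e1 : Q * (P / Q * (1 / P)) = 1 := by field_simp
  have e2 : P / Q * (1 / P) = 1 / Q := by field_simp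
  rw [e1, e2, ENNReal.rpow_one]

theorem lintegral_le_rpow_mul {P : ℝ} (hP : 1 ≤ P) {μ : Measure X} {f : X → ℝ≥0∞}
    (hf : Measurable f) :
    ∫⁻ x, f x ∂μ ≤ (∫⁻ x, f x ^ P ∂μ) ^ (1 / P) * μ univ ^ (1 - 1 / P) := by
  have hP0 : 0 < P := by linarith
  have := ENNReal.lintegral_mul_norm_pow_le (μ := μ) (f := fun x => f x ^ P) (g := fun _ => 1)
    (hf.pow_const P).aemeasurable aemeasurable_const (p := 1 / P) (q := 1 - 1 / P) (by positivity)
    (by rw [sub_nonneg, div_le_one hP0]; exact hP) (by ring)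
  simpa [← ENNReal.rpow_mul, hP0.ne'] using this

theorem lintegral_le_mixedNorm_mul {P Q : ℝ} (hP : 1 ≤ P) (hQ : 1 ≤ Q) {μ : Measure X}
    {ν : Measure Y} [SFinite ν] {F : X × Y → ℝ≥0∞} (hF : Measurable F) :
    ∫⁻ x, ∫⁻ y, F (x, y) ∂ν ∂μ ≤
      mixedNorm P Q μ ν F * (μ univ ^ (1 - 1 / P) * ν univ ^ (1 - 1 / Q)) := by
  have hQ0 : 0 < Q := by linarith
  have hm := (hF.pow_const Q).lintegral_prod_right' (ν := ν)
  calc ∫⁻ x, ∫⁻ y, F (x, y) ∂ν ∂μ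
      ≤ ∫⁻ x, (∫⁻ y, F (x, y) ^ Q ∂ν) ^ (1 / Q) * ν univ ^ (1 - 1 / Q) ∂μ :=
        lintegral_mono fun x => lintegral_le_rpow_mul hQ (hF.comp measurable_prodMk_left)
    _ = (∫⁻ x, (∫⁻ y, F (x, y) ^ Q ∂ν) ^ (1 / Q) ∂μ) * ν univ ^ (1 - 1 / Q) := by
        rw [lintegral_mul_const _ (hm.pow_const _)]
    _ ≤ ((∫⁻ x, ((∫⁻ y, F (x, y) ^ Q ∂ν) ^ (1 / Q)) ^ P ∂μ) ^ (1 / P) * μ univ ^ (1 - 1 / P)) *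
          ν univ ^ (1 - 1 / Q) := by
        gcongr
        exact lintegral_le_rpow_mul hP (hm.pow_const _)
    _ = _ := by
        unfold mixedNorm
        simp only [← ENNReal.rpow_mul]
        rw [one_div_mul_eq_div, mul_assoc]

theorem mixedNorm_indicator {P Q : ℝ} (hP : 0 < P) (hQ : 0 < Q) (μ : Measure X) (ν : Measure Y)
    {s : Set X} {t : Set Y} (hs : MeasurableSet s) (ht : MeasurableSet t) (F : X × Y → ℝ≥0∞) :
    mixedNorm P Q μ ν ((s ×ˢ t).indicator F) =
      mixedNorm P Q (μ.restrict s) (ν.restrict t) F := by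
  unfold mixedNorm
  congr 1
  rw [← lintegral_indicator hs]
  refine lintegral_congr fun x => ?_
  by_cases hx : x ∈ s
  · simp only [hx, indicator_of_mem]
    congr 1
    rw [← lintegral_indicator ht]
    refine lintegral_congr fun y => ?_
    by_cases hy : y ∈ t <;> simp [hx, hy, indicator, hQ]
  · have : 0 < P / Q := by positivity
    simp [hx, indicator, hQ, this]

theorem mixedNorm_const_mul_rpow {P Q s : ℝ} (hP : 0 < P) (hQ : 0 < Q) (hs : 0 < s)
    {μ : Measure X} {ν : Measure Y} [SFinite ν] (A : ℝ≥0∞) {F : X × Y → ℝ≥0∞} (hF : Measurable F) :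
    mixedNorm (s * P) (s * Q) μ ν (fun z => A * F z ^ (1 / s)) =
      A * mixedNorm P Q μ ν F ^ (1 / s) := by
  unfold mixedNorm
  have hm := (hF.pow_const Q).lintegral_prod_right' (ν := ν)
  have e1 : 1 / s * (s * Q) = Q := by field_simp
  have e2 : s * P / (s * Q) = P / Q := by field_simp
  have e3 : s * Q * (P / Q) = s * P := by field_simp
  have e4 : ∀ x, ∫⁻ y, (A * F (x, y) ^ (1 / s)) ^ (s * Q) ∂ν = A ^ (s * Q) * ∫⁻ y, F (x, y) ^ Q ∂ν := by
    intro x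
    have hFx : Measurable fun y => F (x, y) := hF.comp measurable_prodMk_left
    rw [← lintegral_const_mul _ (hFx.pow_const Q)]
    refine lintegral_congr fun y => ?_
    rw [ENNReal.mul_rpow_of_nonneg _ _ (by positivity), ← ENNReal.rpow_mul, e1]
  simp only [e4, e2]
  have e5 : ∀ x, (A ^ (s * Q) * ∫⁻ y, F (x, y) ^ Q ∂ν) ^ (P / Q) =
      A ^ (s * P) * (∫⁻ y, F (x, y) ^ Q ∂ν) ^ (P / Q) := by
    intro x
    rw [ENNReal.mul_rpow_of_nonneg _ _ (by positivity), ← ENNReal.rpow_mul, e3]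
  simp only [e5]
  rw [lintegral_const_mul _ (hm.pow_const _), ENNReal.mul_rpow_of_nonneg _ _ (by positivity),
    ← ENNReal.rpow_mul, ← ENNReal.rpow_mul]
  have e6 : s * P * (1 / (s * P)) = 1 := by field_simp
  have e7 : 1 / (s * P) = 1 / P * (1 / s) := by field_simp
  rw [e6, e7, ENNReal.rpow_one]

end MixedNorm

/-! ### Mixed-norm Morrey spaces and boundedness of the cylinder maximal function. -/

section Morrey

open Metric Set

variable {X Y : Type*} [NormedAddCommGroup X] [NormedSpace ℝ X] [FiniteDimensional ℝ X]
  [MeasurableSpace X] [BorelSpace X] [NormedAddCommGroup Y] [NormedSpace ℝ Y]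
  [FiniteDimensional ℝ Y] [MeasurableSpace Y] [BorelSpace Y]

/-- The Morrey norm with mixed exponents over the cylinders `B(x, ρ ^ a) × B(y, ρ ^ b)`. -/
def morrey (a b : ℕ) (P Q γ : ℝ) (μ : Measure X) (ν : Measure Y) (F : X × Y → ℝ≥0∞) : ℝ≥0∞ :=
  ⨆ (ρ : ℝ) (_ : 0 < ρ) (x : X) (y : Y), ENNReal.ofReal (ρ ^ γ) *
    mixedNorm P Q (μ.restrict (ball x (ρ ^ a))) (ν.restrict (ball y (ρ ^ b))) F

/-- The average of `F` over the closed cylinder of radius `2 ^ k`. -/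
def cylAvg (a b : ℕ) (μ : Measure X) (ν : Measure Y) (k : ℤ) (F : X × Y → ℝ≥0∞) (x : X) (y : Y) :
    ℝ≥0∞ :=
  ballAvg μ (a * k) (fun x' => ballAvg ν (b * k) (fun y' => F (x', y')) y) x

/-- The maximal function over cylinders of dyadic radii. -/
def cylMax (a b : ℕ) (μ : Measure X) (ν : Measure Y) (F : X × Y → ℝ≥0∞) (z : X × Y) : ℝ≥0∞ :=
  ⨆ k : ℤ, cylAvg a b μ ν k F z.1 z.2

variable {a b : ℕ} {P Q γ : ℝ} {μ : Measure X} {ν : Measure Y}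

theorem le_morrey (F : X × Y → ℝ≥0∞) {ρ : ℝ} (hρ : 0 < ρ) (x : X) (y : Y) :
    ENNReal.ofReal (ρ ^ γ) *
      mixedNorm P Q (μ.restrict (ball x (ρ ^ a))) (ν.restrict (ball y (ρ ^ b))) F ≤
      morrey a b P Q γ μ ν F :=
  le_iSup₂_of_le ρ hρ (le_iSup₂_of_le x y le_rfl)

theorem mixedNorm_le_morrey (F : X × Y → ℝ≥0∞) {ρ : ℝ} (hρ : 0 < ρ) (x : X) (y : Y) :
    mixedNorm P Q (μ.restrict (ball x (ρ ^ a))) (ν.restrict (ball y (ρ ^ b))) F ≤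
      ENNReal.ofReal (ρ ^ (-γ)) * morrey a b P Q γ μ ν F := by
  refine le_trans (le_of_eq ?_)
    (mul_le_mul_right (le_morrey (a := a) (b := b) (P := P) (Q := Q) (γ := γ) F hρ x y) _)
  rw [← mul_assoc, ← ENNReal.ofReal_mul (by positivity), ← Real.rpow_add hρ]
  simp

theorem morrey_mono (hP : 0 < P) (hQ : 0 < Q) [SFinite ν] {F G : X × Y → ℝ≥0∞}
    (h : F ≤ᵐ[μ.prod ν] G) : morrey a b P Q γ μ ν F ≤ morrey a b P Q γ μ ν G := by
  refine iSup₂_mono fun ρ hρ => iSup₂_mono fun x y => mul_le_mul_right ?_ _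
  exact mixedNorm_mono hP hQ (ae_restrict_of_ae
    ((Measure.ae_ae_of_ae_prod h).mono fun x hx => ae_restrict_of_ae hx))

theorem morrey_add_le (hP : 1 ≤ P) (hQ : 1 ≤ Q) [SFinite ν] {F G : X × Y → ℝ≥0∞}
    (hF : Measurable F) (hG : Measurable G) :
    morrey a b P Q γ μ ν (fun z => F z + G z) ≤
      morrey a b P Q γ μ ν F + morrey a b P Q γ μ ν G := by
  refine iSup₂_le fun ρ hρ => iSup₂_le fun x y => ?_
  refine (mul_le_mul_right (mixedNorm_add_le hP hQ hF hG) _).trans ?_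
  rw [mul_add]
  exact add_le_add (le_morrey F hρ x y) (le_morrey G hρ x y)

/-- Morrey norms scale under powers; with s = (2+δ)/(1+δ) this is the source of the exponents on the
left of the Gagliardo–Nirenberg inequality. -/
theorem morrey_const_mul_rpow_le {s : ℝ} (hP : 0 < P) (hQ : 0 < Q) (hs : 0 < s) [SFinite ν]
    (A : ℝ≥0∞) {F : X × Y → ℝ≥0∞} (hF : Measurable F) :
    morrey a b (s * P) (s * Q) (γ / s) μ ν (fun z => A * F z ^ (1 / s)) ≤
      A * morrey a b P Q γ μ ν F ^ (1 / s) := by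
  refine iSup₂_le fun ρ hρ => iSup₂_le fun x y => ?_
  rw [mixedNorm_const_mul_rpow hP hQ hs A hF, mul_left_comm]
  gcongr 1
  rw [div_eq_mul_one_div, Real.rpow_mul hρ.le, ← ENNReal.ofReal_rpow_of_nonneg (by positivity)
    (by positivity), ← ENNReal.mul_rpow_of_nonneg _ _ (by positivity)]
  exact ENNReal.rpow_le_rpow (le_morrey F hρ x y) (by positivity)

theorem cylAvg_le_cylMax (k : ℤ) (F : X × Y → ℝ≥0∞) (x : X) (y : Y) :
    cylAvg a b μ ν k F x y ≤ cylMax a b μ ν F (x, y) :=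
  le_iSup (fun k => cylAvg a b μ ν k F x y) k

/-- Letting the radii in the two variables vary independently only increases the supremum, and
decouples the variables. -/
theorem cylAvg_le_hlMax_hlMax (k : ℤ) (F : X × Y → ℝ≥0∞) (x : X) (y : Y) :
    cylAvg a b μ ν k F x y ≤ hlMax μ (fun x' => hlMax ν (fun y' => F (x', y')) y) x :=
  (ballAvg_mono (Filter.Eventually.of_forall fun _ => ballAvg_le_hlMax ν _ _ y) x).trans
    (ballAvg_le_hlMax μ _ _ x)

theorem measurable_cylMax [SFinite μ] [SFinite ν] {F : X × Y → ℝ≥0∞} (hF : Measurable F) :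
    Measurable (cylMax a b μ ν F) := by
  refine Measurable.iSup fun k => ?_
  have h1 := measurable_ballAvg (μ := ν) (b * k) hF
  have h2 := measurable_ballAvg (μ := μ) (α := Y) (a * k) (h1.comp measurable_swap)
  exact h2.comp measurable_swap

/-- The outer operator is handled by the L^P(L^Q) bound, the inner one by the scalar bound on L^Q
for each fixed `x`. -/
theorem exists_mixedNorm_hlMax_hlMax_le (μ : Measure X) [μ.IsAddHaarMeasure] (ν : Measure Y)
    [ν.IsAddHaarMeasure] (hP : 1 < P) (hQ : 1 < Q) :
    ∃ C : ℝ≥0, ∀ F : X × Y → ℝ≥0∞, Measurable F →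
      mixedNorm P Q μ ν (fun z => hlMax μ (fun x' => hlMax ν (fun y' => F (x', y')) z.2) z.1) ≤
        C * mixedNorm P Q μ ν F := by
  obtain ⟨C, hC⟩ := exists_lintegral_hlMax_mixed_le μ ν hP hQ
  obtain ⟨D, hD⟩ := exists_lintegral_hlMax_rpow_le' ν hQ
  have hP0 : 0 < P := by linarith
  have hQ0 : 0 < Q := by linarith
  refine ⟨(C * D ^ (P / Q)) ^ (1 / P), fun F hF => ?_⟩
  unfold mixedNorm
  rw [ENNReal.coe_rpow_of_nonneg _ (by positivity), ENNReal.coe_mul,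
    ENNReal.coe_rpow_of_nonneg _ (by positivity), ← ENNReal.mul_rpow_of_nonneg _ _ (by positivity)]
  refine ENNReal.rpow_le_rpow ?_ (by positivity)
  refine (hC _ (measurable_hlMax_prod (μ := ν) hF)).trans ?_
  rw [mul_assoc]
  gcongr
  rw [← lintegral_const_mul' _ _ (ENNReal.rpow_ne_top_of_nonneg (by positivity) (by simp))]
  refine lintegral_mono fun x => ?_
  rw [← ENNReal.mul_rpow_of_nonneg _ _ (by positivity)]
  exact ENNReal.rpow_le_rpow (hD _ (hF.comp measurable_prodMk_left)) (by positivity)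

theorem measure_ball_pow_eq (μ : Measure X) [μ.IsAddHaarMeasure] (x : X) {ρ : ℝ} (hρ : 0 < ρ) (a : ℕ) :
    μ (ball x (ρ ^ a)) = ENNReal.ofReal (ρ ^ ((a : ℝ) * Module.finrank ℝ X)) * μ (ball 0 1) := by
  rw [Measure.addHaar_ball_of_pos _ _ (by positivity), ← pow_mul, ← Real.rpow_natCast, Nat.cast_mul]

theorem measure_ball_rpow_eq (μ : Measure X) [μ.IsAddHaarMeasure] (x : X) {ρ : ℝ} (hρ : 0 < ρ) (a : ℕ)
    {e : ℝ} (he : 0 ≤ e) :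
    μ (ball x (ρ ^ a)) ^ e =
      ENNReal.ofReal (ρ ^ ((a : ℝ) * Module.finrank ℝ X * e)) * μ (ball 0 1) ^ e := by
  rw [measure_ball_pow_eq μ x hρ, ENNReal.mul_rpow_of_nonneg _ _ he,
    ENNReal.ofReal_rpow_of_nonneg (by positivity) he, ← Real.rpow_mul hρ.le]

/-- Hölder's inequality in both variables. The powers of the measures and the Morrey weight combine
to ρ^(m - β), where m is the homogeneous dimension, whatever `P` and `Q` are. -/
theorem exists_lintegral_cylinder_le_morrey (a b : ℕ) (μ : Measure X) [μ.IsAddHaarMeasure]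
    (ν : Measure Y) [ν.IsAddHaarMeasure] (hP : 1 ≤ P) (hQ : 1 ≤ Q) (β : ℝ) :
    ∃ C : ℝ≥0, ∀ F : X × Y → ℝ≥0∞, Measurable F → ∀ ρ : ℝ, 0 < ρ → ∀ x y,
      ∫⁻ x' in ball x (ρ ^ a), ∫⁻ y' in ball y (ρ ^ b), F (x', y') ∂ν ∂μ ≤
        C * ENNReal.ofReal (ρ ^ ((a : ℝ) * Module.finrank ℝ X + b * Module.finrank ℝ Y - β)) *
          morrey a b P Q (β - a * Module.finrank ℝ X / P - b * Module.finrank ℝ Y / Q) μ ν F := by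
  have hP0 : 0 < P := by linarith
  have hQ0 : 0 < Q := by linarith
  have hP1 : 0 ≤ 1 - 1 / P := by rw [sub_nonneg, div_le_one hP0]; exact hP
  have hQ1 : 0 ≤ 1 - 1 / Q := by rw [sub_nonneg, div_le_one hQ0]; exact hQ
  have hc : μ (ball 0 1) ^ (1 - 1 / P) * ν (ball 0 1) ^ (1 - 1 / Q) ≠ ∞ :=
    ENNReal.mul_ne_top (ENNReal.rpow_ne_top_of_nonneg hP1 measure_ball_lt_top.ne)
      (ENNReal.rpow_ne_top_of_nonneg hQ1 measure_ball_lt_top.ne)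
  refine ⟨(μ (ball 0 1) ^ (1 - 1 / P) * ν (ball 0 1) ^ (1 - 1 / Q)).toNNReal,
    fun F hF ρ hρ x y => ?_⟩
  rw [ENNReal.coe_toNNReal hc]
  refine (lintegral_le_mixedNorm_mul hP hQ hF).trans ?_
  rw [Measure.restrict_apply_univ, Measure.restrict_apply_univ, measure_ball_rpow_eq μ x hρ a hP1,
    measure_ball_rpow_eq ν y hρ b hQ1]
  refine (mul_le_mul_left (mixedNorm_le_morrey (γ := β - a * Module.finrank ℝ X / P -
    b * Module.finrank ℝ Y / Q) F hρ x y) _).trans (le_of_eq ?_)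
  set γ := β - a * Module.finrank ℝ X / P - b * Module.finrank ℝ Y / Q with hγ
  have e : ENNReal.ofReal (ρ ^ ((a : ℝ) * Module.finrank ℝ X + b * Module.finrank ℝ Y - β)) =
      ENNReal.ofReal (ρ ^ (-γ)) * ENNReal.ofReal (ρ ^ ((a : ℝ) * Module.finrank ℝ X * (1 - 1 / P))) *
        ENNReal.ofReal (ρ ^ ((b : ℝ) * Module.finrank ℝ Y * (1 - 1 / Q))) := by
    rw [← ENNReal.ofReal_mul (by positivity), ← ENNReal.ofReal_mul (by positivity),
      ← Real.rpow_add hρ, ← Real.rpow_add hρ]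
    congr 2
    rw [hγ]
    ring
  rw [e]
  ring

theorem closedBall_two_zpow_subset_ball (k : ℤ) (x : X) (ha : a ≠ 0) :
    closedBall x (2 ^ ((a : ℤ) * k) : ℝ) ⊆ ball x ((2 * 2 ^ k) ^ a) := by
  refine closedBall_subset_ball ?_
  rw [mul_comm (a : ℤ), zpow_mul, zpow_natCast]
  have : (0 : ℝ) < 2 ^ k := by positivity
  exact pow_lt_pow_left₀ (by linarith) this.le ha

theorem inv_measure_closedBall_two_zpow (μ : Measure X) [μ.IsAddHaarMeasure] (k : ℤ) (a : ℕ) :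
    (μ (closedBall 0 (2 ^ ((a : ℤ) * k) : ℝ)))⁻¹ =
      ENNReal.ofReal ((2 ^ k : ℝ) ^ (-((a : ℝ) * Module.finrank ℝ X))) * (μ (ball 0 1))⁻¹ := by
  rw [Measure.addHaar_closedBall _ _ (by positivity), mul_comm (a : ℤ), zpow_mul, zpow_natCast,
    ← pow_mul, Real.rpow_neg (by positivity), ENNReal.ofReal_inv_of_pos (by positivity),
    ENNReal.mul_inv (Or.inr measure_ball_lt_top.ne) (Or.inl ENNReal.ofReal_ne_top),
    ← Nat.cast_mul, Real.rpow_natCast]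

theorem closedBall_two_zpow_subset_ball_of_mem {ρ : ℝ} (hρ : 0 < ρ) {x₀ x : X} (ha : a ≠ 0)
    (hx : x ∈ ball x₀ (ρ ^ a)) {k : ℤ} (hk : (2 : ℝ) ^ k ≤ ρ) :
    closedBall x (2 ^ ((a : ℤ) * k) : ℝ) ⊆ ball x₀ ((2 * ρ) ^ a) := by
  intro w hw
  rw [mem_closedBall, mul_comm (a : ℤ), zpow_mul, zpow_natCast] at hw
  rw [mem_ball] at hx ⊢
  have h1 : ((2 : ℝ) ^ k) ^ a ≤ ρ ^ a := pow_le_pow_left₀ (by positivity) hk a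
  have h2 : (2 : ℝ) ≤ 2 ^ a := by
    calc (2 : ℝ) = 2 ^ 1 := (pow_one _).symm
      _ ≤ 2 ^ a := pow_le_pow_right₀ (by norm_num) (Nat.one_le_iff_ne_zero.2 ha)
  have h3 : 2 * ρ ^ a ≤ (2 * ρ) ^ a := by
    rw [mul_pow]
    gcongr
  linarith [dist_triangle w x x₀]

/-- The closed cylinder of radius 2 ^ k sits in the open one of twice the radius; dividing the
previous bound by the volume leaves the factor 2^(-kβ). -/
theorem exists_cylAvg_le_morrey (ha : a ≠ 0) (hb : b ≠ 0) (μ : Measure X) [μ.IsAddHaarMeasure]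
    (ν : Measure Y) [ν.IsAddHaarMeasure] (hP : 1 ≤ P) (hQ : 1 ≤ Q) (β : ℝ) :
    ∃ C : ℝ≥0, ∀ F : X × Y → ℝ≥0∞, Measurable F → ∀ (k : ℤ) x y,
      cylAvg a b μ ν k F x y ≤ C * ENNReal.ofReal ((2 ^ k : ℝ) ^ (-β)) *
          morrey a b P Q (β - a * Module.finrank ℝ X / P - b * Module.finrank ℝ Y / Q) μ ν F := by
  obtain ⟨C, hC⟩ := exists_lintegral_cylinder_le_morrey a b μ ν hP hQ β
  set m := (a : ℝ) * Module.finrank ℝ X + b * Module.finrank ℝ Y with hm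
  set A : ℝ≥0∞ := (μ (ball 0 1))⁻¹ * (ν (ball 0 1))⁻¹ * C * ENNReal.ofReal (2 ^ (m - β)) with hA
  have hAtop : A ≠ ∞ := by
    refine ENNReal.mul_ne_top (ENNReal.mul_ne_top (ENNReal.mul_ne_top ?_ ?_) (by simp)) (by simp)
    · exact ENNReal.inv_ne_top.2 (measure_ball_pos μ 0 one_pos).ne'
    · exact ENNReal.inv_ne_top.2 (measure_ball_pos ν 0 one_pos).ne'
  refine ⟨A.toNNReal, fun F hF k x y => ?_⟩
  rw [ENNReal.coe_toNNReal hAtop]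
  set r : ℝ := 2 ^ k with hr
  have hr0 : 0 < r := by positivity
  have h1 : ∫⁻ x' in closedBall x (2 ^ ((a : ℤ) * k) : ℝ),
      ∫⁻ y' in closedBall y (2 ^ ((b : ℤ) * k) : ℝ), F (x', y') ∂ν ∂μ ≤
      ∫⁻ x' in ball x ((2 * r) ^ a), ∫⁻ y' in ball y ((2 * r) ^ b), F (x', y') ∂ν ∂μ :=
    (lintegral_mono_set (closedBall_two_zpow_subset_ball k x ha)).trans
      (lintegral_mono fun x' => lintegral_mono_set (closedBall_two_zpow_subset_ball k y hb))
  have h2 := h1.trans (hC F hF (2 * r) (by positivity) x y)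
  unfold cylAvg ballAvg
  rw [lintegral_const_mul' _ _ (ENNReal.inv_ne_top.2 (closedBall_measure_ne_zero ν _)),
    inv_measure_closedBall_two_zpow μ, inv_measure_closedBall_two_zpow ν]
  refine (mul_le_mul_right (mul_le_mul_right h2 _) _).trans (le_of_eq ?_)
  have e : ENNReal.ofReal (r ^ (-((a : ℝ) * Module.finrank ℝ X))) *
      ENNReal.ofReal (r ^ (-((b : ℝ) * Module.finrank ℝ Y))) *
      ENNReal.ofReal ((2 * r) ^ (m - β)) =
      ENNReal.ofReal (2 ^ (m - β)) * ENNReal.ofReal (r ^ (-β)) := by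
    rw [Real.mul_rpow (by norm_num) hr0.le, ← ENNReal.ofReal_mul (by positivity),
      ← ENNReal.ofReal_mul (by positivity), ← ENNReal.ofReal_mul (by positivity),
      ← Real.rpow_add hr0, mul_left_comm, ← Real.rpow_add hr0]
    congr 3
    rw [hm]
    ring
  set N := morrey a b P Q (β - a * Module.finrank ℝ X / P - b * Module.finrank ℝ Y / Q) μ ν F
  calc _ = (ENNReal.ofReal (r ^ (-((a : ℝ) * Module.finrank ℝ X))) *
        ENNReal.ofReal (r ^ (-((b : ℝ) * Module.finrank ℝ Y))) *
        ENNReal.ofReal ((2 * r) ^ (m - β))) * ((μ (ball 0 1))⁻¹ * (ν (ball 0 1))⁻¹ * C * N) := by ring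
    _ = _ := by rw [e, hA]; ring

/-- Localisation: averages at scales up to `ρ`, centred in a cylinder of radius `ρ`, only see `F` on
the doubled cylinder. -/
theorem cylAvg_le_hlMax_indicator (ha : a ≠ 0) (hb : b ≠ 0) (F : X × Y → ℝ≥0∞) {ρ : ℝ} (hρ : 0 < ρ)
    {x₀ x : X} {y₀ y : Y} (hx : x ∈ ball x₀ (ρ ^ a)) (hy : y ∈ ball y₀ (ρ ^ b)) {k : ℤ}
    (hk : (2 : ℝ) ^ k ≤ ρ) :
    cylAvg a b μ ν k F x y ≤ hlMax μ (fun x' => hlMax ν (fun y' =>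
      (ball x₀ ((2 * ρ) ^ a) ×ˢ ball y₀ ((2 * ρ) ^ b)).indicator F (x', y')) y) x := by
  refine le_trans (le_of_eq ?_) (cylAvg_le_hlMax_hlMax (a := a) (b := b) k _ x y)
  unfold cylAvg ballAvg
  congr 1
  refine setLIntegral_congr_fun measurableSet_closedBall fun x' hx' => ?_
  congr 1
  refine setLIntegral_congr_fun measurableSet_closedBall fun y' hy' => ?_
  have : (x', y') ∈ ball x₀ ((2 * ρ) ^ a) ×ˢ ball y₀ ((2 * ρ) ^ b) :=
    ⟨closedBall_two_zpow_subset_ball_of_mem hρ ha hx hk hx',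
      closedBall_two_zpow_subset_ball_of_mem hρ hb hy hk hy'⟩
  exact (indicator_of_mem this F).symm

/-- The maximal function over cylinders is bounded on mixed-norm Morrey spaces. -/
theorem exists_morrey_cylMax_le (ha : a ≠ 0) (hb : b ≠ 0) (μ : Measure X) [μ.IsAddHaarMeasure]
    (ν : Measure Y) [ν.IsAddHaarMeasure] (hP : 1 < P) (hQ : 1 < Q) {β : ℝ} (hβ : 0 < β) :
    ∃ C : ℝ≥0, ∀ F : X × Y → ℝ≥0∞, Measurable F →
      morrey a b P Q (β - a * Module.finrank ℝ X / P - b * Module.finrank ℝ Y / Q) μ ν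
        (cylMax a b μ ν F) ≤
      C * morrey a b P Q (β - a * Module.finrank ℝ X / P - b * Module.finrank ℝ Y / Q) μ ν F := by
  obtain ⟨C₁, hC₁⟩ := exists_mixedNorm_hlMax_hlMax_le μ ν hP hQ
  obtain ⟨C₂, hC₂⟩ := exists_cylAvg_le_morrey ha hb μ ν hP.le hQ.le β
  have hP0 : 0 < P := by linarith
  have hQ0 : 0 < Q := by linarith
  set γ := β - a * Module.finrank ℝ X / P - b * Module.finrank ℝ Y / Q with hγ
  set A : ℝ≥0∞ := C₁ * ENNReal.ofReal (2 ^ (-γ)) +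
    C₂ * ν (ball 0 1) ^ (1 / Q) * μ (ball 0 1) ^ (1 / P) with hA
  have hAtop : A ≠ ∞ := by
    refine ENNReal.add_ne_top.2 ⟨ENNReal.mul_ne_top (by simp) (by simp), ENNReal.mul_ne_top
      (ENNReal.mul_ne_top (by simp) ?_) ?_⟩ <;>
    exact ENNReal.rpow_ne_top_of_nonneg (by positivity) measure_ball_lt_top.ne
  refine ⟨A.toNNReal, fun F hF => ?_⟩
  rw [ENNReal.coe_toNNReal hAtop]
  set N := morrey a b P Q γ μ ν F with hN
  refine iSup₂_le fun ρ hρ => iSup₂_le fun x₀ y₀ => ?_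
  set F₁ := (ball x₀ ((2 * ρ) ^ a) ×ˢ ball y₀ ((2 * ρ) ^ b)).indicator F with hF₁
  have hF₁m : Measurable F₁ := hF.indicator (measurableSet_ball.prod measurableSet_ball)
  set G : X × Y → ℝ≥0∞ := fun z => hlMax μ (fun x' => hlMax ν (fun y' => F₁ (x', y')) z.2) z.1 with hG
  have hGm : Measurable G := measurable_hlMax_fst
    (g := fun z => hlMax ν (fun y' => F₁ (z.1, y')) z.2) (measurable_hlMax_prod hF₁m)
  set c : ℝ≥0∞ := C₂ * ENNReal.ofReal (ρ ^ (-β)) * N with hc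
  have h1 : ∀ᵐ x ∂μ.restrict (ball x₀ (ρ ^ a)), ∀ᵐ y ∂ν.restrict (ball y₀ (ρ ^ b)),
      cylMax a b μ ν F (x, y) ≤ G (x, y) + c := by
    refine (ae_restrict_iff' measurableSet_ball).2 (Filter.Eventually.of_forall fun x hx => ?_)
    refine (ae_restrict_iff' measurableSet_ball).2 (Filter.Eventually.of_forall fun y hy => ?_)
    refine iSup_le fun k => ?_
    -- Small scales go to the iterated maximal function of the localised `F`. At large scales β > 0
    -- gives (2 ^ k)^(-β) ≤ ρ^(-β), a constant on the cylinder.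
    rcases le_or_gt ((2 : ℝ) ^ k) ρ with hk | hk
    · exact (cylAvg_le_hlMax_indicator ha hb F hρ hx hy hk).trans le_self_add
    · refine (hC₂ F hF k x y).trans (le_trans ?_ le_add_self)
      exact mul_le_mul_left (mul_le_mul_right (ENNReal.ofReal_le_ofReal
        (Real.rpow_le_rpow_of_nonpos hρ hk.le (neg_nonpos.2 hβ.le))) _) _
  have h2 : mixedNorm P Q (μ.restrict (ball x₀ (ρ ^ a))) (ν.restrict (ball y₀ (ρ ^ b))) G ≤
      C₁ * (ENNReal.ofReal ((2 * ρ) ^ (-γ)) * N) := by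
    refine (mixedNorm_measure_mono hP0 hQ0 Measure.restrict_le_self Measure.restrict_le_self G).trans
      ((hC₁ F₁ hF₁m).trans ?_)
    gcongr
    rw [hF₁, mixedNorm_indicator hP0 hQ0 _ _ measurableSet_ball measurableSet_ball]
    exact mixedNorm_le_morrey F (by positivity) x₀ y₀
  have h3 : mixedNorm P Q (μ.restrict (ball x₀ (ρ ^ a))) (ν.restrict (ball y₀ (ρ ^ b)))
      (fun _ => c) = c * (ENNReal.ofReal (ρ ^ ((b : ℝ) * Module.finrank ℝ Y * (1 / Q))) *
        ν (ball 0 1) ^ (1 / Q)) * (ENNReal.ofReal (ρ ^ ((a : ℝ) * Module.finrank ℝ X * (1 / P))) *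
        μ (ball 0 1) ^ (1 / P)) := by
    rw [mixedNorm_const hP0 hQ0, Measure.restrict_apply_univ, Measure.restrict_apply_univ,
      measure_ball_rpow_eq μ x₀ hρ a (by positivity), measure_ball_rpow_eq ν y₀ hρ b (by positivity)]
  have h4 := (mixedNorm_mono (F := cylMax a b μ ν F) (G := fun z => G z + c) hP0 hQ0 h1).trans
    (mixedNorm_add_le (F := G) (G := fun _ => c) hP.le hQ.le hGm measurable_const)
  refine (mul_le_mul_right (h4.trans (add_le_add h2 h3.le)) _).trans (le_of_eq ?_)
  have e1 : ENNReal.ofReal (ρ ^ γ) * ENNReal.ofReal ((2 * ρ) ^ (-γ)) =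
      ENNReal.ofReal (2 ^ (-γ)) := by
    rw [Real.mul_rpow (by norm_num) hρ.le, ← ENNReal.ofReal_mul (by positivity), mul_left_comm,
      ← Real.rpow_add hρ]
    simp
  have e2 : ENNReal.ofReal (ρ ^ γ) * ENNReal.ofReal (ρ ^ (-β)) *
      ENNReal.ofReal (ρ ^ ((b : ℝ) * Module.finrank ℝ Y * (1 / Q))) *
      ENNReal.ofReal (ρ ^ ((a : ℝ) * Module.finrank ℝ X * (1 / P))) = 1 := by
    rw [← ENNReal.ofReal_mul (by positivity), ← ENNReal.ofReal_mul (by positivity),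
      ← ENNReal.ofReal_mul (by positivity), ← Real.rpow_add hρ, ← Real.rpow_add hρ,
      ← Real.rpow_add hρ]
    have : γ + -β + (b : ℝ) * Module.finrank ℝ Y * (1 / Q) +
      (a : ℝ) * Module.finrank ℝ X * (1 / P) = 0 := by rw [hγ]; ring
    rw [this]; simp
  calc _ = (ENNReal.ofReal (ρ ^ γ) * ENNReal.ofReal ((2 * ρ) ^ (-γ))) * (C₁ * N) +
        (ENNReal.ofReal (ρ ^ γ) * ENNReal.ofReal (ρ ^ (-β)) *
          ENNReal.ofReal (ρ ^ ((b : ℝ) * Module.finrank ℝ Y * (1 / Q))) *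
          ENNReal.ofReal (ρ ^ ((a : ℝ) * Module.finrank ℝ X * (1 / P)))) *
        (C₂ * N * ν (ball 0 1) ^ (1 / Q) * μ (ball 0 1) ^ (1 / P)) := by rw [hc]; ring
    _ = _ := by rw [e1, e2, hA]; ring

end Morrey

/-! ### Functions of temperate growth and convergence in the Schwartz space. -/

section Temperate

open Filter Topology

/-- Averaging a function of temperate growth over its dilations. -/
theorem hasTemperateGrowth_integral_dilation {ψ : ℝ → ℝ} (hψ : Function.HasTemperateGrowth ψ) :
    Function.HasTemperateGrowth fun y : ℝ => ∫ s in (0 : ℝ)..1, ψ (s * y) := by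
  -- `J n` is the n-th derivative of the average, obtained by differentiating under the integral
  -- sign; the chain rule produces s ^ n ≤ 1.
  set J : ℕ → ℝ → ℝ := fun n y => ∫ s in (0 : ℝ)..1, s ^ n * iteratedDeriv n ψ (s * y) with hJ
  have hcont : ∀ n, Continuous (iteratedDeriv n ψ) := fun n =>
    hψ.1.continuous_iteratedDeriv n (by exact_mod_cast le_top)
  have hbd : ∀ n, ∃ (k : ℕ) (C : ℝ), 0 ≤ C ∧ ∀ (s y : ℝ), 0 ≤ s → s ≤ 1 →
      ‖s ^ n * iteratedDeriv n ψ (s * y)‖ ≤ C * (1 + ‖y‖) ^ k := by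
    intro n
    obtain ⟨k, C, hC0, hC⟩ := hψ.norm_iteratedFDeriv_le_uniform n
    refine ⟨k, C, hC0, fun s y hs hs1 => ?_⟩
    have h := hC n le_rfl (s * y)
    rw [norm_iteratedFDeriv_eq_norm_iteratedDeriv] at h
    rw [norm_mul, norm_pow, Real.norm_of_nonneg hs]
    have hsy : ‖s * y‖ ≤ ‖y‖ := by
      rw [norm_mul, Real.norm_of_nonneg hs]
      exact mul_le_of_le_one_left (norm_nonneg _) hs1
    calc s ^ n * ‖iteratedDeriv n ψ (s * y)‖ ≤ 1 * (C * (1 + ‖y‖) ^ k) := by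
          refine mul_le_mul (pow_le_one₀ hs hs1) (h.trans ?_) (norm_nonneg _) zero_le_one
          gcongr
      _ = _ := one_mul _
  have hderiv : ∀ n y, HasDerivAt (J n) (J (n + 1) y) y := by
    intro n y
    obtain ⟨k, C, hC0, hC⟩ := hbd (n + 1)
    refine (intervalIntegral.hasDerivAt_integral_of_dominated_loc_of_deriv_le (μ := volume)
      (F := fun y s => s ^ n * iteratedDeriv n ψ (s * y))
      (F' := fun y s => s ^ (n + 1) * iteratedDeriv (n + 1) ψ (s * y)) (s := Metric.ball y 1)
      (bound := fun _ => C * (1 + (‖y‖ + 1)) ^ k)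
      (Metric.ball_mem_nhds y one_pos) ?_ ?_ ?_ ?_ ?_ ?_).2
    · refine Eventually.of_forall fun x => Continuous.aestronglyMeasurable ?_
      exact (continuous_id.pow n).mul ((hcont n).comp (continuous_id.mul continuous_const))
    · exact ((continuous_id.pow n).mul
        ((hcont n).comp (continuous_id.mul continuous_const))).intervalIntegrable _ _
    · exact ((continuous_id.pow (n + 1)).mul
        ((hcont (n + 1)).comp (continuous_id.mul continuous_const))).aestronglyMeasurable
    · refine Eventually.of_forall fun s hs x hx => ?_
      rw [Set.uIoc_of_le zero_le_one] at hs
      refine (hC s x hs.1.le hs.2).trans ?_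
      have : ‖x‖ ≤ ‖y‖ + 1 := by
        have := norm_le_norm_add_norm_sub' x y
        rw [Metric.mem_ball, dist_eq_norm] at hx
        linarith
      gcongr
    · exact intervalIntegrable_const
    · refine Eventually.of_forall fun s hs x hx => ?_
      have h1 : HasDerivAt (iteratedDeriv n ψ) (iteratedDeriv (n + 1) ψ (s * x)) (s * x) := by
        rw [iteratedDeriv_succ]
        exact ((hψ.1.differentiable_iteratedDeriv n (by exact_mod_cast ENat.natCast_lt_top n)) _).hasDerivAt
      have h2 := (h1.comp x ((hasDerivAt_id x).const_mul s)).const_mul (s ^ n)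
      convert! h2 using 1
      ring
  have hiter : ∀ n, iteratedDeriv n (fun y : ℝ => ∫ s in (0 : ℝ)..1, ψ (s * y)) = J n := by
    intro n
    induction n with
    | zero => ext y; simp [hJ]
    | succ n ih =>
      rw [iteratedDeriv_succ, ih]
      ext y
      exact (hderiv n y).deriv
  refine ⟨contDiff_of_differentiable_iteratedDeriv fun n _ => ?_, fun n => ?_⟩
  · rw [hiter]
    exact fun y => (hderiv n y).differentiableAt
  · obtain ⟨k, C, hC0, hC⟩ := hbd n
    refine ⟨k, C, fun y => ?_⟩
    rw [norm_iteratedFDeriv_eq_norm_iteratedDeriv, hiter]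
    refine (intervalIntegral.norm_integral_le_of_norm_le_const (C := C * (1 + ‖y‖) ^ k)
      fun s hs => ?_).trans (by simp)
    rw [Set.uIoc_of_le zero_le_one] at hs
    exact hC s y hs.1.le hs.2

/-- Hadamard's lemma. Together with `hasTemperateGrowth_integral_dilation` it divides a function
vanishing at 0 by its variable without leaving the class of temperate growth. -/
theorem mul_integral_deriv_dilation {ψ : ℝ → ℝ} (hψ : ContDiff ℝ 1 ψ) (y : ℝ) :
    y * ∫ s in (0 : ℝ)..1, deriv ψ (s * y) = ψ y - ψ 0 := by
  have h := intervalIntegral.mul_integral_comp_mul_right (a := 0) (b := 1) (f := deriv ψ) y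
  rw [h, zero_mul, one_mul]
  exact intervalIntegral.integral_deriv_eq_sub (fun x _ => (hψ.differentiable one_ne_zero) x)
    ((hψ.continuous_deriv le_rfl).intervalIntegrable _ _)

theorem hasTemperateGrowth_deriv {ψ : ℝ → ℝ} (hψ : Function.HasTemperateGrowth ψ) :
    Function.HasTemperateGrowth (deriv ψ) := by
  refine ⟨((contDiff_infty_iff_deriv).1 hψ.1).2, fun n => ?_⟩
  obtain ⟨k, C, hC⟩ := hψ.2 (n + 1)
  refine ⟨k, C, fun x => ?_⟩
  have := hC x
  rwa [norm_iteratedFDeriv_eq_norm_iteratedDeriv, iteratedDeriv_succ',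
    ← norm_iteratedFDeriv_eq_norm_iteratedDeriv] at this

variable {E : Type*} [NormedAddCommGroup E] [NormedSpace ℝ E]

/-- The Schwartz function `exp (-Q)`, for `Q` of temperate growth and at least linear growth. -/
def expNegSchwartz (Q : E → ℝ) (hQ : Function.HasTemperateGrowth Q) (c b : ℝ) (hc : 0 < c)
    (h : ∀ z, c * ‖z‖ - b ≤ Q z) : 𝓢(E, ℝ) where
  toFun z := Real.exp (-Q z)
  smooth' := Real.contDiff_exp.comp hQ.1.neg
  decay' k n := by
    obtain ⟨m, C, hC0, hC⟩ := hQ.norm_iteratedFDeriv_le_uniform n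
    set N := k + m * n
    refine ⟨n.factorial * (1 + C) ^ n * (N.factorial / c ^ N * Real.exp (c + b)), fun z => ?_⟩
    have hz : 1 ≤ 1 + ‖z‖ := by linarith [norm_nonneg z]
    have hD1 : 1 ≤ (1 + C) * (1 + ‖z‖) ^ m :=
      one_le_mul_of_one_le_of_one_le (by linarith) (one_le_pow₀ hz)
    -- Faà di Bruno. The base contains 1 + C instead of C in order to be at least 1, so that it is
    -- bounded by its own i-th power for i ≥ 1.
    have h1 : ‖iteratedFDeriv ℝ n (Real.exp ∘ fun z => -Q z) z‖ ≤
        n.factorial * Real.exp (-Q z) * ((1 + C) * (1 + ‖z‖) ^ m) ^ n := by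
      refine norm_iteratedFDeriv_comp_le (N := n) Real.contDiff_exp
        (hQ.1.neg.of_le (by exact_mod_cast le_top)) le_rfl z (fun i _ => ?_) (fun i hi hin => ?_)
      · rw [norm_iteratedFDeriv_eq_norm_iteratedDeriv, iteratedDeriv_eq_iterate, Real.iter_deriv_exp,
          Real.norm_of_nonneg (Real.exp_pos _).le]
      · have e : (fun z => -Q z) = -Q := rfl
        rw [e, iteratedFDeriv_neg_apply, norm_neg]
        calc ‖iteratedFDeriv ℝ i Q z‖ ≤ C * (1 + ‖z‖) ^ m := hC i hin z
          _ ≤ (1 + C) * (1 + ‖z‖) ^ m := by gcongr; linarith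
          _ ≤ _ := le_self_pow₀ hD1 (by omega)
    -- A single term of the exponential series absorbs the whole polynomial growth.
    have h2 : (1 + ‖z‖) ^ N ≤ N.factorial / c ^ N * Real.exp (c * (1 + ‖z‖)) := by
      have := Real.pow_div_factorial_le_exp (c * (1 + ‖z‖)) (by positivity) N
      rw [div_le_iff₀ (by positivity), mul_pow] at this
      rw [div_mul_eq_mul_div, le_div_iff₀ (by positivity)]
      linarith
    calc ‖z‖ ^ k * ‖iteratedFDeriv ℝ n (fun z => Real.exp (-Q z)) z‖
        ≤ (1 + ‖z‖) ^ k * (n.factorial * Real.exp (-Q z) * ((1 + C) * (1 + ‖z‖) ^ m) ^ n) := by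
          refine mul_le_mul ?_ h1 (norm_nonneg _) (by positivity)
          gcongr
          linarith
      _ = n.factorial * (1 + C) ^ n * ((1 + ‖z‖) ^ N * Real.exp (-Q z)) := by
          rw [mul_pow, ← pow_mul, pow_add]; ring
      _ ≤ n.factorial * (1 + C) ^ n * ((N.factorial / c ^ N * Real.exp (c * (1 + ‖z‖))) *
            Real.exp (b - c * ‖z‖)) := by
          gcongr
          linarith [h z]
      _ = _ := by
          rw [mul_assoc (_ / _), ← Real.exp_add]
          ring_nf

/-- Order zero is the mean value inequality, which costs the factor 1 + ‖z‖. In higher orders the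
constant disappears and the chain rule yields ‖L‖ ^ i ≤ ‖L‖. -/
theorem norm_iteratedFDeriv_comp_sub_le (σ : 𝓢(E, ℂ)) (i : ℕ) :
    ∃ B : ℝ, 0 ≤ B ∧ ∀ L : E →L[ℝ] E, ‖L‖ ≤ 1 → ∀ z,
      ‖iteratedFDeriv ℝ i (fun z => σ (L z) - σ 0) z‖ ≤ B * ‖L‖ * (1 + ‖z‖) := by
  rcases Nat.eq_zero_or_pos i with rfl | hi
  · obtain ⟨B, hB0, hB⟩ := σ.decay 0 1
    refine ⟨B, hB0.le, fun L hL z => ?_⟩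
    rw [norm_iteratedFDeriv_zero]
    have h1 : ‖σ (L z) - σ 0‖ ≤ B * ‖L z - 0‖ := by
      refine convex_univ.norm_image_sub_le_of_norm_fderiv_le (𝕜 := ℝ) (fun x _ => σ.differentiableAt)
        (fun x _ => ?_) (Set.mem_univ _) (Set.mem_univ _)
      have := hB x
      rwa [pow_zero, one_mul, norm_iteratedFDeriv_one] at this
    rw [sub_zero] at h1
    calc _ ≤ B * ‖L z‖ := h1
      _ ≤ B * (‖L‖ * ‖z‖) := by gcongr; exact L.le_opNorm z
      _ ≤ _ := by
        have := mul_nonneg hB0.le (norm_nonneg L)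
        nlinarith
  · obtain ⟨B, hB0, hB⟩ := σ.decay 0 i
    refine ⟨B, hB0.le, fun L hL z => ?_⟩
    have e1 : iteratedFDeriv ℝ i (fun z => σ (L z) - σ 0) z = iteratedFDeriv ℝ i (σ ∘ L) z := by
      have : (fun z => σ (L z) - σ 0) = (σ ∘ L) - fun _ => σ 0 := rfl
      rw [this, iteratedFDeriv_sub_apply
        (((σ.smooth i).comp L.contDiff).contDiffAt) contDiff_const.contDiffAt,
        iteratedFDeriv_const_of_ne hi.ne']
      simp
    rw [e1, L.iteratedFDeriv_comp_right (σ.smooth i) z le_rfl]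
    refine (ContinuousMultilinearMap.norm_compContinuousLinearMap_le _ _).trans ?_
    rw [Finset.prod_const, Finset.card_univ, Fintype.card_fin]
    have h1 := hB (L z)
    rw [pow_zero, one_mul] at h1
    have h2 : ‖L‖ ^ i ≤ ‖L‖ := pow_le_of_le_one (norm_nonneg _) hL hi.ne'
    calc _ ≤ B * ‖L‖ := by gcongr
      _ ≤ _ := le_mul_of_one_le_right (by positivity) (by linarith [norm_nonneg z])

/-- Multiplication by the dilates of a Schwartz function converges to a multiple of the identity. -/
theorem tendsto_smulLeftCLM_comp (σ ψ : 𝓢(E, ℂ)) {L : ℕ → E →L[ℝ] E}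
    (hL : Tendsto (fun n => ‖L n‖) atTop (𝓝 0)) :
    Tendsto (fun n => smulLeftCLM ℂ (fun z => σ (L n z)) ψ) atTop (𝓝 (σ 0 • ψ)) := by
  rw [(schwartz_withSeminorms ℝ E ℂ).tendsto_nhds]
  rintro ⟨k, n⟩ ε hε
  choose B hB0 hB using norm_iteratedFDeriv_comp_sub_le σ
  -- Leibniz' rule; the growth 1 + ‖z‖ of the other factor is paid by one more power of the weight,
  -- hence the seminorms of index `k + 1`.
  set A : ℝ := ∑ i ∈ Finset.range (n + 1), (n.choose i) * B i *
    (SchwartzMap.seminorm ℝ k (n - i) ψ + SchwartzMap.seminorm ℝ (k + 1) (n - i) ψ) with hA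
  have hA0 : 0 ≤ A := Finset.sum_nonneg fun i _ => by
    have := hB0 i
    positivity
  have hlim : Tendsto (fun n => A * ‖L n‖) atTop (𝓝 0) := by simpa using hL.const_mul A
  filter_upwards [hlim.eventually (gt_mem_nhds hε), hL.eventually (gt_mem_nhds one_pos)]
    with N h1 h2
  refine lt_of_le_of_lt ?_ h1
  rw [schwartzSeminormFamily_apply]
  refine SchwartzMap.seminorm_le_bound ℝ k n _ (by positivity) fun z => ?_
  have htg : Function.HasTemperateGrowth fun z => σ (L N z) :=
    σ.hasTemperateGrowth.comp (L N).hasTemperateGrowth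
  have e : ⇑(smulLeftCLM ℂ (fun z => σ (L N z)) ψ - σ 0 • ψ) =
      fun z => (σ (L N z) - σ 0) * ψ z := by
    ext z
    simp [htg, sub_mul]
  rw [e]
  have hsm : ContDiff ℝ n (fun z => σ (L N z) - σ 0) :=
    ((σ.smooth n).comp (L N).contDiff).sub contDiff_const
  have h3 := norm_iteratedFDeriv_mul_le hsm (ψ.smooth n) z (n := n) le_rfl
  calc ‖z‖ ^ k * ‖iteratedFDeriv ℝ n (fun z => (σ (L N z) - σ 0) * ψ z) z‖
      ≤ ‖z‖ ^ k * ∑ i ∈ Finset.range (n + 1), (n.choose i) *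
          ‖iteratedFDeriv ℝ i (fun z => σ (L N z) - σ 0) z‖ * ‖iteratedFDeriv ℝ (n - i) ψ z‖ := by
        gcongr
    _ ≤ ∑ i ∈ Finset.range (n + 1), ((n.choose i) * B i *
          (SchwartzMap.seminorm ℝ k (n - i) ψ + SchwartzMap.seminorm ℝ (k + 1) (n - i) ψ)) * ‖L N‖ := by
        rw [Finset.mul_sum]
        refine Finset.sum_le_sum fun i _ => ?_
        have h4 := SchwartzMap.le_seminorm ℝ k (n - i) ψ z
        have h5 := SchwartzMap.le_seminorm ℝ (k + 1) (n - i) ψ z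
        have h6 := hB i (L N) h2.le z
        have hc : 0 ≤ (n.choose i : ℝ) * B i * ‖L N‖ := by
          have := hB0 i
          positivity
        calc ‖z‖ ^ k * ((n.choose i) * ‖iteratedFDeriv ℝ i (fun z => σ (L N z) - σ 0) z‖ *
              ‖iteratedFDeriv ℝ (n - i) ψ z‖)
            ≤ ‖z‖ ^ k * ((n.choose i) * (B i * ‖L N‖ * (1 + ‖z‖)) *
              ‖iteratedFDeriv ℝ (n - i) ψ z‖) := by gcongr
          _ = (n.choose i) * B i * ‖L N‖ * (‖z‖ ^ k * ‖iteratedFDeriv ℝ (n - i) ψ z‖ +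
                ‖z‖ ^ (k + 1) * ‖iteratedFDeriv ℝ (n - i) ψ z‖) := by rw [pow_succ]; ring
          _ ≤ (n.choose i) * B i * ‖L N‖ * (SchwartzMap.seminorm ℝ k (n - i) ψ +
                SchwartzMap.seminorm ℝ (k + 1) (n - i) ψ) := by gcongr
          _ = _ := by ring
    _ = A * ‖L N‖ := by rw [hA, Finset.sum_mul]

end Temperate

/-! ### Fourier multipliers acting on test functions. -/

section Multiplier

open FourierTransform Filter Topology

variable {E : Type*} [NormedAddCommGroup E] [InnerProductSpace ℝ E] [FiniteDimensional ℝ E]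
  [MeasurableSpace E] [BorelSpace E]

/-- The transpose of the Fourier multiplier with symbol `σ`. -/
def multT (σ : E → ℂ) (φ : 𝓢(E, ℂ)) : 𝓢(E, ℂ) := 𝓕 (smulLeftCLM ℂ σ (𝓕⁻ φ))

theorem multT_comp {σ τ : E → ℂ} (hσ : Function.HasTemperateGrowth σ)
    (hτ : Function.HasTemperateGrowth τ) (φ : 𝓢(E, ℂ)) :
    multT σ (multT τ φ) = multT (σ * τ) φ := by
  unfold multT
  rw [FourierTransform.fourierInv_fourier_eq, smulLeftCLM_smulLeftCLM_apply hσ hτ]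

theorem multT_add {σ τ : E → ℂ} (hσ : Function.HasTemperateGrowth σ)
    (hτ : Function.HasTemperateGrowth τ) (φ : 𝓢(E, ℂ)) :
    multT (σ + τ) φ = multT σ φ + multT τ φ := by
  unfold multT
  rw [smulLeftCLM_add hσ hτ, add_apply, FourierTransform.fourier_add]

theorem multT_smul {σ : E → ℂ} (hσ : Function.HasTemperateGrowth σ) (c : ℂ) (φ : 𝓢(E, ℂ)) :
    multT (c • σ) φ = c • multT σ φ := by
  unfold multT
  rw [smulLeftCLM_smul hσ, smul_apply, FourierTransform.fourier_smul]

/-- The outermost transform in `multT` is the forward one, so a derivative becomes multiplication by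
minus the usual symbol. -/
theorem lineDerivOp_multT {σ : E → ℂ} (hσ : Function.HasTemperateGrowth σ) (m : E) (φ : 𝓢(E, ℂ)) :
    ∂_{m} (multT σ φ) =
      multT (fun ζ => -(2 * Real.pi * Complex.I) * ((inner ℝ ζ m : ℝ) : ℂ) * σ ζ) φ := by
  unfold multT
  rw [SchwartzMap.lineDerivOp_fourier_eq]
  congr 1
  ext ζ
  have h1 : Function.HasTemperateGrowth fun ζ : E => (inner ℝ ζ m : ℝ) := by fun_prop
  have h2 : Function.HasTemperateGrowth fun ζ : E => ((inner ℝ ζ m : ℝ) : ℂ) :=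
    Complex.ofRealCLM.hasTemperateGrowth.comp h1
  have h3 : Function.HasTemperateGrowth
      fun ζ => -(2 * Real.pi * Complex.I) * ((inner ℝ ζ m : ℝ) : ℂ) * σ ζ :=
    ((Function.HasTemperateGrowth.const _).mul h2).mul hσ
  rw [smulLeftCLM_apply_apply h3]
  simp only [smul_apply, smulLeftCLM_apply_apply h1, smulLeftCLM_apply_apply hσ, smul_eq_mul,
    Complex.real_smul]
  ring

/-- An approximate identity seen on the Fourier side; it supplies the limit of the telescoping sum
over finer and finer scales. -/
theorem tendsto_multT_comp (σ φ : 𝓢(E, ℂ)) (h0 : σ 0 = 1) {L : ℕ → E →L[ℝ] E}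
    (hL : Tendsto (fun n => ‖L n‖) atTop (𝓝 0)) :
    Tendsto (fun n => multT (fun z => σ (L n z)) φ) atTop (𝓝 φ) := by
  have h1 := tendsto_smulLeftCLM_comp σ (𝓕⁻ φ) hL
  have h2 := ((fourierCLM ℂ 𝓢(E, ℂ)).continuous.tendsto _).comp h1
  rw [h0, one_smul, fourierCLM_apply, FourierTransform.fourier_fourierInv_eq] at h2
  exact h2

theorem multT_apply_eq_integral (σ φ : 𝓢(E, ℂ)) (z : E) :
    multT σ φ z = ∫ w, 𝓕 σ (z - w) * φ w := by
  have h1 : multT σ φ z = convolution (ContinuousLinearMap.mul ℂ ℂ) (𝓕 σ) φ z := by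
    have h2 : convolution (ContinuousLinearMap.mul ℂ ℂ) (𝓕 σ) φ =
        𝓕⁻ (pairing (ContinuousLinearMap.mul ℂ ℂ) (𝓕 (𝓕 σ)) (𝓕 φ)) := rfl
    have h3 : ∀ (ψ : 𝓢(E, ℂ)) ζ, 𝓕 ψ (-ζ) = 𝓕⁻ ψ ζ := fun ψ ζ => rfl
    rw [h2, fourierInv_coe, Real.fourierInv_eq_fourier_comp_neg]
    unfold multT
    rw [fourier_coe, smulLeftCLM_apply σ.hasTemperateGrowth]
    refine congrArg (fun f : E → ℂ => 𝓕 f z) (funext fun ζ => ?_)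
    rw [pairing_apply_apply, h3, h3, FourierTransform.fourierInv_fourier_eq]
    rfl
  rw [h1, convolution_apply, MeasureTheory.convolution_eq_swap]
  rfl

end Multiplier

/-! ### Parabolic dilations and the Fourier transform. -/

section Dilation

open FourierTransform Filter Topology

variable {d : ℕ}

/-- The parabolic dilation with ratio `2 ^ k`. -/
def dil (d : ℕ) (k : ℤ) : SpaceTime d ≃L[ℝ] SpaceTime d :=
  LinearEquiv.toContinuousLinearEquiv
    { toFun := fun z => pt ((2 : ℝ) ^ (2 * k) * z.fst) ((2 : ℝ) ^ k • z.snd)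
      invFun := fun z => pt ((2 : ℝ) ^ (-(2 * k)) * z.fst) ((2 : ℝ) ^ (-k) • z.snd)
      map_add' := fun x y => by
        refine WithLp.ofLp_injective 2 (Prod.ext ?_ ?_)
        · exact mul_add _ _ _
        · exact smul_add _ _ _
      map_smul' := fun c x => by
        refine WithLp.ofLp_injective 2 (Prod.ext ?_ ?_)
        · exact mul_left_comm _ _ _
        · exact smul_comm _ _ _
      left_inv := fun z => by
        have h1 : (2 : ℝ) ^ (-(2 * k)) * 2 ^ (2 * k) = 1 := by
          rw [← zpow_add₀ two_ne_zero]; simp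
        have h2 : (2 : ℝ) ^ (-k) * 2 ^ k = 1 := by rw [← zpow_add₀ two_ne_zero]; simp
        refine WithLp.ofLp_injective 2 (Prod.ext ?_ ?_)
        · change (2 : ℝ) ^ (-(2 * k)) * (2 ^ (2 * k) * z.fst) = z.fst
          rw [← mul_assoc, h1, one_mul]
        · change ((2 : ℝ) ^ (-k) • (2 : ℝ) ^ k • z.snd) = z.snd
          rw [smul_smul, h2, one_smul]
      right_inv := fun z => by
        have h1 : (2 : ℝ) ^ (2 * k) * 2 ^ (-(2 * k)) = 1 := by
          rw [← zpow_add₀ two_ne_zero]; simp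
        have h2 : (2 : ℝ) ^ k * 2 ^ (-k) = 1 := by rw [← zpow_add₀ two_ne_zero]; simp
        refine WithLp.ofLp_injective 2 (Prod.ext ?_ ?_)
        · change (2 : ℝ) ^ (2 * k) * (2 ^ (-(2 * k)) * z.fst) = z.fst
          rw [← mul_assoc, h1, one_mul]
        · change ((2 : ℝ) ^ k • (2 : ℝ) ^ (-k) • z.snd) = z.snd
          rw [smul_smul, h2, one_smul] }

theorem dil_apply (k : ℤ) (z : SpaceTime d) :
    dil d k z = pt ((2 : ℝ) ^ (2 * k) * z.fst) ((2 : ℝ) ^ k • z.snd) := rfl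

@[simp]
theorem dil_fst (k : ℤ) (z : SpaceTime d) : (dil d k z).fst = (2 : ℝ) ^ (2 * k) * z.fst := rfl

@[simp]
theorem dil_snd (k : ℤ) (z : SpaceTime d) : (dil d k z).snd = (2 : ℝ) ^ k • z.snd := rfl

theorem inner_dil_dil_neg (k : ℤ) (v z : SpaceTime d) :
    inner ℝ (dil d k v) (dil d (-k) z) = inner ℝ v z := by
  have h1 : (2 : ℝ) ^ (2 * k) * 2 ^ (2 * -k) = 1 := by rw [← zpow_add₀ two_ne_zero]; simp
  have h2 : (2 : ℝ) ^ k * 2 ^ (-k) = 1 := by rw [← zpow_add₀ two_ne_zero]; simp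
  rw [WithLp.prod_inner_apply, WithLp.prod_inner_apply]
  change inner ℝ ((2 : ℝ) ^ (2 * k) • v.fst) ((2 : ℝ) ^ (2 * -k) • z.fst) +
    inner ℝ ((2 : ℝ) ^ k • v.snd) ((2 : ℝ) ^ (-k) • z.snd) = inner ℝ v.fst z.fst + inner ℝ v.snd z.snd
  rw [inner_smul_left, inner_smul_right, inner_smul_left, inner_smul_right]
  simp only [conj_trivial]
  rw [← mul_assoc, ← mul_assoc, h1, h2, one_mul, one_mul]

theorem norm_dil_le {k : ℤ} (hk : k ≤ 0) :
    ‖(dil d k : SpaceTime d →L[ℝ] SpaceTime d)‖ ≤ (2 : ℝ) ^ k := by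
  refine ContinuousLinearMap.opNorm_le_bound _ (by positivity) fun z => ?_
  refine le_of_sq_le_sq ?_ (by positivity)
  rw [mul_pow, WithLp.prod_norm_sq_eq_of_L2, WithLp.prod_norm_sq_eq_of_L2]
  change ‖(2 : ℝ) ^ (2 * k) * z.fst‖ ^ 2 + ‖(2 : ℝ) ^ k • z.snd‖ ^ 2 ≤ _
  have h0 : (0 : ℝ) < 2 ^ k := by positivity
  have h1 : (2 : ℝ) ^ k ≤ 1 := zpow_le_one_of_nonpos₀ (by norm_num) hk
  rw [norm_mul, norm_smul, mul_comm 2 k, zpow_mul, zpow_ofNat, norm_pow, Real.norm_of_nonneg h0.le,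
    mul_pow, mul_pow, mul_add]
  gcongr
  exact pow_le_of_le_one h0.le h1 two_ne_zero

theorem tendsto_norm_dil_sub (k : ℤ) :
    Tendsto (fun n : ℕ => ‖(dil d (k - n) : SpaceTime d →L[ℝ] SpaceTime d)‖) atTop (𝓝 0) := by
  have h : Tendsto (fun n : ℕ => (2 : ℝ) ^ k * 2⁻¹ ^ n) atTop (𝓝 0) := by
    simpa using (tendsto_pow_atTop_nhds_zero_of_lt_one (r := (2⁻¹ : ℝ)) (by norm_num)
      (by norm_num)).const_mul ((2 : ℝ) ^ k)
  refine squeeze_zero' (Eventually.of_forall fun _ => norm_nonneg _) ?_ h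
  filter_upwards [eventually_ge_atTop k.toNat] with n hn
  refine (norm_dil_le (by omega)).trans (le_of_eq ?_)
  rw [zpow_sub₀ two_ne_zero, zpow_natCast, inv_pow, div_eq_mul_inv]

theorem map_dil_volume (k : ℤ) :
    Measure.map (dil d k) volume =
      ENNReal.ofReal ((2 : ℝ) ^ (-(k * (d + 2)))) • (volume : Measure (SpaceTime d)) := by
  have e : (dil d k : SpaceTime d → SpaceTime d) = WithLp.toLp 2 ∘
      Prod.map (fun t : ℝ => (2 : ℝ) ^ (2 * k) • t)
        (fun x : EuclideanSpace ℝ (Fin d) => (2 : ℝ) ^ k • x) ∘ WithLp.ofLp := rfl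
  have hm1 : Measurable fun t : ℝ => (2 : ℝ) ^ (2 * k) • t := by fun_prop
  have hm2 : Measurable fun x : EuclideanSpace ℝ (Fin d) => (2 : ℝ) ^ k • x := by fun_prop
  rw [e, ← Measure.map_map (WithLp.measurable_toLp _ _) ((hm1.prodMap hm2).comp
    (WithLp.measurable_ofLp _ _)), ← Measure.map_map (hm1.prodMap hm2) (WithLp.measurable_ofLp _ _),
    (WithLp.volume_preserving_ofLp ℝ (EuclideanSpace ℝ (Fin d))).map_eq, Measure.volume_eq_prod,
    ← Measure.map_prod_map _ _ hm1 hm2, Measure.map_addHaar_smul _ (by positivity),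
    Measure.map_addHaar_smul _ (by positivity), Measure.prod_smul_left, Measure.prod_smul_right,
    smul_smul, Measure.map_smul, ← Measure.volume_eq_prod,
    (WithLp.volume_preserving_toLp ℝ (EuclideanSpace ℝ (Fin d))).map_eq]
  congr 1
  rw [← ENNReal.ofReal_mul (abs_nonneg _), abs_of_pos (by positivity), abs_of_pos (by positivity)]
  congr 1
  rw [Module.finrank_self, finrank_euclideanSpace_fin, pow_one, ← zpow_natCast, ← zpow_mul, ← zpow_neg,
    ← zpow_neg, ← zpow_add₀ two_ne_zero]
  congr 1
  ring

/-- The dilate `σ (dil k ·)` of a Schwartz function. -/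
def dilate (k : ℤ) (σ : 𝓢(SpaceTime d, ℂ)) : 𝓢(SpaceTime d, ℂ) :=
  compCLMOfContinuousLinearEquiv ℂ (dil d k) σ

@[simp]
theorem dilate_apply (k : ℤ) (σ : 𝓢(SpaceTime d, ℂ)) (z : SpaceTime d) :
    dilate k σ z = σ (dil d k z) := rfl

/-- Change of variables: `dil d k` is symmetric with inverse `dil d (-k)` and Jacobian 2^(k(d+2)).
So a symbol dilated by 2 ^ k has a kernel living at the parabolic scale 2 ^ k, with unchanged L¹
norm. -/
theorem fourier_dilate_apply (k : ℤ) (σ : 𝓢(SpaceTime d, ℂ)) (z : SpaceTime d) :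
    𝓕 (dilate k σ) z = ((2 : ℝ) ^ (-(k * (d + 2)) : ℤ) : ℝ) • 𝓕 σ (dil d (-k) z) := by
  rw [fourier_coe, fourier_coe, Real.fourier_eq, Real.fourier_eq]
  set G : SpaceTime d → ℂ := fun v => Real.fourierChar (-inner ℝ v (dil d (-k) z)) • σ v
  have h1 : ∀ v, Real.fourierChar (-inner ℝ v z) • dilate k σ v = G (dil d k v) := by
    intro v
    simp only [G, inner_dil_dil_neg, dilate_apply]
  simp only [h1]
  have h2 := (dil d k).toHomeomorph.measurableEmbedding.integral_map (μ := volume) G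
  change ∫ y, G y ∂(Measure.map (dil d k) volume) = ∫ v, G (dil d k v) at h2
  rw [← h2, map_dil_volume, integral_smul_measure, ENNReal.toReal_ofReal (by positivity)]

end Dilation

/-! ### Dilated Schwartz kernels are controlled by the parabolic maximal function. -/

section KernelBound

open FourierTransform Filter Topology Set Metric

variable {d : ℕ}

/-- The parabolic maximal function on space-time. -/
def parMax (H : SpaceTime d → ℝ≥0∞) (z : SpaceTime d) : ℝ≥0∞ :=
  cylMax 2 1 (volume : Measure ℝ) (volume : Measure (EuclideanSpace ℝ (Fin d)))
    (fun p => H (WithLp.toLp 2 p)) z.ofLp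

theorem measurable_parMax {H : SpaceTime d → ℝ≥0∞} (hH : Measurable H) : Measurable (parMax H) :=
  (measurable_cylMax (hH.comp (WithLp.measurable_toLp _ _))).comp (WithLp.measurable_ofLp _ _)

theorem lintegral_spaceTime {H : SpaceTime d → ℝ≥0∞} (hH : Measurable H) :
    ∫⁻ z, H z = ∫⁻ t : ℝ, ∫⁻ x : EuclideanSpace ℝ (Fin d), H (pt t x) := by
  have h1 : Measurable fun p : ℝ × EuclideanSpace ℝ (Fin d) => H (WithLp.toLp 2 p) :=
    hH.comp (WithLp.measurable_toLp _ _)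
  rw [← (WithLp.volume_preserving_toLp ℝ (EuclideanSpace ℝ (Fin d))).lintegral_comp hH,
    Measure.volume_eq_prod, lintegral_prod _ h1.aemeasurable]

/-- The closed parabolic cylinder of radius `2 ^ k` around the origin. -/
def cylinder (d : ℕ) (k : ℤ) : Set (SpaceTime d) :=
  {v | ‖v.fst‖ ≤ 2 ^ (2 * k) ∧ ‖v.snd‖ ≤ 2 ^ k}

theorem measurableSet_cylinder (k : ℤ) : MeasurableSet (cylinder d k) := by
  have h1 : MeasurableSet {v : SpaceTime d | ‖v.fst‖ ≤ (2 : ℝ) ^ (2 * k)} :=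
    measurableSet_le (measurable_fst.comp (WithLp.measurable_ofLp _ _)).norm measurable_const
  have h2 : MeasurableSet {v : SpaceTime d | ‖v.snd‖ ≤ (2 : ℝ) ^ k} :=
    measurableSet_le (measurable_snd.comp (WithLp.measurable_ofLp _ _)).norm measurable_const
  exact h1.inter h2

theorem dil_mem_cylinder_iff (k j : ℤ) (v : SpaceTime d) :
    dil d (-k) v ∈ cylinder d j ↔ v ∈ cylinder d (k + j) := by
  simp only [cylinder, mem_ofPred_eq, dil_fst, dil_snd, norm_mul, norm_smul, norm_zpow,
    Real.norm_ofNat]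
  have h : ∀ (a b : ℤ) (x : ℝ), (2 : ℝ) ^ (-a) * x ≤ 2 ^ b ↔ x ≤ 2 ^ (a + b) := by
    intro a b x
    rw [zpow_neg, inv_mul_le_iff₀ (by positivity), zpow_add₀ two_ne_zero]
  rw [mul_neg, h, h, mul_add]

/-- A cylinder of index `j` has volume of order 2^(j(d+2)), so decay of order d + 3 is just enough
to leave a summable factor 2^(-j). -/
theorem exists_norm_le_tsum_cylinder (K : 𝓢(SpaceTime d, ℂ)) :
    ∃ A : ℝ≥0, ∀ v, ‖K v‖ₑ ≤ ∑' j : ℕ, (A : ℝ≥0∞) * 2⁻¹ ^ (j * (d + 3)) *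
      (cylinder d j).indicator 1 v := by
  obtain ⟨C₁, hC₁0, hC₁⟩ := K.decay 0 0
  obtain ⟨C₂, hC₂0, hC₂⟩ := K.decay (d + 3) 0
  simp only [pow_zero, one_mul, norm_iteratedFDeriv_zero] at hC₁ hC₂
  set A : ℝ≥0 := ⟨C₁ + C₂ * 2 ^ (d + 3), by positivity⟩ with hA
  refine ⟨A, fun v => ?_⟩
  have hex : ∃ j : ℕ, v ∈ cylinder d j := by
    obtain ⟨n, hn⟩ := pow_unbounded_of_one_lt ‖v‖ (one_lt_two (α := ℝ))
    refine ⟨n, ?_, ?_⟩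
    · refine (WithLp.norm_fst_le _ v).trans (hn.le.trans ?_)
      rw [← zpow_natCast]
      exact zpow_le_zpow_right₀ one_le_two (by omega)
    · refine (WithLp.norm_snd_le _ v).trans (hn.le.trans ?_)
      rw [zpow_natCast]
  classical
  set j := Nat.find hex
  have hj : v ∈ cylinder d j := Nat.find_spec hex
  refine le_trans ?_ (ENNReal.le_tsum j)
  simp only [hj, indicator_of_mem, Pi.one_apply, mul_one]
  have key : ‖K v‖ ≤ (A : ℝ) * 2⁻¹ ^ (j * (d + 3)) := by
    rcases Nat.eq_zero_or_pos j with h0 | h0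
    · rw [h0, zero_mul, pow_zero, mul_one]
      exact (hC₁ v).trans (le_add_of_nonneg_right (by positivity))
    · obtain ⟨i, hi⟩ : ∃ i, j = i + 1 := ⟨j - 1, by omega⟩
      have h1 : v ∉ cylinder d i := Nat.find_min hex (by omega)
      -- For i ≥ 0 one has 2 ^ i ≤ 2 ^ (2 * i), so the cylinder of index `i` contains the Euclidean
      -- ball of radius 2 ^ i; by minimality of `j = i + 1` the point `v` lies outside it.
      have h2 : (2 : ℝ) ^ i ≤ ‖v‖ := by
        by_contra h3
        push Not at h3
        refine h1 ⟨?_, ?_⟩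
        · refine (WithLp.norm_fst_le _ v).trans (h3.le.trans ?_)
          rw [← zpow_natCast]
          exact zpow_le_zpow_right₀ one_le_two (by omega)
        · refine (WithLp.norm_snd_le _ v).trans (h3.le.trans ?_)
          rw [zpow_natCast]
      have h3 : ((2 : ℝ) ^ i) ^ (d + 3) * ‖K v‖ ≤ C₂ :=
        le_trans (by gcongr) (hC₂ v)
      have h4 : ‖K v‖ ≤ C₂ * 2⁻¹ ^ (i * (d + 3)) := by
        rw [inv_pow, ← div_eq_mul_inv, le_div_iff₀ (by positivity), pow_mul, mul_comm]
        exact h3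
      calc ‖K v‖ ≤ C₂ * 2⁻¹ ^ (i * (d + 3)) := h4
        _ = C₂ * 2 ^ (d + 3) * 2⁻¹ ^ (j * (d + 3)) := by
          have : (2 : ℝ) ^ (d + 3) * 2⁻¹ ^ (d + 3) = 1 := by
            rw [← mul_pow]; norm_num
          rw [hi, add_mul, one_mul, pow_add]
          linear_combination -C₂ * 2⁻¹ ^ (i * (d + 3)) * this
        _ ≤ _ := by
          gcongr
          exact le_add_of_nonneg_left hC₁0.le
  rw [← ofReal_norm]
  refine (ENNReal.ofReal_le_ofReal key).trans (le_of_eq ?_)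
  rw [ENNReal.ofReal_mul A.coe_nonneg, ENNReal.ofReal_coe_nnreal, ENNReal.ofReal_pow (by norm_num),
    ENNReal.ofReal_inv_of_pos (by norm_num)]
  simp

theorem lintegral_cylinder_eq (k : ℤ) {F : SpaceTime d → ℝ≥0∞} (hF : Measurable F) (z : SpaceTime d) :
    ∫⁻ w, (cylinder d k).indicator 1 (w - z) * F w =
      volume (closedBall (0 : ℝ) (2 ^ (2 * k))) *
        volume (closedBall (0 : EuclideanSpace ℝ (Fin d)) (2 ^ k)) *
        cylAvg 2 1 volume volume k (fun p => F (WithLp.toLp 2 p)) z.fst z.snd := by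
  have hm : Measurable fun w => (cylinder d k).indicator (1 : SpaceTime d → ℝ≥0∞) (w - z) * F w :=
    ((measurable_one.indicator (measurableSet_cylinder k)).comp (measurable_id.sub_const z)).mul hF
  rw [lintegral_spaceTime hm]
  unfold cylAvg ballAvg
  simp only [Nat.cast_ofNat, Nat.cast_one, one_mul]
  rw [lintegral_const_mul' _ _ (ENNReal.inv_ne_top.2 (closedBall_measure_ne_zero _ _))]
  have hV1 := closedBall_measure_ne_zero (volume : Measure ℝ) (2 * k)
  have hV1' := closedBall_measure_ne_top (volume : Measure ℝ) (2 * k)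
  have hV2 := closedBall_measure_ne_zero (volume : Measure (EuclideanSpace ℝ (Fin d))) k
  have hV2' := closedBall_measure_ne_top (volume : Measure (EuclideanSpace ℝ (Fin d))) k
  set V1 := volume (closedBall (0 : ℝ) (2 ^ (2 * k)))
  set V2 := volume (closedBall (0 : EuclideanSpace ℝ (Fin d)) (2 ^ k))
  have e : ∀ I : ℝ≥0∞, V1 * V2 * (V1⁻¹ * (V2⁻¹ * I)) = I := by
    intro I
    calc _ = (V1 * V1⁻¹) * (V2 * V2⁻¹) * I := by ring
      _ = I := by rw [ENNReal.mul_inv_cancel hV1 hV1', ENNReal.mul_inv_cancel hV2 hV2', one_mul, one_mul]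
  rw [e, ← lintegral_indicator measurableSet_closedBall]
  refine lintegral_congr fun t => ?_
  by_cases ht : t ∈ closedBall z.fst ((2 : ℝ) ^ (2 * k))
  · rw [indicator_of_mem ht, ← lintegral_indicator measurableSet_closedBall]
    refine lintegral_congr fun x => ?_
    by_cases hx : x ∈ closedBall z.snd ((2 : ℝ) ^ k)
    · have : pt t x - z ∈ cylinder d k := by
        rw [mem_closedBall, dist_eq_norm] at ht hx
        exact ⟨ht, hx⟩
      rw [indicator_of_mem hx, indicator_of_mem this, Pi.one_apply, one_mul]
    · have : pt t x - z ∉ cylinder d k := by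
        intro h
        rw [mem_closedBall, dist_eq_norm] at hx
        exact hx h.2
      rw [indicator_of_notMem hx, indicator_of_notMem this, zero_mul]
  · rw [indicator_of_notMem ht]
    have : ∀ x, pt t x - z ∉ cylinder d k := by
      intro x h
      rw [mem_closedBall, dist_eq_norm] at ht
      exact ht h.1
    simp [this]

/-- The kernel is dominated by a convergent series of normalised indicators of cylinders, each of
which averages `F`. The normalisation makes the constant independent of the scale `k`. -/
theorem exists_lintegral_kernel_le_parMax (K : 𝓢(SpaceTime d, ℂ)) :
    ∃ C : ℝ≥0, ∀ (k : ℤ) (F : SpaceTime d → ℝ≥0∞), Measurable F → ∀ z,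
      ∫⁻ w, ‖((2 : ℝ) ^ (-(k * (d + 2)) : ℤ) : ℝ) • K (dil d (-k) (w - z))‖ₑ * F w ≤
        C * parMax F z := by
  obtain ⟨A, hA⟩ := exists_norm_le_tsum_cylinder K
  set V1 := volume (closedBall (0 : ℝ) (2 ^ (0 : ℤ)))
  set V2 := volume (closedBall (0 : EuclideanSpace ℝ (Fin d)) (2 ^ (0 : ℤ)))
  have hV1' : V1 ≠ ∞ := closedBall_measure_ne_top (volume : Measure ℝ) 0
  have hV2' : V2 ≠ ∞ := closedBall_measure_ne_top (volume : Measure (EuclideanSpace ℝ (Fin d))) 0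
  have hc : 2 * (A * (V1 * V2)) ≠ ∞ :=
    ENNReal.mul_ne_top (by simp) (ENNReal.mul_ne_top (by simp) (ENNReal.mul_ne_top hV1' hV2'))
  refine ⟨(2 * (A * (V1 * V2))).toNNReal, fun k F hF z => ?_⟩
  rw [ENNReal.coe_toNNReal hc]
  set c : ℝ≥0∞ := ENNReal.ofReal ((2 : ℝ) ^ (-(k * (d + 2)) : ℤ)) with hcdef
  have hind : ∀ j : ℕ, Measurable fun w =>
      (cylinder d (k + j)).indicator (1 : SpaceTime d → ℝ≥0∞) (w - z) * F w := fun j =>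
    ((measurable_one.indicator (measurableSet_cylinder _)).comp (measurable_id.sub_const z)).mul hF
  have h1 : ∀ w, ‖((2 : ℝ) ^ (-(k * (d + 2)) : ℤ) : ℝ) • K (dil d (-k) (w - z))‖ₑ * F w ≤
      ∑' j : ℕ, c * (A * 2⁻¹ ^ (j * (d + 3))) *
        ((cylinder d (k + j)).indicator 1 (w - z) * F w) := by
    intro w
    rw [enorm_smul, Real.enorm_of_nonneg (by positivity), ← hcdef]
    calc c * ‖K (dil d (-k) (w - z))‖ₑ * F w
        ≤ c * (∑' j : ℕ, (A : ℝ≥0∞) * 2⁻¹ ^ (j * (d + 3)) *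
            (cylinder d j).indicator 1 (dil d (-k) (w - z))) * F w := by
          gcongr
          exact hA _
      _ = _ := by
          rw [← ENNReal.tsum_mul_left, ← ENNReal.tsum_mul_right]
          refine tsum_congr fun j => ?_
          have : (cylinder d j).indicator (1 : SpaceTime d → ℝ≥0∞) (dil d (-k) (w - z)) =
              (cylinder d (k + j)).indicator 1 (w - z) := by
            by_cases h : w - z ∈ cylinder d (k + j)
            · rw [indicator_of_mem h, indicator_of_mem ((dil_mem_cylinder_iff k j _).2 h)]
              rfl
            · rw [indicator_of_notMem h,
                indicator_of_notMem (mt (dil_mem_cylinder_iff k j _).1 h)]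
          rw [this]
          ring
  -- `c` cancels the volume of the cylinder of radius 2 ^ k, leaving only the growth in `j`.
  have hvol : ∀ j : ℕ, c * (volume (closedBall (0 : ℝ) (2 ^ (2 * (k + j)))) *
      volume (closedBall (0 : EuclideanSpace ℝ (Fin d)) (2 ^ (k + j)))) =
        2 ^ (j * (d + 2)) * (V1 * V2) := by
    intro j
    simp only [V1, V2]
    rw [Measure.addHaar_closedBall _ _ (by positivity), Measure.addHaar_closedBall _ _ (by positivity),
      Measure.addHaar_closedBall _ _ (by positivity), Measure.addHaar_closedBall _ _ (by positivity)]
    simp only [zpow_zero, one_pow, ENNReal.ofReal_one, one_mul]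
    set B1 := volume (ball (0 : ℝ) 1)
    set B2 := volume (ball (0 : EuclideanSpace ℝ (Fin d)) 1)
    have e : c * (ENNReal.ofReal (((2 : ℝ) ^ (2 * (k + j))) ^ Module.finrank ℝ ℝ) *
        ENNReal.ofReal (((2 : ℝ) ^ (k + j)) ^ Module.finrank ℝ (EuclideanSpace ℝ (Fin d)))) =
        2 ^ (j * (d + 2)) := by
      rw [hcdef, ← ENNReal.ofReal_mul (by positivity), ← ENNReal.ofReal_mul (by positivity),
        Module.finrank_self, finrank_euclideanSpace_fin, pow_one, ← zpow_natCast, ← zpow_mul,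
        ← zpow_add₀ two_ne_zero, ← zpow_add₀ two_ne_zero]
      have : -(k * ((d : ℤ) + 2)) + (2 * (k + j) + (k + j) * d) = ((j * (d + 2) : ℕ) : ℤ) := by
        push_cast; ring
      rw [this, zpow_natCast, ENNReal.ofReal_pow (by norm_num)]
      simp
    calc _ = c * (ENNReal.ofReal (((2 : ℝ) ^ (2 * (k + j))) ^ Module.finrank ℝ ℝ) *
        ENNReal.ofReal (((2 : ℝ) ^ (k + j)) ^ Module.finrank ℝ (EuclideanSpace ℝ (Fin d)))) *
          (B1 * B2) := by ring
      _ = _ := by rw [e]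
  calc _ ≤ ∫⁻ w, ∑' j : ℕ, c * (A * 2⁻¹ ^ (j * (d + 3))) *
        ((cylinder d (k + j)).indicator 1 (w - z) * F w) := lintegral_mono h1
    _ = ∑' j : ℕ, c * (A * 2⁻¹ ^ (j * (d + 3))) *
        ∫⁻ w, (cylinder d (k + j)).indicator 1 (w - z) * F w := by
        rw [lintegral_tsum fun j => ((hind j).const_mul _).aemeasurable]
        exact tsum_congr fun j => lintegral_const_mul _ (hind j)
    _ ≤ ∑' j : ℕ, 2⁻¹ ^ j * (A * (V1 * V2) * parMax F z) := by
        refine ENNReal.tsum_le_tsum fun j => ?_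
        rw [lintegral_cylinder_eq _ hF]
        set T := cylAvg 2 1 volume volume (k + j) (fun p => F (WithLp.toLp 2 p)) z.fst z.snd with hT
        have hTle : T ≤ parMax F z := cylAvg_le_cylMax (a := 2) (b := 1) (k + j) _ z.fst z.snd
        have e2 : (2⁻¹ : ℝ≥0∞) ^ (j * (d + 3)) * 2 ^ (j * (d + 2)) = 2⁻¹ ^ j := by
          have : j * (d + 3) = j + j * (d + 2) := by ring
          rw [this, pow_add, mul_assoc, ← mul_pow,
            ENNReal.inv_mul_cancel (by norm_num) (by norm_num), one_pow, mul_one]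
        calc _ = (A * 2⁻¹ ^ (j * (d + 3))) * (c * (volume (closedBall (0 : ℝ) (2 ^ (2 * (k + j)))) *
              volume (closedBall (0 : EuclideanSpace ℝ (Fin d)) (2 ^ (k + j)))) ) * T := by ring
          _ = (2⁻¹ ^ (j * (d + 3)) * 2 ^ (j * (d + 2))) * (A * (V1 * V2) * T) := by
              rw [hvol j]; ring
          _ ≤ _ := by rw [e2]; gcongr
    _ = _ := by
        rw [ENNReal.tsum_mul_right, ENNReal.tsum_geometric, ENNReal.one_sub_inv_two, inv_inv]
        ring

end KernelBound

/-! ### Testing a represented distribution on all Schwartz functions. -/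

section Representation

open FourierTransform Filter Topology Set Metric

variable {d : ℕ}

theorem dil_zero_apply (z : SpaceTime d) : dil d 0 z = z := by
  rw [dil_apply]
  refine WithLp.ofLp_injective 2 (Prod.ext ?_ ?_)
  · change (2 : ℝ) ^ (2 * (0 : ℤ)) * z.fst = z.fst
    simp
  · change (2 : ℝ) ^ (0 : ℤ) • z.snd = z.snd
    simp

/-- After translation to `z₀`, the Schwartz function is a kernel of scale one, so finiteness of the
maximal function at one single point suffices. -/
theorem integrable_schwartz_mul {f : SpaceTime d → ℂ} (hf : Measurable f) {z₀ : SpaceTime d}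
    (hz₀ : parMax (fun z => ‖f z‖ₑ) z₀ < ∞) (φ : 𝓢(SpaceTime d, ℂ)) :
    Integrable fun z => φ z * f z := by
  obtain ⟨C, hC⟩ := exists_lintegral_kernel_le_parMax (compSubConstCLM ℂ (-z₀) φ)
  have h1 := hC 0 (fun z => ‖f z‖ₑ) hf.enorm z₀
  refine ⟨(φ.continuous.measurable.mul hf).aestronglyMeasurable, ?_⟩
  rw [hasFiniteIntegral_iff_enorm]
  refine lt_of_le_of_lt (le_of_eq ?_) (h1.trans_lt (ENNReal.mul_lt_top ENNReal.coe_lt_top hz₀))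
  refine lintegral_congr fun z => ?_
  simp [dil_zero_apply, enorm_mul]

/-- A distribution represented by a function with a finite maximal function is given by
integration against all Schwartz functions. -/
theorem apply_eq_integral_of_isRepresentedBy {v : 𝓢'(SpaceTime d, ℂ)} {f : SpaceTime d → ℂ}
    (hf : Measurable f) (hv : IsRepresentedBy v f) {z₀ : SpaceTime d}
    (hz₀ : parMax (fun z => ‖f z‖ₑ) z₀ < ∞) (φ : 𝓢(SpaceTime d, ℂ)) :
    v φ = ∫ z, φ z * f z := by
  let b : ContDiffBump (0 : SpaceTime d) := ⟨1, 2, one_pos, one_lt_two⟩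
  have hbc : HasCompactSupport fun z => ((b z : ℝ) : ℂ) :=
    b.hasCompactSupport.comp_left (g := fun x : ℝ => (x : ℂ)) rfl
  have hbs : ContDiff ℝ (⊤ : ℕ∞) fun z => ((b z : ℝ) : ℂ) :=
    Complex.ofRealCLM.contDiff.comp b.contDiff
  set χ : 𝓢(SpaceTime d, ℂ) := hbc.toSchwartzMap hbs with hχ
  have hχa : ∀ z, χ z = ((b z : ℝ) : ℂ) := fun z => rfl
  have hχ0 : χ 0 = 1 := by
    rw [hχa, b.one_of_mem_closedBall (mem_closedBall_self b.rIn_pos.le)]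
    simp
  have hχ1 : ∀ z, ‖χ z‖ ≤ 1 := by
    intro z
    rw [hχa, Complex.norm_real, Real.norm_of_nonneg b.nonneg]
    exact b.le_one
  -- The cutoffs χ(z/(n+1)) φ tend to `φ` in the Schwartz topology, which handles `v`; dominated
  -- convergence handles the integral.
  let L : ℕ → SpaceTime d →L[ℝ] SpaceTime d :=
    fun n => ((n : ℝ) + 1)⁻¹ • ContinuousLinearMap.id ℝ (SpaceTime d)
  have hinv : Tendsto (fun n : ℕ => ((n : ℝ) + 1)⁻¹) atTop (𝓝 0) := by
    simpa [one_div] using tendsto_one_div_add_atTop_nhds_zero_nat (𝕜 := ℝ)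
  have hL : Tendsto (fun n => ‖L n‖) atTop (𝓝 0) := by
    refine squeeze_zero (fun _ => norm_nonneg _) (fun n => ?_) hinv
    refine (norm_smul_le ((n : ℝ) + 1)⁻¹ (ContinuousLinearMap.id ℝ (SpaceTime d))).trans ?_
    rw [Real.norm_of_nonneg (by positivity)]
    exact mul_le_of_le_one_right (by positivity) ContinuousLinearMap.norm_id_le
  have hLa : ∀ n z, L n z = ((n : ℝ) + 1)⁻¹ • z := fun n z => rfl
  have hsa : ∀ n z, smulLeftCLM ℂ (fun z => χ (L n z)) φ z = χ (L n z) * φ z := by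
    intro n z
    have htg : Function.HasTemperateGrowth fun z => χ (L n z) :=
      χ.hasTemperateGrowth.comp (L n).hasTemperateGrowth
    rw [smulLeftCLM_apply_apply htg, smul_eq_mul]
  have h1 := tendsto_smulLeftCLM_comp χ φ hL
  rw [hχ0, one_smul] at h1
  have h2 := (v.continuous.tendsto _).comp h1
  have h3 : ∀ n, v (smulLeftCLM ℂ (fun z => χ (L n z)) φ) = ∫ z, χ (L n z) * φ z * f z := by
    intro n
    rw [hv.2]
    · simp only [hsa]
    · have hc : HasCompactSupport fun z => χ (L n z) := by
        have : HasCompactSupport (χ : SpaceTime d → ℂ) := hbc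
        exact this.comp_homeomorph (Homeomorph.smulOfNeZero ((n : ℝ) + 1)⁻¹ (by positivity))
      have : (smulLeftCLM ℂ (fun z => χ (L n z)) φ : SpaceTime d → ℂ) =
          fun z => χ (L n z) * φ z := funext (hsa n)
      rw [this]
      exact hc.mul_right
  refine tendsto_nhds_unique h2 ?_
  have hint := integrable_schwartz_mul hf hz₀ φ
  refine Tendsto.congr (fun n => (h3 n).symm) ?_
  refine tendsto_integral_of_dominated_convergence (fun z => ‖φ z * f z‖) (fun n => ?_) hint.norm
    (fun n => Eventually.of_forall fun z => ?_) (Eventually.of_forall fun z => ?_)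
  · exact (((χ.continuous.comp (L n).continuous).measurable.mul φ.continuous.measurable).mul
      hf).aestronglyMeasurable
  · rw [mul_assoc, norm_mul]
    exact mul_le_of_le_one_left (norm_nonneg _) (hχ1 _)
  · have h4 : Tendsto (fun n => L n z) atTop (𝓝 0) := by
      simpa [hLa] using hinv.smul_const z
    have h5 := (χ.continuous.tendsto 0).comp h4
    rw [hχ0] at h5
    have h6 := (h5.mul_const (φ z)).mul_const (f z)
    simpa using h6

end Representation

/-! ### Multipliers acting on functions. -/

section ConvT

open FourierTransform Filter Topology Set Metric

variable {d : ℕ}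

/-- The action of the multiplier with symbol `σ` on the function `f`. -/
def multFun (σ : 𝓢(SpaceTime d, ℂ)) (f : SpaceTime d → ℂ) (z : SpaceTime d) : ℂ :=
  ∫ w, 𝓕 σ (w - z) * f w

theorem exists_lintegral_fourier_dilate_le (σ : 𝓢(SpaceTime d, ℂ)) :
    ∃ C : ℝ≥0, ∀ (k : ℤ) (f : SpaceTime d → ℂ), Measurable f → ∀ z,
      ∫⁻ w, ‖𝓕 (dilate k σ) (w - z)‖ₑ * ‖f w‖ₑ ≤ C * parMax (fun z => ‖f z‖ₑ) z := by
  obtain ⟨C, hC⟩ := exists_lintegral_kernel_le_parMax (𝓕 σ)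
  refine ⟨C, fun k f hf z => ?_⟩
  simp only [fourier_dilate_apply]
  exact hC k _ hf.enorm z

theorem enorm_multFun_le_lintegral (σ : 𝓢(SpaceTime d, ℂ)) (f : SpaceTime d → ℂ) (z : SpaceTime d) :
    ‖multFun σ f z‖ₑ ≤ ∫⁻ w, ‖𝓕 σ (w - z)‖ₑ * ‖f w‖ₑ := by
  refine (enorm_integral_le_lintegral_enorm _).trans (le_of_eq ?_)
  simp only [enorm_mul]

theorem stronglyMeasurable_multFun (σ : 𝓢(SpaceTime d, ℂ)) {f : SpaceTime d → ℂ} (hf : Measurable f) :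
    StronglyMeasurable (multFun σ f) := by
  have h : Measurable fun p : SpaceTime d × SpaceTime d => 𝓕 σ (p.2 - p.1) * f p.2 :=
    ((𝓕 σ).continuous.measurable.comp (measurable_snd.sub measurable_fst)).mul
      (hf.comp measurable_snd)
  exact h.stronglyMeasurable.integral_prod_right'

/-- Fubini's theorem, with `F` as majorant. Transposition reverses the argument of the kernel, which
is why `multFun` evaluates it at `w - z`. -/
theorem integral_multT_mul (σ φ : 𝓢(SpaceTime d, ℂ)) {f : SpaceTime d → ℂ} (hf : Measurable f)
    {F : SpaceTime d → ℝ≥0∞} (h : ∀ z, ∫⁻ w, ‖𝓕 σ (w - z)‖ₑ * ‖f w‖ₑ ≤ F z)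
    (hF : ∫⁻ z, ‖φ z‖ₑ * F z < ∞) :
    ∫ w, multT σ φ w * f w = ∫ z, φ z * multFun σ f z := by
  have hm : Measurable (Function.uncurry fun w z => 𝓕 σ (w - z) * φ z * f w) :=
    (((𝓕 σ).continuous.measurable.comp (measurable_fst.sub measurable_snd)).mul
      (φ.continuous.measurable.comp measurable_snd)).mul (hf.comp measurable_fst)
  have hi : Integrable (Function.uncurry fun w z => 𝓕 σ (w - z) * φ z * f w)
      ((volume : Measure (SpaceTime d)).prod (volume : Measure (SpaceTime d))) := by
    refine ⟨hm.aestronglyMeasurable, ?_⟩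
    rw [hasFiniteIntegral_iff_enorm, lintegral_prod_symm _ hm.enorm.aemeasurable]
    refine lt_of_le_of_lt (lintegral_mono fun z => ?_) hF
    have e : ∀ w, ‖Function.uncurry (fun w z => 𝓕 σ (w - z) * φ z * f w) (w, z)‖ₑ =
        ‖φ z‖ₑ * (‖𝓕 σ (w - z)‖ₑ * ‖f w‖ₑ) := by
      intro w
      simp only [Function.uncurry, enorm_mul]
      ring
    simp only [e]
    rw [lintegral_const_mul' _ _ enorm_ne_top]
    exact mul_le_mul_right (h z) _
  calc ∫ w, multT σ φ w * f w = ∫ w, ∫ z, 𝓕 σ (w - z) * φ z * f w := by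
        refine integral_congr_ae (Eventually.of_forall fun w => ?_)
        simp only [multT_apply_eq_integral]
        rw [← integral_mul_const]
    _ = ∫ z, ∫ w, 𝓕 σ (w - z) * φ z * f w := integral_integral_swap hi
    _ = _ := by
        refine integral_congr_ae (Eventually.of_forall fun z => ?_)
        simp only [multFun]
        rw [← integral_const_mul]
        refine integral_congr_ae (Eventually.of_forall fun w => ?_)
        simp only
        ring

/-- It lets the kernel bound in terms of `parMax` also serve for the bounded functions given by the
Besov norm. -/
theorem parMax_le_of_ae_le {F : SpaceTime d → ℝ≥0∞} {c : ℝ≥0∞} (h : ∀ᵐ z, F z ≤ c)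
    (z : SpaceTime d) : parMax F z ≤ c := by
  have h1 : ∀ᵐ p : ℝ × EuclideanSpace ℝ (Fin d), F (WithLp.toLp 2 p) ≤ c :=
    (WithLp.volume_preserving_toLp ℝ (EuclideanSpace ℝ (Fin d))).quasiMeasurePreserving.ae h
  have h2 := Measure.ae_ae_of_ae_prod h1
  refine iSup_le fun k => ?_
  refine (ballAvg_mono (h := fun _ => c) (h2.mono fun t ht => ?_) _).trans
    ((ballAvg_le_hlMax _ _ _ _).trans (hlMax_const_le _ _ _))
  exact (ballAvg_mono (h := fun _ => c) ht _).trans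
    ((ballAvg_le_hlMax _ _ _ _).trans (hlMax_const_le _ _ _))

end ConvT

/-! ### The symbols: splitting of dyadic differences and the telescoping relation. -/

section Symbols

open FourierTransform Filter Topology

variable {d : ℕ}

theorem hasTemperateGrowth_exp_neg_sq (a : ℝ) (ha : 0 ≤ a) :
    Function.HasTemperateGrowth fun x : ℝ => Real.exp (-(a * x ^ 2)) := by
  have h := gaussian_hasTemperateGrowth.comp
    ((Function.HasTemperateGrowth.const (Real.sqrt (2 * a))).mul
      (Function.HasTemperateGrowth.id' (E := ℝ)))
  convert! h using 2 with x
  change Real.exp (-(a * x ^ 2)) = Real.exp (-((Real.sqrt (2 * a) * x) ^ 2 / 2))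
  rw [mul_pow, Real.sq_sqrt (show 0 ≤ 2 * a by positivity)]
  congr 1
  ring

/-- The constants are such that multiplication by exp(-x²/32), the share of `baseGaussian`, turns
the right-hand side into exp(-x²/16) - exp(-x²). -/
theorem exists_temperate_mul_eq :
    ∃ κ : ℝ → ℝ, Function.HasTemperateGrowth κ ∧ ∀ x, x * κ x =
      Real.exp (-(1 / 32 * x ^ 2)) - Real.exp (-(31 / 32 * x ^ 2)) := by
  set ψ : ℝ → ℝ := fun x => Real.exp (-(1 / 32 * x ^ 2)) - Real.exp (-(31 / 32 * x ^ 2))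
  have hψ : Function.HasTemperateGrowth ψ :=
    (hasTemperateGrowth_exp_neg_sq _ (by norm_num)).sub
      (hasTemperateGrowth_exp_neg_sq _ (by norm_num))
  refine ⟨_, hasTemperateGrowth_integral_dilation (hasTemperateGrowth_deriv hψ), fun x => ?_⟩
  rw [mul_integral_deriv_dilation (hψ.1.of_le (by exact_mod_cast le_top))]
  simp [ψ]

/-- The anisotropic quadratic form `(2πτ)² + (2π|ξ|)⁴`. -/
def parForm (ζ : SpaceTime d) : ℝ := (2 * Real.pi * ζ.fst) ^ 2 + (2 * Real.pi * ‖ζ.snd‖) ^ 4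

theorem temperate_fst : Function.HasTemperateGrowth fun ζ : SpaceTime d => 2 * Real.pi * ζ.fst :=
  (Function.HasTemperateGrowth.const _).mul
    (WithLp.fstL 2 ℝ ℝ (EuclideanSpace ℝ (Fin d))).hasTemperateGrowth

theorem temperate_norm_snd_sq :
    Function.HasTemperateGrowth fun ζ : SpaceTime d => (2 * Real.pi * ‖ζ.snd‖) ^ 2 := by
  have h := (Function.HasTemperateGrowth.const ((2 * Real.pi) ^ 2)).mul
    ((Function.hasTemperateGrowth_norm_sq (EuclideanSpace ℝ (Fin d))).comp
      (WithLp.sndL 2 ℝ ℝ (EuclideanSpace ℝ (Fin d))).hasTemperateGrowth)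
  convert! h using 2
  exact mul_pow _ _ _

theorem temperate_snd_apply (i : Fin d) :
    Function.HasTemperateGrowth fun ζ : SpaceTime d => 2 * Real.pi * ζ.snd i :=
  (Function.HasTemperateGrowth.const _).mul
    ((EuclideanSpace.proj (𝕜 := ℝ) i).comp
      (WithLp.sndL 2 ℝ ℝ (EuclideanSpace ℝ (Fin d)))).hasTemperateGrowth

theorem parForm_eq (ζ : SpaceTime d) :
    parForm ζ = (2 * Real.pi * ζ.fst) ^ 2 + ((2 * Real.pi * ‖ζ.snd‖) ^ 2) ^ 2 := by
  unfold parForm; ring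

theorem temperate_parForm : Function.HasTemperateGrowth (parForm (d := d)) := by
  have h := (temperate_fst (d := d)).pow 2 |>.add ((temperate_norm_snd_sq (d := d)).pow 2)
  have e : parForm (d := d) =
      (fun ζ => 2 * Real.pi * ζ.fst) ^ 2 + (fun ζ => (2 * Real.pi * ‖ζ.snd‖) ^ 2) ^ 2 :=
    funext parForm_eq
  rw [e]
  exact h

theorem norm_sub_le_parForm (ζ : SpaceTime d) : 1 * ‖ζ‖ - 2 ≤ 1 / 32 * parForm ζ := by
  have h1 : ‖ζ‖ ≤ ‖ζ.fst‖ + ‖ζ.snd‖ := by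
    have h := WithLp.prod_norm_sq_eq_of_L2 ζ
    refine le_of_sq_le_sq ?_ (by positivity)
    rw [h]
    nlinarith [norm_nonneg ζ.fst, norm_nonneg ζ.snd]
  have hπ : 3 < Real.pi := Real.pi_gt_three
  have h2 : ‖ζ.fst‖ - 1 ≤ 1 / 32 * (2 * Real.pi * ζ.fst) ^ 2 := by
    rw [mul_pow, ← sq_abs ζ.fst, ← Real.norm_eq_abs]
    have : 36 ≤ (2 * Real.pi) ^ 2 := by nlinarith
    nlinarith [mul_le_mul_of_nonneg_right this (sq_nonneg ‖ζ.fst‖), sq_nonneg (‖ζ.fst‖ - 1 / 2)]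
  have h3 : ‖ζ.snd‖ - 1 ≤ 1 / 32 * (2 * Real.pi * ‖ζ.snd‖) ^ 4 := by
    rw [mul_pow]
    have : 36 ≤ (2 * Real.pi) ^ 2 := by nlinarith
    have h4 : 32 ≤ (2 * Real.pi) ^ 4 := by nlinarith
    have h5 : ‖ζ.snd‖ - 1 ≤ ‖ζ.snd‖ ^ 4 := by
      nlinarith [sq_nonneg (‖ζ.snd‖ ^ 2 - 1 / 2), sq_nonneg (‖ζ.snd‖ - 1 / 2)]
    nlinarith [mul_le_mul_of_nonneg_right h4 (show 0 ≤ ‖ζ.snd‖ ^ 4 by positivity)]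
  unfold parForm
  linarith

/-- The Schwartz function `exp (-parForm / 32)`. -/
def baseGaussian (d : ℕ) : 𝓢(SpaceTime d, ℂ) :=
  postcompCLM Complex.ofRealCLM (expNegSchwartz (fun ζ => 1 / 32 * parForm ζ)
    ((Function.HasTemperateGrowth.const _).mul temperate_parForm) 1 2 one_pos norm_sub_le_parForm)

theorem baseGaussian_apply (ζ : SpaceTime d) :
    baseGaussian d ζ = ((Real.exp (-(1 / 32 * parForm ζ)) : ℝ) : ℂ) := rfl

/-- The Schwartz function `ψ exp (-parForm / 32)`, for `ψ` of temperate growth. -/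
def gaussSymbol (ψ : SpaceTime d → ℂ) : 𝓢(SpaceTime d, ℂ) := smulLeftCLM ℂ ψ (baseGaussian d)

theorem gaussSymbol_apply {ψ : SpaceTime d → ℂ} (hψ : Function.HasTemperateGrowth ψ)
    (ζ : SpaceTime d) :
    gaussSymbol ψ ζ = ψ ζ * ((Real.exp (-(1 / 32 * parForm ζ)) : ℝ) : ℂ) := by
  rw [gaussSymbol, smulLeftCLM_apply_apply hψ, baseGaussian_apply, smul_eq_mul]

theorem biheatSymbol_eq (θ : ℝ) (ζ : SpaceTime d) :
    biheatSymbol θ ζ = ((Real.exp (-(θ ^ 2 * parForm ζ)) : ℝ) : ℂ) := rfl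

theorem parForm_dil (k : ℤ) (ζ : SpaceTime d) :
    parForm (dil d k ζ) = ((2 : ℝ) ^ k) ^ 4 * parForm ζ := by
  unfold parForm
  rw [dil_fst, dil_snd, norm_smul, Real.norm_of_nonneg (by positivity), mul_comm 2 k, zpow_mul]
  norm_cast
  ring

/-- The part 1/32 of the exponent is carried by `baseGaussian`, which is Schwartz, and the rest is a
multiplier of temperate growth. -/
theorem exists_schwartz_biheatSymbol (θ : ℝ) (hθ : 1 / 32 ≤ θ ^ 2) :
    ∃ M : 𝓢(SpaceTime d, ℂ), ∀ ζ, M ζ = ((Real.exp (-(θ ^ 2 * parForm ζ)) : ℝ) : ℂ) := by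
  refine ⟨gaussSymbol (biheatSymbol (Real.sqrt (θ ^ 2 - 1 / 32))), fun ζ => ?_⟩
  rw [gaussSymbol_apply (biheatSymbol_hasTemperateGrowth _), biheatSymbol_eq,
    Real.sq_sqrt (by linarith), ← Complex.ofReal_mul, ← Real.exp_add]
  congr 2
  ring

theorem ofReal_temperate {ψ : SpaceTime d → ℝ} (hψ : Function.HasTemperateGrowth ψ) :
    Function.HasTemperateGrowth fun ζ => ((ψ ζ : ℝ) : ℂ) :=
  Complex.ofRealCLM.hasTemperateGrowth.comp hψ

/-- The difference of two consecutive symbols, differentiated, splits into a time derivative and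
a space Laplacian of Schwartz symbols. -/
theorem exists_symbol_decomposition (i : Fin d) :
    ∃ α β : 𝓢(SpaceTime d, ℂ), ∀ ζ : SpaceTime d,
      -(2 * Real.pi * Complex.I) * (ζ.snd i : ℂ) *
          (((Real.exp (-(1 / 16 * parForm ζ)) : ℝ) : ℂ) - ((Real.exp (-parForm ζ) : ℝ) : ℂ)) =
        -(2 * Real.pi * Complex.I) * (ζ.fst : ℂ) * α ζ +
          ∑ j, -(2 * Real.pi * Complex.I) * (ζ.snd j : ℂ) *
            (-(2 * Real.pi * Complex.I) * (ζ.snd j : ℂ) * β ζ) := by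
  obtain ⟨κ, hκ, hκe⟩ := exists_temperate_mul_eq
  have hα : Function.HasTemperateGrowth fun ζ : SpaceTime d => 2 * Real.pi * ζ.snd i *
      (κ (2 * Real.pi * ζ.fst) * Real.exp (-(1 / 32 * ((2 * Real.pi * ‖ζ.snd‖) ^ 2) ^ 2))) :=
    (temperate_snd_apply i).mul ((hκ.comp temperate_fst).mul
      ((hasTemperateGrowth_exp_neg_sq (1 / 32) (by norm_num)).comp temperate_norm_snd_sq))
  have hβ : Function.HasTemperateGrowth fun ζ : SpaceTime d => 2 * Real.pi * ζ.snd i *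
      (κ ((2 * Real.pi * ‖ζ.snd‖) ^ 2) * Real.exp (-(31 / 32 * (2 * Real.pi * ζ.fst) ^ 2))) :=
    (temperate_snd_apply i).mul ((hκ.comp temperate_norm_snd_sq).mul
      ((hasTemperateGrowth_exp_neg_sq (31 / 32) (by norm_num)).comp temperate_fst))
  have hβ' : Function.HasTemperateGrowth fun ζ : SpaceTime d => Complex.I *
      ((2 * Real.pi * ζ.snd i * (κ ((2 * Real.pi * ‖ζ.snd‖) ^ 2) *
        Real.exp (-(31 / 32 * (2 * Real.pi * ζ.fst) ^ 2))) : ℝ) : ℂ) :=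
    (Function.HasTemperateGrowth.const Complex.I).mul (ofReal_temperate hβ)
  refine ⟨gaussSymbol fun ζ => ((2 * Real.pi * ζ.snd i * (κ (2 * Real.pi * ζ.fst) *
      Real.exp (-(1 / 32 * ((2 * Real.pi * ‖ζ.snd‖) ^ 2) ^ 2))) : ℝ) : ℂ),
    gaussSymbol fun ζ => Complex.I * ((2 * Real.pi * ζ.snd i * (κ ((2 * Real.pi * ‖ζ.snd‖) ^ 2) *
      Real.exp (-(31 / 32 * (2 * Real.pi * ζ.fst) ^ 2))) : ℝ) : ℂ), fun ζ => ?_⟩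
  rw [gaussSymbol_apply (ofReal_temperate hα), gaussSymbol_apply hβ']
  have hsum : ((2 * Real.pi * ‖ζ.snd‖) ^ 2 : ℝ) = (2 * Real.pi) ^ 2 * ∑ j, ζ.snd j ^ 2 := by
    rw [mul_pow, EuclideanSpace.real_norm_sq_eq]
  set x := 2 * Real.pi * ζ.fst with hx
  set y := (2 * Real.pi * ‖ζ.snd‖) ^ 2 with hy
  have hQ : parForm ζ = x ^ 2 + y ^ 2 := parForm_eq ζ
  -- With Q = x² + y², the difference exp(-Q/16) - exp(-Q) is split at the intermediate symbol
  -- exp(-(x² + y²/16)). One half changes only the exponent of `x` and is divisible by `x`, the time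
  -- derivative; the other changes only that of `y` and is divisible by `y`, the Laplacian.
  have hA : x * κ x * Real.exp (-(1 / 32 * y ^ 2)) * Real.exp (-(1 / 32 * parForm ζ)) =
      Real.exp (-(1 / 16 * parForm ζ)) - Real.exp (-(x ^ 2 + 1 / 16 * y ^ 2)) := by
    rw [hκe, sub_mul, sub_mul, ← Real.exp_add, ← Real.exp_add, ← Real.exp_add, ← Real.exp_add, hQ]
    congr 2 <;> ring
  have hB : y * κ y * Real.exp (-(31 / 32 * x ^ 2)) * Real.exp (-(1 / 32 * parForm ζ)) =
      Real.exp (-(x ^ 2 + 1 / 16 * y ^ 2)) - Real.exp (-parForm ζ) := by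
    rw [hκe, sub_mul, sub_mul, ← Real.exp_add, ← Real.exp_add, ← Real.exp_add, ← Real.exp_add, hQ]
    congr 2 <;> ring
  have hAB := congrArg (fun r : ℝ => (r : ℂ)) (congrArg₂ (· + ·) hA hB)
  have hsum' := congrArg (fun r : ℝ => (r : ℂ)) hsum
  have hx' := congrArg (fun r : ℝ => (r : ℂ)) hx
  simp only [Complex.ofReal_add, Complex.ofReal_mul, Complex.ofReal_sub, Complex.ofReal_pow,
    Complex.ofReal_sum, Complex.ofReal_ofNat] at hAB hsum' hx' ⊢
  generalize Complex.ofReal (Real.exp (-(1 / 16 * parForm ζ))) = E₁ at *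
  generalize Complex.ofReal (Real.exp (-(1 / 32 * parForm ζ))) = E₂ at *
  generalize Complex.ofReal (Real.exp (-parForm ζ)) = E₃ at *
  generalize Complex.ofReal (Real.exp (-(1 / 32 * y ^ 2))) = E₄ at *
  generalize Complex.ofReal (Real.exp (-(31 / 32 * x ^ 2))) = E₅ at *
  generalize Complex.ofReal (Real.exp (-(x ^ 2 + 1 / 16 * y ^ 2))) = E₆ at *
  have e : ∀ b : ℂ, ∑ j, -(2 * (Real.pi : ℂ) * Complex.I) * (ζ.snd j : ℂ) *
      (-(2 * (Real.pi : ℂ) * Complex.I) * (ζ.snd j : ℂ) * b) = -(y : ℂ) * b := by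
    intro b
    rw [hsum', Finset.mul_sum, ← Finset.sum_neg_distrib, Finset.sum_mul]
    refine Finset.sum_congr rfl fun j _ => ?_
    linear_combination (2 * (Real.pi : ℂ)) ^ 2 * (ζ.snd j : ℂ) ^ 2 * b * Complex.I_sq
  rw [e]
  have e2 : E₁ - E₃ = (x * κ x * E₄ * E₂) + (y * κ y * E₅ * E₂) := by rw [hAB]; ring
  rw [e2, hx']
  ring

theorem multT_sum {ι : Type*} {s : Finset ι} {σ : ι → SpaceTime d → ℂ}
    (hσ : ∀ i ∈ s, Function.HasTemperateGrowth (σ i)) (φ : 𝓢(SpaceTime d, ℂ)) :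
    multT (fun ζ => ∑ i ∈ s, σ i ζ) φ = ∑ i ∈ s, multT (σ i) φ := by
  unfold multT
  rw [smulLeftCLM_sum hσ, sum_apply, ← fourierCLM_apply (R := ℂ), map_sum]
  rfl

theorem inner_pt_one_zero (ζ : SpaceTime d) : inner ℝ ζ (pt 1 0) = ζ.fst := by
  rw [WithLp.prod_inner_apply]
  simp

theorem inner_pt_zero_single (ζ : SpaceTime d) (i : Fin d) :
    inner ℝ ζ (pt 0 (EuclideanSpace.single i (1 : ℝ))) = ζ.snd i := by
  rw [WithLp.prod_inner_apply]
  simp [EuclideanSpace.inner_single_right]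

theorem temperate_inner_mul {σ : SpaceTime d → ℂ} (hσ : Function.HasTemperateGrowth σ)
    (m : SpaceTime d) : Function.HasTemperateGrowth
      fun ζ => -(2 * Real.pi * Complex.I) * ((inner ℝ ζ m : ℝ) : ℂ) * σ ζ := by
  have h1 : Function.HasTemperateGrowth fun ζ : SpaceTime d => (inner ℝ ζ m : ℝ) := by fun_prop
  exact ((Function.HasTemperateGrowth.const _).mul (ofReal_temperate h1)).mul hσ

theorem temperate_const_smul {σ : SpaceTime d → ℂ} (c : ℂ) (hσ : Function.HasTemperateGrowth σ) :
    Function.HasTemperateGrowth (c • σ) :=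
  (Function.HasTemperateGrowth.const c).mul hσ

theorem timeDeriv_apply (u : 𝓢'(SpaceTime d, ℂ)) (φ : 𝓢(SpaceTime d, ℂ)) :
    timeDeriv u φ = -u (∂_{pt (d := d) 1 0} φ) := by
  rw [timeDeriv, TemperedDistribution.lineDerivOp_apply_apply, map_neg]

theorem spaceDeriv_apply (i : Fin d) (u : 𝓢'(SpaceTime d, ℂ)) (φ : 𝓢(SpaceTime d, ℂ)) :
    spaceDeriv i u φ = -u (∂_{pt 0 (EuclideanSpace.single i (1 : ℝ))} φ) := by
  rw [spaceDeriv, TemperedDistribution.lineDerivOp_apply_apply, map_neg]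

theorem spaceLaplacian_apply (u : 𝓢'(SpaceTime d, ℂ)) (φ : 𝓢(SpaceTime d, ℂ)) :
    spaceLaplacian u φ = u (∑ i : Fin d, ∂_{pt (d := d) 0 (EuclideanSpace.single i (1 : ℝ))}
      (∂_{pt (d := d) 0 (EuclideanSpace.single i (1 : ℝ))} φ)) := by
  have : spaceLaplacian u φ = ∑ i, spaceDeriv i (spaceDeriv i u) φ := by
    unfold spaceLaplacian
    exact map_sum (PointwiseConvergenceCLM.evalCLM _ _ φ) _ _
  rw [this, map_sum]
  refine Finset.sum_congr rfl fun i _ => ?_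
  rw [spaceDeriv_apply, spaceDeriv_apply, neg_neg]

theorem biheat_apply (θ : ℝ) (u : 𝓢'(SpaceTime d, ℂ)) (φ : 𝓢(SpaceTime d, ℂ)) :
    biheat θ u φ = u (multT (biheatSymbol θ) φ) := by
  rw [biheat, TemperedDistribution.fourierMultiplierCLM_apply_apply]
  rfl

/-- The telescoping relation for the regularisations of `∂_i u`. -/
theorem exists_telescoping (i : Fin d) :
    ∃ α β D M : 𝓢(SpaceTime d, ℂ), M 0 = 1 ∧
      ∀ (u : 𝓢'(SpaceTime d, ℂ)) (k : ℤ) (φ : 𝓢(SpaceTime d, ℂ)),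
        (spaceDeriv i u (multT (dilate (k - 1) M) φ) = spaceDeriv i u (multT (dilate k M) φ) +
          ((2 : ℝ) ^ k : ℝ) * timeDeriv u (multT (dilate k α) φ) -
          ((2 : ℝ) ^ k : ℝ) * spaceLaplacian u (multT (dilate k β) φ)) ∧
        spaceDeriv i u (multT (dilate k M) φ) =
          ((2 : ℝ) ^ (-k) : ℝ) * biheat ((2 : ℝ) ^ (2 * k) / Real.sqrt 2) u
            (multT (dilate k D) φ) := by
  obtain ⟨α, β, hαβ⟩ := exists_symbol_decomposition i
  obtain ⟨M, hM⟩ := exists_schwartz_biheatSymbol (d := d) 1 (by norm_num)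
  -- The square root of the symbol `M`: one copy becomes the biheat operator with θ² = 2^(4k)/2, and
  -- the other, multiplied by the symbol of the derivative, becomes `D`.
  obtain ⟨H, hH⟩ := exists_schwartz_biheatSymbol (d := d) (Real.sqrt 2)⁻¹ (by
    rw [inv_pow, Real.sq_sqrt zero_le_two]; norm_num)
  have hHD : Function.HasTemperateGrowth fun ζ : SpaceTime d =>
      Complex.I * ((2 * Real.pi * ζ.snd i : ℝ) : ℂ) :=
    (Function.HasTemperateGrowth.const _).mul (ofReal_temperate (temperate_snd_apply i))
  set D := smulLeftCLM ℂ (fun ζ : SpaceTime d => Complex.I * ((2 * Real.pi * ζ.snd i : ℝ) : ℂ)) H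
    with hD
  refine ⟨α, β, D, M, ?_, fun u k φ => ⟨?_, ?_⟩⟩
  · rw [hM]
    simp [parForm]
  · have hk : (((2 : ℝ) ^ k : ℝ) : ℂ) ≠ 0 := by
      exact_mod_cast (by positivity : (2 : ℝ) ^ k ≠ 0)
    have hMk : ∀ k, Function.HasTemperateGrowth (dilate k M : SpaceTime d → ℂ) :=
      fun k => (dilate k M).hasTemperateGrowth
    have hαk := (dilate k α).hasTemperateGrowth
    have hβk := (dilate k β).hasTemperateGrowth
    have hβ2 := fun j : Fin d => temperate_inner_mul (temperate_inner_mul hβk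
        (pt 0 (EuclideanSpace.single j (1 : ℝ)))) (pt 0 (EuclideanSpace.single j (1 : ℝ)))
    have key : ∂_{pt 0 (EuclideanSpace.single i (1 : ℝ))} (multT (dilate (k - 1) M) φ) =
        ∂_{pt 0 (EuclideanSpace.single i (1 : ℝ))} (multT (dilate k M) φ) +
        (((2 : ℝ) ^ k : ℝ) : ℂ) • (∂_{pt (d := d) 1 0} (multT (dilate k α) φ) +
          ∑ j : Fin d, ∂_{pt (d := d) 0 (EuclideanSpace.single j (1 : ℝ))}
            (∂_{pt (d := d) 0 (EuclideanSpace.single j (1 : ℝ))} (multT (dilate k β) φ))) := by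
      simp only [lineDerivOp_multT (hMk _), lineDerivOp_multT hαk, lineDerivOp_multT hβk,
        lineDerivOp_multT (temperate_inner_mul hβk _)]
      rw [← multT_sum (fun j _ => hβ2 j), ← multT_add (temperate_inner_mul hαk _)
        (Function.HasTemperateGrowth.sum fun j _ => hβ2 j), ← multT_smul
        ((temperate_inner_mul hαk _).add (Function.HasTemperateGrowth.sum fun j _ => hβ2 j)),
        ← multT_add (temperate_inner_mul (hMk _) _) (temperate_const_smul _
          ((temperate_inner_mul hαk _).add (Function.HasTemperateGrowth.sum fun j _ => hβ2 j)))]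
      congr 1
      ext ζ
      simp only [Pi.add_apply, Pi.smul_apply, smul_eq_mul, dilate_apply, inner_pt_one_zero,
        inner_pt_zero_single, hM]
      have h := hαβ (dil d k ζ)
      -- The form is homogeneous of degree 4 under dilations, so one dyadic step down produces the
      -- 1/16 of `exists_symbol_decomposition`.
      have e1 : (1 : ℝ) ^ 2 * parForm (dil d (k - 1) ζ) = 1 / 16 * parForm (dil d k ζ) := by
        rw [parForm_dil, parForm_dil, zpow_sub_one₀ two_ne_zero]; ring
      have e2 : (1 : ℝ) ^ 2 * parForm (dil d k ζ) = parForm (dil d k ζ) := by ring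
      have e3 : ∀ j, (dil d k ζ).snd j = (2 : ℝ) ^ k * ζ.snd j := fun j => rfl
      have e4 : (dil d k ζ).fst = ((2 : ℝ) ^ k) ^ 2 * ζ.fst := by
        rw [dil_fst, mul_comm 2 k, zpow_mul]; norm_cast
      rw [e1, e2]
      simp only [e3, e4, Complex.ofReal_mul, Complex.ofReal_pow] at h
      generalize (((2 : ℝ) ^ k : ℝ) : ℂ) = r at *
      have e5 : ∀ b : ℂ, ∑ j, -(2 * (Real.pi : ℂ) * Complex.I) * (r * (ζ.snd j : ℂ)) *
          (-(2 * (Real.pi : ℂ) * Complex.I) * (r * (ζ.snd j : ℂ)) * b) =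
          r ^ 2 * ∑ j, -(2 * (Real.pi : ℂ) * Complex.I) * (ζ.snd j : ℂ) *
          (-(2 * (Real.pi : ℂ) * Complex.I) * (ζ.snd j : ℂ) * b) := by
        intro b
        rw [Finset.mul_sum]
        exact Finset.sum_congr rfl fun j _ => by ring
      rw [e5] at h
      -- Dilation multiplies ξ_i by 2 ^ k but τ and |ξ|² by 2 ^ (2 * k); cancelling one factor
      -- leaves the gain 2 ^ k.
      refine mul_left_cancel₀ hk ?_
      linear_combination h
    rw [spaceDeriv_apply, spaceDeriv_apply, timeDeriv_apply, spaceLaplacian_apply, key, map_add,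
      map_smul, map_add, smul_eq_mul]
    ring
  · have hk : (((2 : ℝ) ^ k : ℝ) : ℂ) ≠ 0 := by
      exact_mod_cast (by positivity : (2 : ℝ) ^ k ≠ 0)
    have hc : ∀ (c : ℂ) (ψ : 𝓢(SpaceTime d, ℂ)), c * u ψ = u (c • ψ) := fun c ψ => by
      rw [map_smul, smul_eq_mul]
    rw [spaceDeriv_apply, biheat_apply, multT_comp (biheatSymbol_hasTemperateGrowth _)
      (dilate k D).hasTemperateGrowth, lineDerivOp_multT (dilate k M).hasTemperateGrowth,
      hc, ← multT_smul ((biheatSymbol_hasTemperateGrowth _).mul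
      (dilate k D).hasTemperateGrowth), ← map_neg]
    congr 1
    rw [← neg_one_smul ℂ, ← multT_smul (temperate_inner_mul (dilate k M).hasTemperateGrowth _)]
    congr 1
    ext ζ
    simp only [Pi.smul_apply, Pi.mul_apply, smul_eq_mul, dilate_apply, inner_pt_zero_single, hM,
      hD, smulLeftCLM_apply_apply hHD, hH, biheatSymbol_eq, parForm_dil]
    have e3 : ∀ j, (dil d k ζ).snd j = (2 : ℝ) ^ k * ζ.snd j := fun j => rfl
    have e4 : Real.exp (-(1 ^ 2 * (((2 : ℝ) ^ k) ^ 4 * parForm ζ))) =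
        Real.exp (-(((2 : ℝ) ^ (2 * k) / Real.sqrt 2) ^ 2 * parForm ζ)) *
        Real.exp (-((Real.sqrt 2)⁻¹ ^ 2 * (((2 : ℝ) ^ k) ^ 4 * parForm ζ))) := by
      rw [← Real.exp_add, div_pow, inv_pow, Real.sq_sqrt zero_le_two, mul_comm 2 k, zpow_mul]
      congr 1
      norm_cast
      ring
    rw [e3, e4, zpow_neg]
    simp only [Complex.ofReal_mul, Complex.ofReal_inv, Complex.ofReal_ofNat]
    field_simp

end Symbols

/-! ### Local integrability of majorants. -/

section LocallyFinite

open Filter Topology Set Metric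

variable {d : ℕ}

/-- `F` has finite integrals over compact sets. -/
def LocFinite (F : SpaceTime d → ℝ≥0∞) : Prop := ∀ K, IsCompact K → ∫⁻ z in K, F z < ∞

theorem locFinite_const {c : ℝ≥0∞} (hc : c ≠ ∞) : LocFinite fun _ : SpaceTime d => c := by
  intro K hK
  rw [setLIntegral_const]
  exact ENNReal.mul_lt_top hc.lt_top hK.measure_lt_top

theorem LocFinite.add {F G : SpaceTime d → ℝ≥0∞} (hF : LocFinite F) (hG : LocFinite G)
    (hFm : Measurable F) : LocFinite fun z => F z + G z := by
  intro K hK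
  rw [lintegral_add_left hFm]
  exact ENNReal.add_lt_top.2 ⟨hF K hK, hG K hK⟩

theorem LocFinite.const_mul {F : SpaceTime d → ℝ≥0∞} (hF : LocFinite F) {c : ℝ≥0∞} (hc : c ≠ ∞) :
    LocFinite fun z => c * F z := by
  intro K hK
  rw [lintegral_const_mul' _ _ hc]
  exact ENNReal.mul_lt_top hc.lt_top (hF K hK)

theorem LocFinite.lintegral_mul_lt_top {F : SpaceTime d → ℝ≥0∞} (hF : LocFinite F)
    (φ : 𝓢(SpaceTime d, ℂ)) (hφ : HasCompactSupport (φ : SpaceTime d → ℂ)) :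
    ∫⁻ z, ‖φ z‖ₑ * F z < ∞ := by
  obtain ⟨c, hc0, hc⟩ := φ.decay 0 0
  simp only [pow_zero, one_mul, norm_iteratedFDeriv_zero] at hc
  refine lt_of_le_of_lt ?_ ((hF.const_mul (c := ENNReal.ofReal c) ENNReal.ofReal_ne_top) _ hφ)
  rw [← lintegral_indicator hφ.isClosed.measurableSet]
  refine lintegral_mono fun z => ?_
  by_cases hz : z ∈ tsupport φ
  · rw [indicator_of_mem hz]
    gcongr
    rw [← ofReal_norm]
    exact ENNReal.ofReal_le_ofReal (hc z)
  · rw [indicator_of_notMem hz, image_eq_zero_of_notMem_tsupport hz]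
    simp

theorem LocFinite.ae_lt_top {F : SpaceTime d → ℝ≥0∞} (hF : LocFinite F) (hFm : Measurable F) :
    ∀ᵐ z, F z < ∞ := by
  have h : ∀ n : ℕ, ∀ᵐ z ∂(volume.restrict (closedBall (0 : SpaceTime d) n)), F z < ∞ := fun n =>
    MeasureTheory.ae_lt_top hFm (hF _ (isCompact_closedBall 0 (n : ℝ))).ne
  have h2 := (ae_restrict_iUnion_iff _ _).2 h
  rwa [iUnion_closedBall_nat, Measure.restrict_univ] at h2

theorem LocFinite.locallyIntegrable {F : SpaceTime d → ℝ≥0∞} (hF : LocFinite F)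
    {h : SpaceTime d → ℂ} (hm : AEStronglyMeasurable h volume) (hle : ∀ z, ‖h z‖ₑ ≤ F z) :
    LocallyIntegrable h := by
  rw [locallyIntegrable_iff]
  intro K hK
  refine ⟨hm.restrict, ?_⟩
  rw [hasFiniteIntegral_iff_enorm]
  exact (lintegral_mono hle).trans_lt (hF K hK)

theorem integrable_mul_of_locallyIntegrable {h : SpaceTime d → ℂ} (hh : LocallyIntegrable h)
    (φ : 𝓢(SpaceTime d, ℂ)) (hφ : HasCompactSupport (φ : SpaceTime d → ℂ)) :
    Integrable fun z => φ z * h z :=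
  hh.integrable_smul_left_of_hasCompactSupport φ.continuous hφ

theorem ae_eq_of_integral_schwartz_eq {f g : SpaceTime d → ℂ} (hf : LocallyIntegrable f)
    (hg : LocallyIntegrable g) (h : ∀ φ : 𝓢(SpaceTime d, ℂ),
      HasCompactSupport (φ : SpaceTime d → ℂ) → ∫ z, φ z * f z = ∫ z, φ z * g z) :
    ∀ᵐ z, f z = g z := by
  refine ae_eq_of_integral_contDiff_smul_eq hf hg fun ψ hψ hψc => ?_
  have h1 : HasCompactSupport (Complex.ofRealCLM ∘ ψ) := hψc.comp_left rfl
  have h2 : ContDiff ℝ (⊤ : ℕ∞) (Complex.ofRealCLM ∘ ψ) := Complex.ofRealCLM.contDiff.comp hψ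
  exact h (h1.toSchwartzMap h2) h1

end LocallyFinite

/-! ### Optimisation over dyadic scales. -/

section Optimise

open Filter Topology

/-- The two terms balance at 2 ^ k = (N/M)^(1/(2+δ)), and the nearest dyadic scale below loses only
a constant. -/
theorem le_interpolation_of_forall_dyadic {δ a N M C : ℝ} (hδ : 0 < δ) (hN : 0 ≤ N) (hM : 0 ≤ M)
    (hC : 0 ≤ C) (h : ∀ k : ℤ, a ≤ C * (((2 : ℝ) ^ k) ^ (-(1 + δ)) * N + (2 : ℝ) ^ k * M)) :
    a ≤ C * (2 ^ (1 + δ) + 1) * (N ^ (1 / (2 + δ)) * M ^ ((1 + δ) / (2 + δ))) := by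
  have hs : 0 < 2 + δ := by linarith
  -- `N` or `M` may vanish, so both are first raised by `ε`, which then tends to zero.
  have key : ∀ ε : ℝ, 0 < ε → a ≤ C * (2 ^ (1 + δ) + 1) *
      ((N + ε) ^ (1 / (2 + δ)) * (M + ε) ^ ((1 + δ) / (2 + δ))) := by
    intro ε hε
    have hN' : 0 < N + ε := by linarith
    have hM' : 0 < M + ε := by linarith
    set N' := N + ε
    set M' := M + ε
    set t := (N' / M') ^ (1 / (2 + δ)) with ht
    have ht0 : 0 < t := by positivity
    obtain ⟨k, hk1, hk2⟩ := exists_mem_Ico_zpow ht0 (one_lt_two (α := ℝ))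
    rw [zpow_add_one₀ two_ne_zero] at hk2
    have e1 : t * M' = N' ^ (1 / (2 + δ)) * M' ^ ((1 + δ) / (2 + δ)) := by
      have : (1 + δ) / (2 + δ) = 1 - 1 / (2 + δ) := by field_simp; ring
      rw [this, Real.rpow_sub hM', Real.rpow_one, ht, Real.div_rpow hN'.le hM'.le]
      ring
    have e2 : t ^ (-(1 + δ)) * N' = N' ^ (1 / (2 + δ)) * M' ^ ((1 + δ) / (2 + δ)) := by
      have e3 : (1 / (2 + δ) : ℝ) = 1 - (1 + δ) / (2 + δ) := by field_simp; ring
      rw [ht, ← Real.rpow_mul (by positivity)]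
      have e4 : 1 / (2 + δ) * (-(1 + δ)) = -((1 + δ) / (2 + δ)) := by ring
      rw [e4, Real.rpow_neg (by positivity), Real.div_rpow hN'.le hM'.le, e3, Real.rpow_sub hN',
        Real.rpow_one]
      field_simp
    -- The loss 2^(1+δ) comes from 2 ^ k > t / 2.
    have e5 : ((2 : ℝ) ^ k) ^ (-(1 + δ)) ≤ 2 ^ (1 + δ) * t ^ (-(1 + δ)) := by
      have h1 : t / 2 ≤ 2 ^ k := by linarith
      have h2 := Real.rpow_le_rpow_of_nonpos (z := -(1 + δ)) (by positivity) h1 (by linarith)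
      refine h2.trans (le_of_eq ?_)
      rw [Real.div_rpow ht0.le zero_le_two, Real.rpow_neg zero_le_two]
      field_simp
    calc a ≤ C * (((2 : ℝ) ^ k) ^ (-(1 + δ)) * N + (2 : ℝ) ^ k * M) := h k
      _ ≤ C * (2 ^ (1 + δ) * t ^ (-(1 + δ)) * N' + t * M') := by
        gcongr
        · exact (le_add_of_nonneg_right hε.le)
        · exact (le_add_of_nonneg_right hε.le)
      _ = _ := by rw [mul_assoc, e2, e1]; ring
  have hcont : Continuous fun ε : ℝ => C * (2 ^ (1 + δ) + 1) *
      ((N + ε) ^ (1 / (2 + δ)) * (M + ε) ^ ((1 + δ) / (2 + δ))) := by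
    refine continuous_const.mul (Continuous.mul ?_ ?_)
    · exact (Real.continuous_rpow_const (by positivity)).comp (continuous_const.add continuous_id)
    · exact (Real.continuous_rpow_const (by positivity)).comp (continuous_const.add continuous_id)
  have hlim := (hcont.tendsto 0).mono_left (nhdsWithin_le_nhds (s := Set.Ioi 0))
  simp only [add_zero] at hlim
  exact ge_of_tendsto hlim (eventually_mem_nhdsWithin.mono fun ε hε => key ε hε)

theorem enorm_le_interpolation_of_forall_dyadic {δ : ℝ} (hδ : 0 < δ) {a N M : ℝ≥0∞} (C : ℝ≥0)
    (hN : N ≠ ∞) (hM : M ≠ ∞)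
    (h : ∀ k : ℤ, a ≤ C * (ENNReal.ofReal (((2 : ℝ) ^ k) ^ (-(1 + δ))) * N +
      ENNReal.ofReal ((2 : ℝ) ^ k) * M)) :
    a ≤ (C * ((2 : ℝ≥0) ^ (1 + δ) + 1) : ℝ≥0) *
      (N ^ (1 / (2 + δ)) * M ^ ((1 + δ) / (2 + δ))) := by
  lift N to ℝ≥0 using hN
  lift M to ℝ≥0 using hM
  have ha : a ≠ ∞ := by
    refine ne_top_of_le_ne_top ?_ (h 0)
    exact ENNReal.mul_ne_top ENNReal.coe_ne_top (ENNReal.add_ne_top.2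
      ⟨ENNReal.mul_ne_top ENNReal.ofReal_ne_top ENNReal.coe_ne_top,
        ENNReal.mul_ne_top ENNReal.ofReal_ne_top ENNReal.coe_ne_top⟩)
  lift a to ℝ≥0 using ha
  have hs : 0 < 2 + δ := by linarith
  have h' : ∀ k : ℤ, (a : ℝ) ≤ C * (((2 : ℝ) ^ k) ^ (-(1 + δ)) * N + (2 : ℝ) ^ k * M) := by
    intro k
    have h1 := ENNReal.toReal_mono ?_ (h k)
    · rw [ENNReal.toReal_mul, ENNReal.toReal_add, ENNReal.toReal_mul, ENNReal.toReal_mul,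
        ENNReal.toReal_ofReal (by positivity), ENNReal.toReal_ofReal (by positivity)] at h1
      · exact h1
      · exact ENNReal.mul_ne_top ENNReal.ofReal_ne_top ENNReal.coe_ne_top
      · exact ENNReal.mul_ne_top ENNReal.ofReal_ne_top ENNReal.coe_ne_top
    · exact ENNReal.mul_ne_top ENNReal.coe_ne_top (ENNReal.add_ne_top.2
        ⟨ENNReal.mul_ne_top ENNReal.ofReal_ne_top ENNReal.coe_ne_top,
          ENNReal.mul_ne_top ENNReal.ofReal_ne_top ENNReal.coe_ne_top⟩)
  have h2 := le_interpolation_of_forall_dyadic hδ N.coe_nonneg M.coe_nonneg C.coe_nonneg h'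
  rw [← ENNReal.coe_rpow_of_nonneg _ (by positivity), ← ENNReal.coe_rpow_of_nonneg _ (by positivity),
    ← ENNReal.coe_mul, ← ENNReal.coe_mul, ENNReal.coe_le_coe, ← NNReal.coe_le_coe]
  push_cast
  exact h2

end Optimise

/-! ### Bounded representatives of the biheat regularisations. -/

section Linfty

open Filter Topology

variable {d : ℕ}

/-- A bounded function is determined by its distribution, so the infimum in `normLinfty` runs over a
single element and is attained. -/
theorem exists_biheat_eq_integral {δ : ℝ} {u : 𝓢'(SpaceTime d, ℂ)} (hu : normBesov δ u < ∞) {θ : ℝ}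
    (hθ : 0 < θ) : ∃ w : SpaceTime d → ℂ, Measurable w ∧
      (∀ᵐ z, ‖w z‖ₑ ≤ ENNReal.ofReal (θ ^ (-(δ / 2))) * normBesov δ u) ∧
      ∀ φ : 𝓢(SpaceTime d, ℂ), biheat θ u φ = ∫ z, φ z * w z := by
  have h1 : normLinfty (biheat θ u) ≤ ENNReal.ofReal (θ ^ (-(δ / 2))) * normBesov δ u := by
    calc normLinfty (biheat θ u) = ENNReal.ofReal (θ ^ (-(δ / 2))) *
          (ENNReal.ofReal (θ ^ (δ / 2)) * normLinfty (biheat θ u)) := by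
          rw [← mul_assoc, ← ENNReal.ofReal_mul (by positivity), ← Real.rpow_add hθ]
          simp
      _ ≤ _ := by
          gcongr
          exact le_iSup₂_of_le θ hθ le_rfl
  have h2 : normLinfty (biheat θ u) < ∞ :=
    h1.trans_lt (ENNReal.mul_lt_top ENNReal.ofReal_lt_top hu)
  obtain ⟨w, hw⟩ := iInf_lt_iff.1 h2
  obtain ⟨hwu, -⟩ := iInf_lt_iff.1 hw
  have h3 : ‖w‖ₑ ≤ normLinfty (biheat θ u) := by
    refine le_iInf₂ fun w' hw' => le_of_eq ?_
    have hinj := LinearMap.ker_eq_bot.1 (Lp.ker_toTemperedDistributionCLM_eq_bot (F := ℂ)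
      (μ := (volume : Measure (SpaceTime d))) (p := ∞))
    have : w = w' := hinj (hwu.trans hw'.symm)
    rw [this]
  refine ⟨w, (Lp.stronglyMeasurable w).measurable, ?_, fun φ => ?_⟩
  · have h4 := ae_le_eLpNormEssSup (f := w) (μ := (volume : Measure (SpaceTime d)))
    filter_upwards [h4] with z hz
    refine hz.trans ((le_of_eq ?_).trans (h3.trans h1))
    rw [Lp.enorm_def, eLpNorm_exponent_top]
  · rw [← hwu, Lp.toTemperedDistribution_apply]
    rfl

end Linfty

/-! ### Construction of the gradient and its pointwise bound. -/

section Gradient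

open Filter Topology Set FourierTransform

variable {d : ℕ}

/-- `multT σ φ` need not have compact support, so the representation of `v` must first be extended
to all Schwartz functions; a locally finite maximal function is finite somewhere, as that requires.
-/
theorem integral_mul_multFun_eq {v : 𝓢'(SpaceTime d, ℂ)} {f : SpaceTime d → ℂ} (hf : Measurable f)
    (hv : IsRepresentedBy v f) (hloc : LocFinite (parMax fun z => ‖f z‖ₑ))
    {σ φ : 𝓢(SpaceTime d, ℂ)} (hφ : HasCompactSupport (φ : SpaceTime d → ℂ)) {C : ℝ≥0}
    (hC : ∀ z, ∫⁻ w, ‖𝓕 σ (w - z)‖ₑ * ‖f w‖ₑ ≤ C * parMax (fun z => ‖f z‖ₑ) z) :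
    v (multT σ φ) = ∫ z, φ z * multFun σ f z := by
  obtain ⟨z₀, hz₀⟩ := (hloc.ae_lt_top (measurable_parMax hf.enorm)).exists
  rw [apply_eq_integral_of_isRepresentedBy hf hv hz₀]
  exact integral_multT_mul σ φ hf hC
    ((hloc.const_mul ENNReal.coe_ne_top).lintegral_mul_lt_top φ hφ)

theorem tsum_ofReal_two_zpow_sub (k : ℤ) :
    ∑' j : ℕ, ENNReal.ofReal ((2 : ℝ) ^ (k - j)) = 2 * ENNReal.ofReal ((2 : ℝ) ^ k) := by
  have h : ∀ j : ℕ, ENNReal.ofReal ((2 : ℝ) ^ (k - j)) = ENNReal.ofReal ((2 : ℝ) ^ k) * 2⁻¹ ^ j := by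
    intro j
    rw [zpow_sub₀ two_ne_zero, zpow_natCast, div_eq_mul_inv, ENNReal.ofReal_mul (by positivity),
      ← inv_pow, ENNReal.ofReal_pow (by norm_num), ENNReal.ofReal_inv_of_pos (by norm_num)]
    simp
  simp only [h]
  rw [ENNReal.tsum_mul_left, ENNReal.tsum_geometric, ENNReal.one_sub_inv_two, inv_inv, mul_comm]

/-- Summing a telescoping sequence of functionals represented by functions with a geometric
bound. -/
theorem eq_integral_of_telescoping {T : ℂ} {φ : 𝓢(SpaceTime d, ℂ)}
    (hφ : HasCompactSupport (φ : SpaceTime d → ℂ)) {k : ℤ} {U : ℕ → ℂ}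
    {V : SpaceTime d → ℂ} {H : ℕ → SpaceTime d → ℂ} {F : SpaceTime d → ℝ≥0∞}
    (hF : LocFinite F) (hV : LocallyIntegrable V) (hH : ∀ j, StronglyMeasurable (H j))
    (hHF : ∀ j z, ‖H j z‖ₑ ≤ ENNReal.ofReal ((2 : ℝ) ^ (k - j)) * F z)
    (hS : LocallyIntegrable fun z => ∑' j, H j z)
    (hU0 : U 0 = ∫ z, φ z * V z) (hU : ∀ j, U (j + 1) = U j + ∫ z, φ z * H j z)
    (hlim : Tendsto U atTop (𝓝 T)) :
    T = ∫ z, φ z * (V z + ∑' j, H j z) := by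
  have hFφ := hF.lintegral_mul_lt_top φ hφ
  have hHl : ∀ j, LocallyIntegrable (H j) := fun j =>
    (hF.const_mul ENNReal.ofReal_ne_top).locallyIntegrable (hH j).aestronglyMeasurable (hHF j)
  have hi : ∀ j, Integrable fun z => φ z * H j z := fun j =>
    integrable_mul_of_locallyIntegrable (hHl j) φ hφ
  have hle : ∀ j, ∫⁻ z, ‖φ z * H j z‖ₑ ≤ ENNReal.ofReal ((2 : ℝ) ^ (k - j)) *
      ∫⁻ z, ‖φ z‖ₑ * F z := by
    intro j
    rw [← lintegral_const_mul' _ _ ENNReal.ofReal_ne_top]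
    refine lintegral_mono fun z => ?_
    rw [enorm_mul, mul_left_comm]
    exact mul_le_mul_right (hHF j z) _
  have hsum : Summable fun j => ∫ z, ‖φ z * H j z‖ := by
    have h1 : ∑' j : ℕ, ∫⁻ z, ‖φ z * H j z‖ₑ ≠ ∞ := by
      refine ne_top_of_le_ne_top ?_ (ENNReal.tsum_le_tsum hle)
      rw [ENNReal.tsum_mul_right, tsum_ofReal_two_zpow_sub]
      exact ENNReal.mul_ne_top (ENNReal.mul_ne_top (by simp) ENNReal.ofReal_ne_top) hFφ.ne
    refine (ENNReal.summable_toReal h1).congr fun j => ?_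
    rw [integral_norm_eq_lintegral_enorm (hi j).1]
  have h2 := (hasSum_integral_of_summable_integral_norm hi hsum).tendsto_sum_nat
  have h3 : ∀ n, U n = U 0 + ∑ j ∈ Finset.range n, ∫ z, φ z * H j z := by
    intro n
    induction n with
    | zero => simp
    | succ n ih => rw [hU, ih, Finset.sum_range_succ, add_assoc]
  have h4 := tendsto_nhds_unique hlim ((h2.const_add (U 0)).congr fun n => (h3 n).symm)
  rw [h4, hU0]
  simp only [tsum_mul_left, mul_add]
  rw [integral_add (integrable_mul_of_locallyIntegrable hV φ hφ)
    (integrable_mul_of_locallyIntegrable hS φ hφ)]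

/-- For each starting scale `k` the telescoping series gives a function representing ∂_i u, with a
bound depending on `k`. These functions agree almost everywhere, so the scale can be optimised
separately at each point. -/
theorem exists_spaceDeriv_bound (i : Fin d) {δ : ℝ} (hδ : 0 < δ) :
    ∃ C : ℝ≥0, ∀ (u : 𝓢'(SpaceTime d, ℂ)) (f g : SpaceTime d → ℂ), Measurable f → Measurable g →
      normBesov δ u < ∞ → IsRepresentedBy (timeDeriv u) f → IsRepresentedBy (spaceLaplacian u) g →
      LocFinite (parMax fun z => ‖f z‖ₑ) → LocFinite (parMax fun z => ‖g z‖ₑ) →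
      ∃ G : SpaceTime d → ℂ, IsRepresentedBy (spaceDeriv i u) G ∧
        ∀ᵐ z, ‖G z‖ₑ ≤ C * (normBesov δ u ^ (1 / (2 + δ)) *
          (parMax (fun z => ‖f z‖ₑ) z + parMax (fun z => ‖g z‖ₑ) z) ^ ((1 + δ) / (2 + δ))) := by
  obtain ⟨α, β, D, M, hM0, hrel⟩ := exists_telescoping i
  obtain ⟨Cα, hCα⟩ := exists_lintegral_fourier_dilate_le α
  obtain ⟨Cβ, hCβ⟩ := exists_lintegral_fourier_dilate_le β
  obtain ⟨CD, hCD⟩ := exists_lintegral_fourier_dilate_le D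
  set c₀ : ℝ≥0 := (Real.sqrt 2 ^ (δ / 2)).toNNReal
  set C : ℝ≥0 := CD * c₀ + 2 * (Cα + Cβ) with hCdef
  refine ⟨C * ((2 : ℝ≥0) ^ (1 + δ) + 1), fun u f g hf hg hu huf hug hfl hgl => ?_⟩
  set N := normBesov δ u
  set Mf := parMax fun z => ‖f z‖ₑ with hMf
  set Mg := parMax fun z => ‖g z‖ₑ with hMg
  have hMfm : Measurable Mf := measurable_parMax hf.enorm
  have hMgm : Measurable Mg := measurable_parMax hg.enorm
  set F : SpaceTime d → ℝ≥0∞ := fun z => (Cα + Cβ : ℝ≥0) * (Mf z + Mg z) with hFdef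
  have hFl : LocFinite F := (hfl.add hgl hMfm).const_mul ENNReal.coe_ne_top
  have hθ : ∀ k : ℤ, (0 : ℝ) < (2 : ℝ) ^ (2 * k) / Real.sqrt 2 := fun k => by positivity
  choose w hwm hwb hw using fun k : ℤ => exists_biheat_eq_integral hu (hθ k)
  -- The Besov parameter θ is of order 2 ^ (2 * k), so θ^(-δ/2) is (2 ^ k)^(-δ) up to the constant
  -- `c₀`.
  have hθe : ∀ k : ℤ, ENNReal.ofReal (((2 : ℝ) ^ (2 * k) / Real.sqrt 2) ^ (-(δ / 2))) =
      ENNReal.ofReal (((2 : ℝ) ^ k) ^ (-δ)) * c₀ := by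
    intro k
    rw [← ENNReal.ofReal_coe_nnreal (p := c₀), ← ENNReal.ofReal_mul (by positivity),
      Real.coe_toNNReal _ (by positivity)]
    congr 1
    rw [Real.div_rpow (by positivity) (by positivity), Real.rpow_neg (Real.sqrt_nonneg 2),
      div_inv_eq_mul, mul_comm 2 k, zpow_mul]
    congr 1
    have : (((2 : ℝ) ^ k) ^ (2 : ℤ)) = ((2 : ℝ) ^ k) ^ (2 : ℝ) := by
      rw [← Real.rpow_intCast]; norm_num
    rw [this, ← Real.rpow_mul (by positivity)]
    congr 1
    ring
  set V : ℤ → SpaceTime d → ℂ := fun k z => ((2 : ℝ) ^ (-k) : ℝ) * multFun (dilate k D) (w k) z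
  set H : ℤ → SpaceTime d → ℂ := fun k z => ((2 : ℝ) ^ k : ℝ) * multFun (dilate k α) f z -
    ((2 : ℝ) ^ k : ℝ) * multFun (dilate k β) g z
  -- The regularisation at scale 2 ^ k plus all corrections at the scales 2 ^ (k - j), for j ≥ 0.
  set G : ℤ → SpaceTime d → ℂ := fun k z => V k z + ∑' j : ℕ, H (k - j) z
  have hpos : ∀ k : ℤ, ‖(((2 : ℝ) ^ k : ℝ) : ℂ)‖ₑ = ENNReal.ofReal ((2 : ℝ) ^ k) := by
    intro k
    rw [← ofReal_norm, Complex.norm_real, Real.norm_of_nonneg (by positivity)]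
  have hwM : ∀ k z, parMax (fun z => ‖w k z‖ₑ) z ≤
      ENNReal.ofReal (((2 : ℝ) ^ k) ^ (-δ)) * c₀ * N := by
    intro k z
    rw [← hθe]
    exact parMax_le_of_ae_le (hwb k) z
  have hVm : ∀ k, StronglyMeasurable (V k) := fun k =>
    (stronglyMeasurable_multFun _ (hwm k)).const_mul _
  have hHm : ∀ k, StronglyMeasurable (H k) := fun k =>
    ((stronglyMeasurable_multFun _ hf).const_mul _).sub
      ((stronglyMeasurable_multFun _ hg).const_mul _)
  have hVb : ∀ k z, ‖V k z‖ₑ ≤ (CD * c₀ : ℝ≥0) *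
      (ENNReal.ofReal (((2 : ℝ) ^ k) ^ (-(1 + δ))) * N) := by
    intro k z
    have e : ENNReal.ofReal (((2 : ℝ) ^ k) ^ (-(1 + δ))) =
        ENNReal.ofReal ((2 : ℝ) ^ (-k)) * ENNReal.ofReal (((2 : ℝ) ^ k) ^ (-δ)) := by
      rw [← ENNReal.ofReal_mul (by positivity)]
      congr 1
      rw [neg_add, Real.rpow_add (by positivity), Real.rpow_neg_one, zpow_neg]
    calc ‖V k z‖ₑ = ENNReal.ofReal ((2 : ℝ) ^ (-k)) * ‖multFun (dilate k D) (w k) z‖ₑ := by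
          rw [enorm_mul, hpos]
      _ ≤ ENNReal.ofReal ((2 : ℝ) ^ (-k)) *
          (CD * (ENNReal.ofReal (((2 : ℝ) ^ k) ^ (-δ)) * c₀ * N)) := by
          gcongr
          exact ((enorm_multFun_le_lintegral _ _ _).trans (hCD k _ (hwm k) z)).trans
            (mul_le_mul_right (hwM k z) _)
      _ = _ := by
          rw [e, ENNReal.coe_mul]
          ring
  have hHb : ∀ k z, ‖H k z‖ₑ ≤ ENNReal.ofReal ((2 : ℝ) ^ k) * F z := by
    intro k z
    calc ‖H k z‖ₑ ≤ ENNReal.ofReal ((2 : ℝ) ^ k) * ‖multFun (dilate k α) f z‖ₑ +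
          ENNReal.ofReal ((2 : ℝ) ^ k) * ‖multFun (dilate k β) g z‖ₑ := by
          refine (enorm_sub_le).trans (le_of_eq ?_)
          rw [enorm_mul, enorm_mul, hpos]
      _ ≤ ENNReal.ofReal ((2 : ℝ) ^ k) * (Cα * Mf z) + ENNReal.ofReal ((2 : ℝ) ^ k) * (Cβ * Mg z) := by
          gcongr
          · exact (enorm_multFun_le_lintegral _ _ _).trans (hCα k _ hf z)
          · exact (enorm_multFun_le_lintegral _ _ _).trans (hCβ k _ hg z)
      _ = ENNReal.ofReal ((2 : ℝ) ^ k) * (Cα * Mf z + Cβ * Mg z) := by ring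
      _ ≤ _ := by
          gcongr
          rw [hFdef, ENNReal.coe_add]
          calc (Cα : ℝ≥0∞) * Mf z + Cβ * Mg z ≤ (Cα * Mf z + Cβ * Mg z) +
                (Cα * Mg z + Cβ * Mf z) := le_self_add
            _ = _ := by ring
  have hSb : ∀ k z, ‖∑' j : ℕ, H (k - j) z‖ₑ ≤ 2 * ENNReal.ofReal ((2 : ℝ) ^ k) * F z := by
    intro k z
    refine enorm_tsum_le_tsum_enorm.trans ?_
    rw [← tsum_ofReal_two_zpow_sub, ← ENNReal.tsum_mul_right]
    exact ENNReal.tsum_le_tsum fun j => hHb _ z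
  have hFm : Measurable F := (hMfm.add hMgm).const_mul _
  have hFfin := hFl.ae_lt_top hFm
  have hSm : ∀ k, AEStronglyMeasurable (fun z => ∑' j : ℕ, H (k - j) z) volume := by
    intro k
    refine aestronglyMeasurable_of_tendsto_ae atTop
      (f := fun n z => ∑ j ∈ Finset.range n, H (k - j) z) (fun n => ?_) ?_
    · exact (Finset.stronglyMeasurable_fun_sum (Finset.range n)
        fun (j : ℕ) _ => hHm (k - j)).aestronglyMeasurable
    · filter_upwards [hFfin] with z hz
      have h1 : ∑' j : ℕ, ‖H (k - j) z‖ₑ ≠ ∞ := by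
        refine ne_top_of_le_ne_top ?_ (ENNReal.tsum_le_tsum fun j : ℕ => hHb (k - j) z)
        rw [ENNReal.tsum_mul_right, tsum_ofReal_two_zpow_sub]
        exact ENNReal.mul_ne_top (ENNReal.mul_ne_top (by simp) ENNReal.ofReal_ne_top) hz.ne
      have h2 : Summable fun j : ℕ => ‖H (k - j) z‖ := by
        refine (ENNReal.summable_toReal h1).congr fun j => ?_
        exact toReal_enorm _
      exact h2.of_norm.hasSum.tendsto_sum_nat
  have hVl : ∀ k, LocallyIntegrable (V k) := fun k =>
    (locFinite_const (ENNReal.mul_ne_top ENNReal.coe_ne_top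
      (ENNReal.mul_ne_top ENNReal.ofReal_ne_top hu.ne))).locallyIntegrable
      (hVm k).aestronglyMeasurable (hVb k)
  have hSl : ∀ k, LocallyIntegrable fun z => ∑' j : ℕ, H (k - j) z := fun k =>
    (hFl.const_mul (ENNReal.mul_ne_top (by simp) ENNReal.ofReal_ne_top)).locallyIntegrable
      (hSm k) (hSb k)
  have hGl : ∀ k, LocallyIntegrable (G k) := fun k => (hVl k).add (hSl k)
  have hGrep : ∀ k (φ : 𝓢(SpaceTime d, ℂ)), HasCompactSupport (φ : SpaceTime d → ℂ) →
      spaceDeriv i u φ = ∫ z, φ z * G k z := by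
    intro k φ hφ
    refine eq_integral_of_telescoping hφ (k := k)
      (U := fun n => spaceDeriv i u (multT (dilate (k - n) M) φ)) hFl (hVl k)
      (fun j => hHm (k - j)) (fun j => hHb (k - j)) (hSl k) ?_ (fun j => ?_) ?_
    · simp only [Nat.cast_zero, sub_zero]
      rw [(hrel u k φ).2, hw]
      have h1 := integral_multT_mul (dilate k D) φ (hwm k) (hCD k _ (hwm k)) (lt_of_le_of_lt
        (lintegral_mono fun z => mul_le_mul_right (mul_le_mul_right (hwM k z) _) _)
        ((locFinite_const (ENNReal.mul_ne_top (ENNReal.coe_ne_top (r := CD))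
          (ENNReal.mul_ne_top (ENNReal.mul_ne_top ENNReal.ofReal_ne_top ENNReal.coe_ne_top)
            hu.ne))).lintegral_mul_lt_top φ hφ))
      rw [h1, ← integral_const_mul]
      refine integral_congr_ae (Eventually.of_forall fun z => ?_)
      simp only [V]
      ring
    · have e : k - ((j + 1 : ℕ) : ℤ) = k - j - 1 := by push_cast; ring
      simp only [e]
      rw [(hrel u (k - j) φ).1,
        integral_mul_multFun_eq hf huf hfl hφ (hCα (k - j) f hf),
        integral_mul_multFun_eq hg hug hgl hφ (hCβ (k - j) g hg)]
      have hi1 : Integrable fun z => φ z * multFun (dilate (k - j) α) f z :=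
        integrable_mul_of_locallyIntegrable ((hfl.const_mul ENNReal.coe_ne_top).locallyIntegrable
          (stronglyMeasurable_multFun _ hf).aestronglyMeasurable fun z =>
            (enorm_multFun_le_lintegral _ _ _).trans (hCα _ _ hf z)) φ hφ
      have hi2 : Integrable fun z => φ z * multFun (dilate (k - j) β) g z :=
        integrable_mul_of_locallyIntegrable ((hgl.const_mul ENNReal.coe_ne_top).locallyIntegrable
          (stronglyMeasurable_multFun _ hg).aestronglyMeasurable fun z =>
            (enorm_multFun_le_lintegral _ _ _).trans (hCβ _ _ hg z)) φ hφ
      rw [add_sub_assoc]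
      congr 1
      rw [← integral_const_mul, ← integral_const_mul, ← integral_sub (hi1.const_mul _)
        (hi2.const_mul _)]
      refine integral_congr_ae (Eventually.of_forall fun z => ?_)
      simp only [H]
      ring
    · have h1 := tendsto_multT_comp M φ hM0 (tendsto_norm_dil_sub (d := d) k)
      exact ((spaceDeriv i u).continuous.tendsto φ).comp h1
  -- All `G k` represent the same distribution; there are countably many `k`, so one null set serves
  -- for all.
  have hGeq : ∀ᵐ z, ∀ k, G 0 z = G k z := by
    rw [ae_all_iff]
    intro k
    refine ae_eq_of_integral_schwartz_eq (hGl 0) (hGl k) fun φ hφ => ?_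
    rw [← hGrep 0 φ hφ, ← hGrep k φ hφ]
  refine ⟨G 0, ⟨hGl 0, hGrep 0⟩, ?_⟩
  filter_upwards [hGeq, (hfl.add hgl hMfm).ae_lt_top (hMfm.add hMgm)] with z hz hz2
  refine enorm_le_interpolation_of_forall_dyadic hδ C hu.ne hz2.ne fun k => ?_
  rw [hz k]
  calc ‖G k z‖ₑ ≤ ‖V k z‖ₑ + ‖∑' j : ℕ, H (k - j) z‖ₑ := enorm_add_le _ _
    _ ≤ (CD * c₀ : ℝ≥0) * (ENNReal.ofReal (((2 : ℝ) ^ k) ^ (-(1 + δ))) * N) +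
        2 * ENNReal.ofReal ((2 : ℝ) ^ k) * F z := add_le_add (hVb k z) (hSb k z)
    _ = (CD * c₀ : ℝ≥0) * (ENNReal.ofReal (((2 : ℝ) ^ k) ^ (-(1 + δ))) * N) +
        (2 * (Cα + Cβ) : ℝ≥0) * (ENNReal.ofReal ((2 : ℝ) ^ k) * (Mf z + Mg z)) := by
        rw [hFdef]
        push_cast
        ring
    _ ≤ C * (ENNReal.ofReal (((2 : ℝ) ^ k) ^ (-(1 + δ))) * N) +
        C * (ENNReal.ofReal ((2 : ℝ) ^ k) * (Mf z + Mg z)) := by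
        gcongr
        · rw [hCdef]; exact le_self_add
        · rw [hCdef]; exact le_add_self
    _ = _ := by ring

theorem enorm_euclidean_le_sum (x : EuclideanSpace ℂ (Fin d)) : ‖x‖ₑ ≤ ∑ i, ‖x i‖ₑ := by
  have h : ‖x‖ ≤ ∑ i, ‖x i‖ := by
    rw [EuclideanSpace.norm_eq]
    refine Real.sqrt_le_iff.2 ⟨Finset.sum_nonneg fun i _ => norm_nonneg _, ?_⟩
    exact Finset.sum_sq_le_sq_sum_of_nonneg fun i _ => norm_nonneg _
  rw [← ofReal_norm]
  refine (ENNReal.ofReal_le_ofReal h).trans (le_of_eq ?_)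
  rw [ENNReal.ofReal_sum_of_nonneg fun i _ => norm_nonneg _]
  exact Finset.sum_congr rfl fun i _ => ofReal_norm _

/-- Pointwise bound of the space gradient by the maximal functions of `∂_t u` and `Δ u`. -/
theorem exists_spaceGradient_bound (d : ℕ) {δ : ℝ} (hδ : 0 < δ) :
    ∃ C : ℝ≥0, ∀ (u : 𝓢'(SpaceTime d, ℂ)) (f g : SpaceTime d → ℂ), Measurable f → Measurable g →
      normBesov δ u < ∞ → IsRepresentedBy (timeDeriv u) f → IsRepresentedBy (spaceLaplacian u) g →
      LocFinite (parMax fun z => ‖f z‖ₑ) → LocFinite (parMax fun z => ‖g z‖ₑ) →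
      ∃ G : SpaceTime d → EuclideanSpace ℂ (Fin d), IsSpaceGradient u G ∧
        ∀ᵐ z, ‖G z‖ₑ ≤ C * (normBesov δ u ^ (1 / (2 + δ)) *
          (parMax (fun z => ‖f z‖ₑ) z + parMax (fun z => ‖g z‖ₑ) z) ^ ((1 + δ) / (2 + δ))) := by
  choose C hC using fun i : Fin d => exists_spaceDeriv_bound i hδ
  refine ⟨∑ i, C i, fun u f g hf hg hu huf hug hfl hgl => ?_⟩
  choose G hG hGb using fun i => hC i u f g hf hg hu huf hug hfl hgl
  refine ⟨fun z => WithLp.toLp 2 fun i => G i z, fun i => hG i, ?_⟩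
  filter_upwards [ae_all_iff.2 hGb] with z hz
  refine (enorm_euclidean_le_sum _).trans ((Finset.sum_le_sum fun i _ => hz i).trans
    (le_of_eq ?_))
  rw [← Finset.sum_mul, ENNReal.ofNNReal_finsetSum]

end Gradient

/-! ### Transfer to the norms E and F. -/

section Norms

open Filter Topology Set Metric

variable {d : ℕ}

/-- `normE` as a functional of `‖f‖ₑ`. -/
theorem normE_eq_morrey {V : Type*} [NormedAddCommGroup V] (p q β : ℝ) (f : SpaceTime d → V) :
    normE p q β f = morrey 2 1 p q (β - 2 / p - d / q) (volume : Measure ℝ)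
      (volume : Measure (EuclideanSpace ℝ (Fin d))) (fun z => ‖f (WithLp.toLp 2 z)‖ₑ) := by
  unfold normE morrey mixedNorm
  have h1 : ∀ t r : ℝ, {s : ℝ | |t - s| < r} = ball t r := by
    intro t r; ext s; rw [mem_ball, dist_comm]; rfl
  have h2 : ∀ (x : EuclideanSpace ℝ (Fin d)) (r : ℝ),
      {y : EuclideanSpace ℝ (Fin d) | ‖x - y‖ < r} = ball x r := by
    intro x r; ext s; rw [mem_ball, dist_comm, dist_eq_norm]; rfl
  simp only [h1, h2, pow_one]

/-- Here space is the outer variable, so the roles of `p` and `q` and of the radii ρ and ρ² are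
exchanged. -/
theorem normF_eq_morrey {V : Type*} [NormedAddCommGroup V] (p q β : ℝ) (f : SpaceTime d → V) :
    normF p q β f = morrey 1 2 q p (β - 2 / p - d / q)
      (volume : Measure (EuclideanSpace ℝ (Fin d))) (volume : Measure ℝ)
      (fun z => ‖f (WithLp.toLp 2 z.swap)‖ₑ) := by
  unfold normF morrey mixedNorm
  have h1 : ∀ t r : ℝ, {s : ℝ | |t - s| < r} = ball t r := by
    intro t r; ext s; rw [mem_ball, dist_comm]; rfl
  have h2 : ∀ (x : EuclideanSpace ℝ (Fin d)) (r : ℝ),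
      {y : EuclideanSpace ℝ (Fin d) | ‖x - y‖ < r} = ball x r := by
    intro x r; ext s; rw [mem_ball, dist_comm, dist_eq_norm]; rfl
  simp only [h1, h2, pow_one]
  refine iSup_congr fun ρ => iSup_congr fun _ => ?_
  rw [iSup_comm]
  rfl

theorem IsRepresentedBy.congr_ae {v : 𝓢'(SpaceTime d, ℂ)} {f g : SpaceTime d → ℂ}
    (h : IsRepresentedBy v f) (hfg : f =ᵐ[volume] g) : IsRepresentedBy v g := by
  refine ⟨h.1.congr hfg, fun φ hφ => ?_⟩
  rw [h.2 φ hφ]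
  exact integral_congr_ae (hfg.mono fun z hz => by simp only [hz])

/-- The Gagliardo–Nirenberg inequality for norms that are compatible with the parabolic maximal
function. -/
theorem exists_gagliardoNirenberg (d : ℕ) {δ : ℝ} (hδ : 0 < δ)
    {N₀ N₁ : (SpaceTime d → ℝ≥0∞) → ℝ≥0∞}
    (hmono₀ : ∀ F G : SpaceTime d → ℝ≥0∞, F ≤ᵐ[volume] G → N₀ F ≤ N₀ G)
    (hmono₁ : ∀ F G : SpaceTime d → ℝ≥0∞, F ≤ᵐ[volume] G → N₁ F ≤ N₁ G)
    (hadd : ∀ F G, Measurable F → Measurable G → N₀ (fun z => F z + G z) ≤ N₀ F + N₀ G)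
    (hmax : ∃ C : ℝ≥0, ∀ F, Measurable F → N₀ (parMax F) ≤ C * N₀ F)
    (hloc : ∀ F, Measurable F → N₀ F < ∞ → LocFinite F)
    (hpow : ∀ (A : ℝ≥0∞) F, Measurable F →
      N₁ (fun z => A * F z ^ ((1 + δ) / (2 + δ))) ≤ A * N₀ F ^ ((1 + δ) / (2 + δ))) :
    ∃ C : ℝ≥0, ∀ (u : 𝓢'(SpaceTime d, ℂ)) (f g : SpaceTime d → ℂ),
      normBesov δ u < ∞ →
      IsRepresentedBy (timeDeriv u) f → N₀ (fun z => ‖f z‖ₑ) < ∞ →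
      IsRepresentedBy (spaceLaplacian u) g → N₀ (fun z => ‖g z‖ₑ) < ∞ →
      ∃ G : SpaceTime d → EuclideanSpace ℂ (Fin d), IsSpaceGradient u G ∧
        N₁ (fun z => ‖G z‖ₑ) ≤ C * normBesov δ u ^ (1 / (2 + δ)) *
          (N₀ (fun z => ‖f z‖ₑ) + N₀ (fun z => ‖g z‖ₑ)) ^ ((1 + δ) / (2 + δ)) := by
  obtain ⟨C, hC⟩ := exists_spaceGradient_bound d hδ
  obtain ⟨C', hC'⟩ := hmax
  have he : 0 ≤ (1 + δ) / (2 + δ) := by positivity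
  refine ⟨C * C' ^ ((1 + δ) / (2 + δ)), fun u f₀ g₀ hu huf₀ hf₀ hug₀ hg₀ => ?_⟩
  -- The maximal function estimates need genuinely measurable functions; passing to such
  -- representatives does not increase the norms.
  obtain ⟨f, hf, hff⟩ := huf₀.1.aestronglyMeasurable
  obtain ⟨g, hg, hgg⟩ := hug₀.1.aestronglyMeasurable
  have huf := huf₀.congr_ae hff
  have hug := hug₀.congr_ae hgg
  have hfN : N₀ (fun z => ‖f z‖ₑ) ≤ N₀ (fun z => ‖f₀ z‖ₑ) :=
    hmono₀ _ _ (hff.mono fun z hz => by simp only [hz]; exact le_rfl)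
  have hgN : N₀ (fun z => ‖g z‖ₑ) ≤ N₀ (fun z => ‖g₀ z‖ₑ) :=
    hmono₀ _ _ (hgg.mono fun z hz => by simp only [hz]; exact le_rfl)
  have hMf := measurable_parMax hf.measurable.enorm
  have hMg := measurable_parMax hg.measurable.enorm
  have hMfN := hC' _ hf.measurable.enorm
  have hMgN := hC' _ hg.measurable.enorm
  have hlf := hloc _ hMf (hMfN.trans_lt (ENNReal.mul_lt_top ENNReal.coe_lt_top (hfN.trans_lt hf₀)))
  have hlg := hloc _ hMg (hMgN.trans_lt (ENNReal.mul_lt_top ENNReal.coe_lt_top (hgN.trans_lt hg₀)))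
  obtain ⟨G, hG, hGb⟩ := hC u f g hf.measurable hg.measurable hu huf hug hlf hlg
  refine ⟨G, hG, ?_⟩
  set B := normBesov δ u ^ (1 / (2 + δ))
  calc N₁ (fun z => ‖G z‖ₑ) ≤ N₁ (fun z => (C * B) *
        (parMax (fun z => ‖f z‖ₑ) z + parMax (fun z => ‖g z‖ₑ) z) ^ ((1 + δ) / (2 + δ))) := by
        refine hmono₁ _ _ (hGb.mono fun z hz => hz.trans (le_of_eq ?_))
        simp only [mul_assoc, B]
    _ ≤ (C * B) * N₀ (fun z => parMax (fun z => ‖f z‖ₑ) z + parMax (fun z => ‖g z‖ₑ) z) ^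
        ((1 + δ) / (2 + δ)) := hpow _ _ (hMf.add hMg)
    _ ≤ (C * B) * (C' * (N₀ (fun z => ‖f₀ z‖ₑ) + N₀ (fun z => ‖g₀ z‖ₑ))) ^
        ((1 + δ) / (2 + δ)) := by
        gcongr
        refine (hadd _ _ hMf hMg).trans ?_
        rw [mul_add]
        exact add_le_add (hMfN.trans (mul_le_mul_right hfN _))
          (hMgN.trans (mul_le_mul_right hgN _))
    _ = _ := by
        rw [ENNReal.mul_rpow_of_nonneg _ _ he, ENNReal.coe_mul, ENNReal.coe_rpow_of_nonneg _ he]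
        ring

theorem ae_le_toLp {F G : SpaceTime d → ℝ≥0∞} (h : F ≤ᵐ[volume] G) :
    (fun p : ℝ × EuclideanSpace ℝ (Fin d) => F (WithLp.toLp 2 p)) ≤ᵐ[volume.prod volume]
      fun p => G (WithLp.toLp 2 p) :=
  (WithLp.volume_preserving_toLp ℝ (EuclideanSpace ℝ (Fin d))).quasiMeasurePreserving.ae h

theorem ae_le_toLp_swap {F G : SpaceTime d → ℝ≥0∞} (h : F ≤ᵐ[volume] G) :
    (fun p : EuclideanSpace ℝ (Fin d) × ℝ => F (WithLp.toLp 2 p.swap)) ≤ᵐ[volume.prod volume]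
      fun p => G (WithLp.toLp 2 p.swap) :=
  Measure.measurePreserving_swap.quasiMeasurePreserving.ae (ae_le_toLp h)

theorem measurable_toLp {F : SpaceTime d → ℝ≥0∞} (hF : Measurable F) :
    Measurable fun p : ℝ × EuclideanSpace ℝ (Fin d) => F (WithLp.toLp 2 p) :=
  hF.comp (WithLp.measurable_toLp _ _)

theorem measurable_toLp_swap {F : SpaceTime d → ℝ≥0∞} (hF : Measurable F) :
    Measurable fun p : EuclideanSpace ℝ (Fin d) × ℝ => F (WithLp.toLp 2 p.swap) :=
  (measurable_toLp hF).comp measurable_swap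

theorem locFinite_of_lintegral_ball {F : SpaceTime d → ℝ≥0∞} (hF : Measurable F)
    (h : ∀ ρ : ℝ, 0 < ρ → ∫⁻ t in ball (0 : ℝ) (ρ ^ 2), ∫⁻ x in ball
      (0 : EuclideanSpace ℝ (Fin d)) (ρ ^ 1), F (pt t x) < ∞) : LocFinite F := by
  intro K hK
  obtain ⟨R, hR0, hR⟩ := hK.isBounded.subset_closedBall_lt 0 0
  refine lt_of_le_of_lt ?_ (h (R + 1) (by positivity))
  rw [← lintegral_indicator hK.measurableSet, lintegral_spaceTime (hF.indicator hK.measurableSet),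
    ← lintegral_indicator measurableSet_ball]
  refine lintegral_mono fun t => ?_
  by_cases ht : t ∈ ball (0 : ℝ) ((R + 1) ^ 2)
  · rw [indicator_of_mem ht, ← lintegral_indicator measurableSet_ball]
    refine lintegral_mono fun x => ?_
    by_cases hx : x ∈ ball (0 : EuclideanSpace ℝ (Fin d)) ((R + 1) ^ 1)
    · rw [indicator_of_mem hx]
      exact indicator_le_self _ _ _
    · rw [indicator_of_notMem hx, indicator_of_notMem]
      intro hK'
      refine hx ?_
      have h1 := hR hK'
      rw [mem_closedBall_zero_iff] at h1
      rw [mem_ball_zero_iff, pow_one]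
      exact lt_of_le_of_lt ((WithLp.norm_snd_le _ (pt t x)).trans h1) (by linarith)
  · rw [indicator_of_notMem ht]
    refine le_of_eq (lintegral_eq_zero_of_ae_eq_zero (Eventually.of_forall fun x => ?_))
    refine indicator_of_notMem ?_ _
    intro hK'
    refine ht ?_
    have h1 := hR hK'
    rw [mem_closedBall_zero_iff] at h1
    rw [mem_ball_zero_iff]
    exact lt_of_le_of_lt ((WithLp.norm_fst_le _ (pt t x)).trans h1) (by nlinarith)

/-- Tonelli's theorem. Hence the maximal function, defined with time as outer variable, can also be
estimated in the F norms. -/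
theorem cylAvg_swap {X Y : Type*} [NormedAddCommGroup X] [NormedSpace ℝ X] [FiniteDimensional ℝ X]
    [MeasurableSpace X] [BorelSpace X] [NormedAddCommGroup Y] [NormedSpace ℝ Y]
    [FiniteDimensional ℝ Y] [MeasurableSpace Y] [BorelSpace Y] (a b : ℕ) (μ : Measure X)
    [μ.IsAddHaarMeasure] (ν : Measure Y) [ν.IsAddHaarMeasure] (k : ℤ) {F : X × Y → ℝ≥0∞}
    (hF : Measurable F) (x : X) (y : Y) :
    cylAvg b a ν μ k (fun p => F p.swap) y x = cylAvg a b μ ν k F x y := by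
  unfold cylAvg ballAvg
  rw [lintegral_const_mul' _ _ (ENNReal.inv_ne_top.2 (closedBall_measure_ne_zero _ _)),
    lintegral_const_mul' _ _ (ENNReal.inv_ne_top.2 (closedBall_measure_ne_zero _ _)), mul_left_comm,
    lintegral_lintegral_swap]
  · rfl
  · exact (hF.comp measurable_swap).aemeasurable

theorem parMax_toLp_swap {F : SpaceTime d → ℝ≥0∞} (hF : Measurable F) :
    (fun p : EuclideanSpace ℝ (Fin d) × ℝ => parMax F (WithLp.toLp 2 p.swap)) =
      cylMax 1 2 volume volume fun p => F (WithLp.toLp 2 p.swap) := by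
  funext p
  exact iSup_congr fun k => (cylAvg_swap 2 1 volume volume k (measurable_toLp hF) p.2 p.1).symm

end Norms

end ParabolicGN

end

/-! ### The Gagliardo–Nirenberg inequality in both scales of spaces. -/

theorem mainTheorem9 (d : ℕ) (δ p q β : ℝ) (hδ : 0 < δ) (hp : 1 < p) (hq : 1 < q)
    (hβ : 0 < β) (hβ' : β < 2 / p + d / q) :
    (∃ C : ℝ≥0, ∀ (u : 𝓢'(SpaceTime d, ℂ)) (f g : SpaceTime d → ℂ),
      normBesov δ u < ∞ →
      IsRepresentedBy (timeDeriv u) f → normE p q β f < ∞ →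
      IsRepresentedBy (spaceLaplacian u) g →
        normE p q β g < ∞ →
      ∃ G : SpaceTime d → EuclideanSpace ℂ (Fin d),
        IsSpaceGradient u G ∧
        normE ((2 + δ) / (1 + δ) * p) ((2 + δ) / (1 + δ) * q)
            ((1 + δ) / (2 + δ) * β) G ≤
          C * normBesov δ u ^ (1 / (2 + δ)) *
            (normE p q β f + normE p q β g) ^ ((1 + δ) / (2 + δ))) ∧
    (∃ C : ℝ≥0, ∀ (u : 𝓢'(SpaceTime d, ℂ)) (f g : SpaceTime d → ℂ),
      normBesov δ u < ∞ →
      IsRepresentedBy (timeDeriv u) f → normF p q β f < ∞ →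
      IsRepresentedBy (spaceLaplacian u) g →
        normF p q β g < ∞ →
      ∃ G : SpaceTime d → EuclideanSpace ℂ (Fin d),
        IsSpaceGradient u G ∧
        normF ((2 + δ) / (1 + δ) * p) ((2 + δ) / (1 + δ) * q)
            ((1 + δ) / (2 + δ) * β) G ≤
          C * normBesov δ u ^ (1 / (2 + δ)) *
            (normF p q β f + normF p q β g) ^ ((1 + δ) / (2 + δ))) := by
  have hp0 : 0 < p := by linarith
  have hq0 : 0 < q := by linarith
  set s := (2 + δ) / (1 + δ) with hs
  have hs0 : 0 < s := by positivity
  have hs1 : (1 + δ) / (2 + δ) = 1 / s := by rw [hs, one_div_div]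
  -- The whole Morrey weight exponent is divided by `s`, which is exactly its scaling under the
  -- power 1/s.
  have hγ : (1 + δ) / (2 + δ) * β - 2 / (s * p) - d / (s * q) = (β - 2 / p - d / q) / s := by
    rw [hs1]
    field_simp
  simp only [normE_eq_morrey, normF_eq_morrey, hγ]
  constructor
  · have e : β - (2 : ℕ) * Module.finrank ℝ ℝ / p -
        (1 : ℕ) * Module.finrank ℝ (EuclideanSpace ℝ (Fin d)) / q = β - 2 / p - d / q := by
      simp
    refine exists_gagliardoNirenberg d hδ
      (N₀ := fun F => morrey 2 1 p q (β - 2 / p - d / q) volume volume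
        fun z => F (WithLp.toLp 2 z))
      (N₁ := fun F => morrey 2 1 (s * p) (s * q) ((β - 2 / p - d / q) / s) volume volume
        fun z => F (WithLp.toLp 2 z))
      (fun F G h => morrey_mono hp0 hq0 (ae_le_toLp h))
      (fun F G h => morrey_mono (by positivity) (by positivity) (ae_le_toLp h))
      (fun F G hF hG => morrey_add_le hp.le hq.le (measurable_toLp hF) (measurable_toLp hG))
      ?_ (fun F hF hfin => locFinite_of_lintegral_ball hF fun ρ hρ => ?_)
      (fun A F hF => ?_)
    · obtain ⟨C, hC⟩ := exists_morrey_cylMax_le (a := 2) (b := 1) two_ne_zero one_ne_zero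
        (volume : Measure ℝ) (volume : Measure (EuclideanSpace ℝ (Fin d))) hp hq hβ
      rw [e] at hC
      exact ⟨C, fun F hF => hC _ (measurable_toLp hF)⟩
    · obtain ⟨C, hC⟩ := exists_lintegral_cylinder_le_morrey 2 1
        (volume : Measure ℝ) (volume : Measure (EuclideanSpace ℝ (Fin d))) hp.le hq.le β
      rw [e] at hC
      exact (hC _ (measurable_toLp hF) ρ hρ 0 0).trans_lt
        (ENNReal.mul_lt_top (ENNReal.mul_lt_top ENNReal.coe_lt_top ENNReal.ofReal_lt_top) hfin)
    · simp only [hs1]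
      exact morrey_const_mul_rpow_le hp0 hq0 hs0 A (measurable_toLp hF)
  · have e : β - (1 : ℕ) * Module.finrank ℝ (EuclideanSpace ℝ (Fin d)) / q -
        (2 : ℕ) * Module.finrank ℝ ℝ / p = β - 2 / p - d / q := by
      simp
      ring
    refine exists_gagliardoNirenberg d hδ
      (N₀ := fun F => morrey 1 2 q p (β - 2 / p - d / q) volume volume
        fun z => F (WithLp.toLp 2 z.swap))
      (N₁ := fun F => morrey 1 2 (s * q) (s * p) ((β - 2 / p - d / q) / s) volume volume
        fun z => F (WithLp.toLp 2 z.swap))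
      (fun F G h => morrey_mono hq0 hp0 (ae_le_toLp_swap h))
      (fun F G h => morrey_mono (by positivity) (by positivity) (ae_le_toLp_swap h))
      (fun F G hF hG => morrey_add_le hq.le hp.le (measurable_toLp_swap hF)
        (measurable_toLp_swap hG))
      ?_ (fun F hF hfin => locFinite_of_lintegral_ball hF fun ρ hρ => ?_)
      (fun A F hF => ?_)
    · obtain ⟨C, hC⟩ := exists_morrey_cylMax_le (a := 1) (b := 2) one_ne_zero two_ne_zero
        (volume : Measure (EuclideanSpace ℝ (Fin d))) (volume : Measure ℝ) hq hp hβ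
      rw [e] at hC
      refine ⟨C, fun F hF => ?_⟩
      simp only [parMax_toLp_swap hF]
      exact hC _ (measurable_toLp_swap hF)
    · obtain ⟨C, hC⟩ := exists_lintegral_cylinder_le_morrey 1 2
        (volume : Measure (EuclideanSpace ℝ (Fin d))) (volume : Measure ℝ) hq.le hp.le β
      rw [e] at hC
      rw [lintegral_lintegral_swap (f := fun t x => F (pt t x)) (measurable_toLp hF).aemeasurable]
      exact (hC _ (measurable_toLp_swap hF) ρ hρ 0 0).trans_lt
        (ENNReal.mul_lt_top (ENNReal.mul_lt_top ENNReal.coe_lt_top ENNReal.ofReal_lt_top) hfin)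
    · simp only [hs1]
      exact morrey_const_mul_rpow_le hq0 hp0 hs0 A (measurable_toLp_swap hF)
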